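/- **Setting.** A *non-quasianalytic weight function* is a continuous increasing $\omega:[0,\infty)\to[0,\infty)$ such that ($\alpha$) $\omega(2t)\le L(\omega(t)+1)$ for some $L>0$ and all $t\ge 0$; ($\beta$) $\int_1^\infty \omega(t)t^{-2}\,dt<\infty$; ($\gamma$) $\log t=o(\omega(t))$ as $t\to\infty$; ($\delta$) $\varphi_\omega(t)=\omega(e^t)$ is convex. Put $\varphi^*_\omega(y)=\sup_{t\ge0}(yt-\varphi_\omega(t))$. For an open set $\Omega\subseteq\mathbb R^n$ the Roumieu class $\mathcal E_{\{\omega\}}(\Omega)$ (resp. the Beurling class $\mathcal E_{(\omega)}(\Omega)$) is the set of $f\in C^\infty(\Omega)$ such that for every compact $K\subset\Omega$ and some (resp. every) $\lambda>0$ one has $\sup_{\alpha}\sup_{x\in K}|\partial^\alpha f(x)|e^{-\lambda\varphi^*_\omega(|\alpha|/\lambda)}<\infty$. For an operator $P=P(x,D)=\sum_{|\alpha|\le m}a_\alpha(x)D^\alpha$, $D=-i\partial$, the class $\mathcal E^P_{(\omega)}(\Omega)$ is the set of $f\in C^\infty(\Omega)$ such that for every compact $K\subset\Omega$ and every $k\in\mathbb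 N$, $k\ge1$, there is $c>0$ with $\|P^qf\|_{L^2(K)}\le c\,e^{k\varphi^*_\omega(qm/k)}$ for all $q\in\mathbb N_0$; and $\mathcal E^P_{\{\omega\}}(\Omega)$ is the set of $f\in C^\infty(\Omega)$ such that for every compact $K\subset\Omega$ there are $k\in\mathbb N$, $k\ge 1$, and $c>0$ with $\|P^qf\|_{L^2(K)}\le c\,e^{\frac1k\varphi^*_\omega(qmk)}$ for all $q\in\mathbb N_0$. **Statement.** Let $\Omega\subseteq\mathbb R^n$ be open and connected, $m\ge1$, and let $P=\sum_{|\alpha|\le m}a_\alpha(x)D^\alpha$ have (complex-valued) real analytic coefficients in $\Omega$. Suppose that $P$ is not elliptic at $(x_0,\xi_0)$, where $x_0\in\Omega$, $\xi_0\in\mathbb R^n$, $|\xi_0|=1$, i.e. $P_m(x_0,\xi_0)=\sum_{|\alpha|=m}a_\alpha(x_0)\xi_0^\alpha=0$. Let $s>1$. Call $(\sigma,\varepsilon,\delta,\chi)$ admissible if $1<\sigma<s$, $0<\varepsilon<\frac{m(s-\sigma)}{2ms-\sigma}$, $\delta>0$, $\overline{B(x_0,2\delta)}\subset\Omega$, and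 $\chi\in\mathcal E_{(t^{1/\sigma})}(\mathbb R^n)$ has $\operatorname{supp}\chi\subset B(0,2\delta)$ and $\chi=1$ in a neighbourhood of $0$. Then: 1. For all $\sigma,\varepsilon,\delta$ as above there is $\chi$ such that $(\sigma,\varepsilon,\delta,\chi)$ is admissible. 2. Let $(\sigma,\varepsilon,\delta,\chi)$ be admissible, $\eta=\frac{m-\varepsilon}{ms}$ and $$u(x)=\int_1^{\infty}\chi\big(\rho^\varepsilon(x-x_0)\big)e^{-\rho^\eta}e^{i\rho\langle x-x_0,\xi_0\rangle}\,d\rho .$$ Then $0<\eta<1/s$; with $D_{\xi_0}=-i\partial_{\xi_0}$, $(D_{\xi_0}^ju)(x_0)=\frac1\eta\Gamma\big(\frac{j+1}\eta\big)+o(1)$ as $j\to\infty$; $u\in\mathcal E_{\{t^\eta\}}(\mathbb R^n)$; $u\notin\mathcal E_{\{t^{1/s'}\}}(U)$ for every $0<s'<1/\eta$ and every open $U\ni x_0$; and $u\in\mathcal E^P_{\{t^{1/s}\}}(\Omega)$. Moreover, for every $s'$ with $s<s'<1/\eta$ and every subadditive non-quasianalytic weight function $\omega$ with $\omega(t)=o(t^{1/s})$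 and $t^{1/s'}=o(\omega(t))$ as $t\to\infty$, $$u\in\mathcal E^P_{\{\omega\}}(\Omega)\setminus\mathcal E_{\{\omega\}}(\Omega)\quad\text{and}\quad u\in\mathcal E^P_{(\omega)}(\Omega)\setminus\mathcal E_{(t^{1/s'})}(\Omega).$$ 3. There is a subadditive non-quasianalytic weight function $\omega$ with $\omega(t)=t^{1/s}/\log t$ for all large $t$; it satisfies $\omega(t)=o(t^{1/s})$ and $t^{1/s'}=o(\omega(t))$ for every $s'>s$, and for no $r>1$ are $\omega(t)$ and $t^{1/r}$ of the same order of growth as $t\to\infty$. 4. Consequently ellipticity cannot be dropped in the Kotake–Narasimhan theorems for these classes: there is $s'>s$ such that for every subadditive non-quasianalytic weight function $\omega$ with $\omega(t)=o(t^{1/s})$ and $t^{1/s'}=o(\omega(t))$, all $a_\alpha$ lie in $\mathcal E_{\{\omega\}}(\Omega)\cap\mathcal E_{(\omega)}(\Omega)$, but $\mathcal E_{\{\omega\}}(\Omega)\ne\mathcal E^P_{\{\omega\}}(\Omega)$, and $\tau(t)=t^{1/s'}$ is a subadditive non-quasianalytic weight function with $\tau=o(\omega)$ and $\mathcal E^P_{(\omega)}(\Omega)\not\subseteq\mathcal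 E_{(\tau)}(\Omega)$. -/

import Mathlib

open Set Filter Topology MeasureTheory Asymptotics

noncomputable section

namespace Ultradiff

/-! ### Weight functions -/

/-- Non-quasianalytic weight functions; only the values on `[0, ∞)` matter. -/
structure IsWeight (ω : ℝ → ℝ) : Prop where
  continuousOn : ContinuousOn ω (Ici 0)
  monotoneOn : MonotoneOn ω (Ici 0)
  nonneg : ∀ t, 0 ≤ t → 0 ≤ ω t
  alpha : ∃ L : ℝ, 0 < L ∧ ∀ t, 0 ≤ t → ω (2 * t) ≤ L * (ω t + 1)
  beta : IntegrableOn (fun t : ℝ => ω t / t ^ 2) (Ioi 1)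
  gamma : Real.log =o[atTop] ω
  delta : ConvexOn ℝ univ (fun t : ℝ => ω (Real.exp t))

/-- Subadditivity on `[0, ∞)`. -/
def IsSubadd (ω : ℝ → ℝ) : Prop :=
  ∀ t₁ t₂, 0 ≤ t₁ → 0 ≤ t₂ → ω (t₁ + t₂) ≤ ω t₁ + ω t₂

/-- The Gevrey weight `t ↦ t ^ (1 / r)`. -/
def gevreyWeight (r : ℝ) : ℝ → ℝ := fun t => t ^ (1 / r)

/-- The Young conjugate `φ*(y) = sup_{t ≥ 0} (y t - φ(t))` of `φ(t) = ω(exp t)`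
(a finite supremum as soon as `log t = o(ω(t))`). -/
def youngConj (ω : ℝ → ℝ) (y : ℝ) : ℝ :=
  ⨆ t : Ici (0 : ℝ), (y * (t : ℝ) - ω (Real.exp t))

/-! ### Derivatives and differential operators

A function on an open set `Ω ⊆ ℝⁿ` is represented by a function on `ℝⁿ`; its values outside `Ω`
play no role, because derivatives at points of `Ω` are determined by the germ. -/

variable {n : ℕ}

/-- The partial derivative `∂ᵢ f`. -/
def partialD (i : Fin n) (f : EuclideanSpace ℝ (Fin n) → ℂ) : EuclideanSpace ℝ (Fin n) → ℂ :=
  fun x => fderiv ℝ f x (EuclideanSpace.single i 1)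

/-- `∂^α f = ∂₁^{α₁} ⋯ ∂ₙ^{αₙ} f`. -/
def multiD (α : Fin n → ℕ) (f : EuclideanSpace ℝ (Fin n) → ℂ) : EuclideanSpace ℝ (Fin n) → ℂ :=
  (List.finRange n).foldr (fun i g => (partialD i)^[α i] g) f

/-- The operator `P(x, D) f = ∑_{|α| ≤ m} a_α(x) D^α f`, `D = -i ∂`. -/
def diffOp (m : ℕ) (a : (Fin n → ℕ) → EuclideanSpace ℝ (Fin n) → ℂ)
    (f : EuclideanSpace ℝ (Fin n) → ℂ) : EuclideanSpace ℝ (Fin n) → ℂ :=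
  fun x => ∑ k ∈ Finset.range (m + 1), ∑ α ∈ Finset.piAntidiag Finset.univ k,
    a α x * ((-Complex.I) ^ k * multiD α f x)

/-- The principal symbol `P_m(x, ξ) = ∑_{|α| = m} a_α(x) ξ^α`. -/
def principalSymbol (m : ℕ) (a : (Fin n → ℕ) → EuclideanSpace ℝ (Fin n) → ℂ)
    (x ξ : EuclideanSpace ℝ (Fin n)) : ℂ :=
  ∑ α ∈ Finset.piAntidiag Finset.univ m, a α x * ∏ i, ((ξ i : ℝ) : ℂ) ^ α i

/-- The directional derivative `D_ξ = -i ∂_ξ`. -/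
def directionalD (ξ : EuclideanSpace ℝ (Fin n)) (f : EuclideanSpace ℝ (Fin n) → ℂ) :
    EuclideanSpace ℝ (Fin n) → ℂ :=
  fun x => -Complex.I * fderiv ℝ f x ξ

/-! ### Classes of ultradifferentiable functions -/

/-- Finiteness of the seminorm
`p_{K,l}(f) = sup_α sup_{x ∈ K} |∂^α f(x)| exp(-l φ*(|α| / l))`. -/
def SeminormFinite (ω : ℝ → ℝ) (K : Set (EuclideanSpace ℝ (Fin n))) (l : ℝ)
    (f : EuclideanSpace ℝ (Fin n) → ℂ) : Prop :=
  ∃ C : ℝ, ∀ α : Fin n → ℕ, ∀ x ∈ K,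
    ‖multiD α f x‖ * Real.exp (-(l * youngConj ω (((∑ i, α i : ℕ) : ℝ) / l))) ≤ C

/-- The Beurling class `E_(ω)(Ω)`. -/
def beurling (ω : ℝ → ℝ) (Ω : Set (EuclideanSpace ℝ (Fin n))) :
    Set (EuclideanSpace ℝ (Fin n) → ℂ) :=
  {f | ContDiffOn ℝ ((⊤ : ℕ∞) : WithTop ℕ∞) f Ω ∧
    ∀ K, IsCompact K → K ⊆ Ω → ∀ l : ℝ, 0 < l → SeminormFinite ω K l f}

/-- The Roumieu class `E_{ω}(Ω)`. -/
def roumieu (ω : ℝ → ℝ) (Ω : Set (EuclideanSpace ℝ (Fin n))) :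
    Set (EuclideanSpace ℝ (Fin n) → ℂ) :=
  {f | ContDiffOn ℝ ((⊤ : ℕ∞) : WithTop ℕ∞) f Ω ∧
    ∀ K, IsCompact K → K ⊆ Ω → ∃ l : ℝ, 0 < l ∧ SeminormFinite ω K l f}

/-- The Beurling class `E^P_(ω)(Ω)` of the iterates of `P = diffOp m a`. -/
def beurlingIter (m : ℕ) (a : (Fin n → ℕ) → EuclideanSpace ℝ (Fin n) → ℂ)
    (ω : ℝ → ℝ) (Ω : Set (EuclideanSpace ℝ (Fin n))) :
    Set (EuclideanSpace ℝ (Fin n) → ℂ) :=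
  {f | ContDiffOn ℝ ((⊤ : ℕ∞) : WithTop ℕ∞) f Ω ∧
    ∀ K, IsCompact K → K ⊆ Ω → ∀ k : ℕ, 1 ≤ k → ∃ c : ℝ, 0 < c ∧ ∀ q : ℕ,
      eLpNorm ((diffOp m a)^[q] f) 2 (volume.restrict K) ≤
        ENNReal.ofReal (c * Real.exp (k * youngConj ω (q * m / k)))}

/-- The Roumieu class `E^P_{ω}(Ω)` of the iterates of `P = diffOp m a`. -/
def roumieuIter (m : ℕ) (a : (Fin n → ℕ) → EuclideanSpace ℝ (Fin n) → ℂ)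
    (ω : ℝ → ℝ) (Ω : Set (EuclideanSpace ℝ (Fin n))) :
    Set (EuclideanSpace ℝ (Fin n) → ℂ) :=
  {f | ContDiffOn ℝ ((⊤ : ℕ∞) : WithTop ℕ∞) f Ω ∧
    ∀ K, IsCompact K → K ⊆ Ω → ∃ k : ℕ, 1 ≤ k ∧ ∃ c : ℝ, 0 < c ∧ ∀ q : ℕ,
      eLpNorm ((diffOp m a)^[q] f) 2 (volume.restrict K) ≤
        ENNReal.ofReal (c * Real.exp (1 / k * youngConj ω (q * m * k)))}

/-! ### Métivier's function -/

/-- Admissible parameters `σ`, `ε`, `δ` and cut-off function `χ`. -/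
structure IsMetivierData (Ω : Set (EuclideanSpace ℝ (Fin n))) (x₀ : EuclideanSpace ℝ (Fin n))
    (m : ℕ) (s σ ε δ : ℝ) (χ : EuclideanSpace ℝ (Fin n) → ℂ) : Prop where
  one_lt : 1 < σ
  lt_s : σ < s
  eps_pos : 0 < ε
  eps_lt : ε < m * (s - σ) / (2 * m * s - σ)
  delta_pos : 0 < δ
  ball_subset : Metric.closedBall x₀ (2 * δ) ⊆ Ω
  mem_beurling : χ ∈ beurling (gevreyWeight σ) univ
  tsupport_subset : tsupport χ ⊆ Metric.ball 0 (2 * δ)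
  eq_one : ∀ᶠ y in 𝓝 0, χ y = 1

/-- The exponent `η = (m - ε) / (m s)`. -/
def metivierEta (m : ℕ) (s ε : ℝ) : ℝ := (m - ε) / (m * s)

/-- `u(x) = ∫_1^∞ χ(ρ^ε (x - x₀)) exp(-ρ^η) exp(i ρ ⟨x - x₀, ξ₀⟩) dρ`. -/
def metivierFun (x₀ ξ₀ : EuclideanSpace ℝ (Fin n)) (ε η : ℝ)
    (χ : EuclideanSpace ℝ (Fin n) → ℂ) : EuclideanSpace ℝ (Fin n) → ℂ :=
  fun x => ∫ ρ in Ioi (1 : ℝ), χ (ρ ^ ε • (x - x₀)) * (Real.exp (-(ρ ^ η)) : ℂ) *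
    Complex.exp (Complex.I * (ρ * inner ℝ (x - x₀) ξ₀ : ℝ))

/-- `ω` is a subadditive non-quasianalytic weight lying strictly between the Gevrey weights
`t^{1/s'}` and `t^{1/s}`. -/
structure IsBetween (s s' : ℝ) (ω : ℝ → ℝ) : Prop where
  isWeight : IsWeight ω
  subadd : IsSubadd ω
  upper : ω =o[atTop] gevreyWeight s
  lower : gevreyWeight s' =o[atTop] ω

end Ultradiff

end

namespace Ultradiff

/-! ### Calculus of iterated partial derivatives -/

/-! The function `u` is a superposition of wave packets. The packet of frequency `ρ ξ₀` lives in a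
ball of radius comparable to `ρ ^ (-ε)` about `x₀` and carries the weight `exp (-ρ ^ η)`. A
derivative of order `N` costs at most `ρ ^ N = (ρ ^ η) ^ (N / η)` up to geometric factors, and
maximising `X ^ (N / η) * exp (-X)` gives `N ^ (N / η)`, so `u` is Gevrey of order `1 / η`. Near
`x₀` the cut-off equals `1`; hence `D_ξ₀ ^ j u (x₀)` is exactly `∫_1^∞ ρ ^ j exp (-ρ ^ η) dρ`, a
positive integral of size `j ^ (j / η)`, and the order `1 / η` cannot be lowered.

The operator `P` costs less than its order suggests. Conjugation by the wave turns `D_i` into `D_i +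
ρ ξ_i` and `P` into `ρ ^ m P_m(x, ξ₀)` plus terms that either have order below `m` or put a
derivative on the amplitude. The symbol vanishes at `x₀`, so it is `O(ρ ^ (-ε))` on the packet; a
derivative of the amplitude is charged `ρ ^ (1 - ε)` instead of `ρ`; lower order gains `ρ⁻¹`. One
application of `P` thus costs `ρ ^ (m - ε) = (ρ ^ η) ^ (m s)`, and `P ^ q u` grows only like `(q m)
^ (s q m)`, although `s < 1 / η`.

The constants must stay geometric in `q` although repeated differentiation of the cut-off and of the
coefficients creates factorials. The majorant `gevreyMajorant` stores these factorials in a second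
index `J`. The upper bound on `ε` amounts to `η σ < 1 - 2 ε`, and this makes them harmless against
`exp (-ρ ^ η)`: see `isMajorant_gevreyMajorant`, `majorizedAt_shiftedOp` and
`rpow_mul_gevreyMajorant_le`.

General weights enter through Young conjugates. Bounds of Gevrey order `s` imply the Beurling
estimates for every weight `ω = o(t ^ (1 / s))`, while `t ^ (1 / s') = o(ω)` places the Roumieu
class of `ω` inside the Gevrey class of order `s'`. Any `s'` in `(s, 1 / η)` therefore separates the
iterates of `P` from the function itself. -/

/-- Smoothness on a set, for complex valued functions on a real normed space. -/
abbrev SmoothOn {E : Type*} [NormedAddCommGroup E] [NormedSpace ℝ E] (f : E → ℂ) (U : Set E) :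
    Prop :=
  ContDiffOn ℝ ((⊤ : ℕ∞) : WithTop ℕ∞) f U

theorem SmoothOn.contDiffAt {E : Type*} [NormedAddCommGroup E] [NormedSpace ℝ E] {f : E → ℂ}
    {U : Set E} (hf : SmoothOn f U) (hU : IsOpen U) {x : E} (hx : x ∈ U) :
    ContDiffAt ℝ ((⊤ : ℕ∞) : WithTop ℕ∞) f x :=
  ContDiffOn.contDiffAt hf (hU.mem_nhds hx)

theorem SmoothOn.differentiableAt {E : Type*} [NormedAddCommGroup E] [NormedSpace ℝ E] {f : E → ℂ}
    {U : Set E} (hf : SmoothOn f U) (hU : IsOpen U) {x : E} (hx : x ∈ U) :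
    DifferentiableAt ℝ f x :=
  (hf.contDiffAt hU hx).differentiableAt (by simp)

variable {n : ℕ}

/-- The iterated partial derivative along a word of coordinates. -/
noncomputable def wordD (l : List (Fin n)) (f : EuclideanSpace ℝ (Fin n) → ℂ) :
    EuclideanSpace ℝ (Fin n) → ℂ :=
  l.foldr partialD f

/-- The nondecreasing word in which each coordinate `i` occurs `α i` times. -/
def multiWord (α : Fin n → ℕ) : List (Fin n) :=
  (List.finRange n).flatMap fun i => List.replicate (α i) i

@[simp] theorem wordD_nil (f : EuclideanSpace ℝ (Fin n) → ℂ) : wordD [] f = f := rfl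

@[simp] theorem wordD_cons (i : Fin n) (l : List (Fin n)) (f : EuclideanSpace ℝ (Fin n) → ℂ) :
    wordD (i :: l) f = partialD i (wordD l f) := rfl

theorem length_multiWord (α : Fin n → ℕ) : (multiWord α).length = ∑ i, α i := by
  simp [multiWord, List.length_flatMap, Fin.sum_univ_def]

/-- Replaces powers of each `∂_i` by one fold over a word, so that later inductions add one
derivative at a time. -/
theorem foldr_replicate_flatMap {β γ : Type*} (g : γ → β → β) (α : γ → ℕ) (l : List γ) (b : β) :
    (l.flatMap fun i => List.replicate (α i) i).foldr g b =
      l.foldr (fun i c => (g i)^[α i] c) b := by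
  induction l with
  | nil => rfl
  | cons i l ih =>
    rw [List.flatMap_cons, List.foldr_append, ih, List.foldr_cons]
    generalize List.foldr _ b l = c
    induction α i with
    | zero => rfl
    | succ k ih => rw [List.replicate_succ, List.foldr_cons, ih, Function.iterate_succ_apply']

theorem multiD_eq_wordD (α : Fin n → ℕ) (f : EuclideanSpace ℝ (Fin n) → ℂ) :
    multiD α f = wordD (multiWord α) f :=
  (foldr_replicate_flatMap partialD α _ f).symm

theorem SmoothOn.partialD {f : EuclideanSpace ℝ (Fin n) → ℂ} {U : Set (EuclideanSpace ℝ (Fin n))}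
    (hf : SmoothOn f U) (hU : IsOpen U) (i : Fin n) : SmoothOn (partialD i f) U := by
  have h : ContDiffOn ℝ ((⊤ : ℕ∞) : WithTop ℕ∞) (fderiv ℝ f) U :=
    hf.fderiv_of_isOpen hU (by simp)
  exact h.clm_apply contDiffOn_const

theorem SmoothOn.wordD {f : EuclideanSpace ℝ (Fin n) → ℂ} {U : Set (EuclideanSpace ℝ (Fin n))}
    (hf : SmoothOn f U) (hU : IsOpen U) (l : List (Fin n)) : SmoothOn (wordD l f) U := by
  induction l with
  | nil => exact hf
  | cons i l ih => exact ih.partialD hU i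

theorem partialD_congr {f g : EuclideanSpace ℝ (Fin n) → ℂ} {U : Set (EuclideanSpace ℝ (Fin n))}
    (hU : IsOpen U) (h : EqOn f g U) (i : Fin n) : EqOn (partialD i f) (partialD i g) U := by
  intro x hx
  have : f =ᶠ[𝓝 x] g := h.eventuallyEq_of_mem (hU.mem_nhds hx)
  simp only [partialD, this.fderiv_eq]

theorem wordD_congr {f g : EuclideanSpace ℝ (Fin n) → ℂ} {U : Set (EuclideanSpace ℝ (Fin n))}
    (hU : IsOpen U) (h : EqOn f g U) (l : List (Fin n)) : EqOn (wordD l f) (wordD l g) U := by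
  induction l with
  | nil => exact h
  | cons i l ih => exact partialD_congr hU ih i

theorem partialD_comm {f : EuclideanSpace ℝ (Fin n) → ℂ} {U : Set (EuclideanSpace ℝ (Fin n))}
    (hf : SmoothOn f U) (hU : IsOpen U) (i j : Fin n) :
    EqOn (partialD i (partialD j f)) (partialD j (partialD i f)) U := by
  intro x hx
  have hd : DifferentiableAt ℝ (fderiv ℝ f) x :=
    ((hf.contDiffAt hU hx).fderiv_right (m := 1) (by norm_cast)).differentiableAt (by simp)
  have h2 : IsSymmSndFDerivAt ℝ f x := (hf.contDiffAt hU hx).isSymmSndFDerivAt (by simp; norm_cast)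
  have key : ∀ v w, fderiv ℝ (fun y => fderiv ℝ f y v) x w = fderiv ℝ (fderiv ℝ f) x w v := by
    intro v w
    rw [fderiv_clm_apply hd (by fun_prop)]
    simp
  exact ((key _ _).trans (h2 _ _)).trans (key _ _).symm

/-- Transpositions of neighbours generate all rearrangements, and one transposition is the symmetry
of the second derivative. -/
theorem wordD_perm {f : EuclideanSpace ℝ (Fin n) → ℂ} {U : Set (EuclideanSpace ℝ (Fin n))}
    (hf : SmoothOn f U) (hU : IsOpen U) {l l' : List (Fin n)} (h : l.Perm l') :
    EqOn (wordD l f) (wordD l' f) U := by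
  induction h with
  | nil => exact fun _ _ => rfl
  | cons i _ ih => exact partialD_congr hU ih i
  | swap i j l => exact partialD_comm (hf.wordD hU l) hU j i
  | trans _ _ h₁ h₂ => exact h₁.trans h₂

theorem perm_multiWord_count (l : List (Fin n)) : l.Perm (multiWord fun i => l.count i) := by
  rw [List.perm_iff_count]
  intro a
  rw [multiWord, List.count_flatMap]
  have : ((List.finRange n).map ((List.count a) ∘ fun i => List.replicate (l.count i) i)).sum =
      ∑ i, if i = a then l.count i else 0 := by
    rw [Fin.sum_univ_def]
    simp [Function.comp_def, List.count_replicate]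
  rw [this]
  simp

theorem sum_count_eq_length (l : List (Fin n)) : ∑ i, l.count i = l.length := by
  rw [← length_multiWord, (perm_multiWord_count l).length_eq]

/-! ### Comparison of partial derivatives with Fréchet derivatives. -/

theorem norm_iteratedFDeriv_partialD_le {f : EuclideanSpace ℝ (Fin n) → ℂ}
    {x : EuclideanSpace ℝ (Fin n)} (hf : ContDiffAt ℝ ((⊤ : ℕ∞) : WithTop ℕ∞) f x) (i : Fin n)
    (k : ℕ) :
    ‖iteratedFDeriv ℝ k (partialD i f) x‖ ≤ ‖iteratedFDeriv ℝ (k + 1) f x‖ := by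
  have hd : ContDiffAt ℝ (k : WithTop ℕ∞) (fderiv ℝ f) x :=
    hf.fderiv_right (m := (k : WithTop ℕ∞)) (by norm_cast; exact le_top)
  let L := ContinuousLinearMap.apply ℝ ℂ (EuclideanSpace.single i (1 : ℝ))
  have hL : ‖L‖ ≤ 1 := by
    refine ContinuousLinearMap.opNorm_le_bound _ zero_le_one fun T => ?_
    simpa [L] using T.le_opNorm (EuclideanSpace.single i (1 : ℝ))
  have := L.norm_iteratedFDeriv_comp_left hd le_rfl
  rw [norm_iteratedFDeriv_fderiv] at this
  exact this.trans (mul_le_of_le_one_left (norm_nonneg _) hL)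

theorem ContDiffAt.partialD {f : EuclideanSpace ℝ (Fin n) → ℂ}
    {x : EuclideanSpace ℝ (Fin n)} (hf : ContDiffAt ℝ ((⊤ : ℕ∞) : WithTop ℕ∞) f x) (i : Fin n) :
    ContDiffAt ℝ ((⊤ : ℕ∞) : WithTop ℕ∞) (partialD i f) x :=
  (hf.fderiv_right (m := ((⊤ : ℕ∞) : WithTop ℕ∞)) (by simp)).clm_apply contDiffAt_const

theorem ContDiffAt.wordD {f : EuclideanSpace ℝ (Fin n) → ℂ}
    {x : EuclideanSpace ℝ (Fin n)} (hf : ContDiffAt ℝ ((⊤ : ℕ∞) : WithTop ℕ∞) f x)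
    (l : List (Fin n)) : ContDiffAt ℝ ((⊤ : ℕ∞) : WithTop ℕ∞) (wordD l f) x := by
  induction l with
  | nil => exact hf
  | cons i l ih => exact ContDiffAt.partialD ih i

theorem norm_iteratedFDeriv_wordD_le {f : EuclideanSpace ℝ (Fin n) → ℂ}
    {x : EuclideanSpace ℝ (Fin n)} (hf : ContDiffAt ℝ ((⊤ : ℕ∞) : WithTop ℕ∞) f x)
    (l : List (Fin n)) (k : ℕ) :
    ‖iteratedFDeriv ℝ k (wordD l f) x‖ ≤ ‖iteratedFDeriv ℝ (k + l.length) f x‖ := by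
  induction l generalizing k with
  | nil => simp
  | cons i l ih =>
    refine (norm_iteratedFDeriv_partialD_le (ContDiffAt.wordD hf l) i k).trans ?_
    refine (ih (k + 1)).trans (le_of_eq ?_)
    rw [List.length_cons, add_assoc, add_comm 1]

theorem norm_multiD_le {f : EuclideanSpace ℝ (Fin n) → ℂ}
    {x : EuclideanSpace ℝ (Fin n)} (hf : ContDiffAt ℝ ((⊤ : ℕ∞) : WithTop ℕ∞) f x)
    (α : Fin n → ℕ) : ‖multiD α f x‖ ≤ ‖iteratedFDeriv ℝ (∑ i, α i) f x‖ := by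
  have := norm_iteratedFDeriv_wordD_le hf (multiWord α) 0
  rwa [norm_iteratedFDeriv_zero, zero_add, length_multiWord, ← multiD_eq_wordD] at this

theorem differentiableAt_iteratedFDeriv {f : EuclideanSpace ℝ (Fin n) → ℂ}
    {U : Set (EuclideanSpace ℝ (Fin n))} (hf : SmoothOn f U) (hU : IsOpen U) (k : ℕ)
    {x : EuclideanSpace ℝ (Fin n)} (hx : x ∈ U) :
    DifferentiableAt ℝ (iteratedFDeriv ℝ k f) x :=
  ((hf.contDiffAt hU hx).iteratedFDeriv_right (m := 1) (i := k)
    (by norm_cast; exact le_top)).differentiableAt (by simp)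

theorem wordD_ofFn {f : EuclideanSpace ℝ (Fin n) → ℂ} {U : Set (EuclideanSpace ℝ (Fin n))}
    (hf : SmoothOn f U) (hU : IsOpen U) {k : ℕ} (r : Fin k → Fin n) :
    EqOn (wordD (List.ofFn r) f)
      (fun x => iteratedFDeriv ℝ k f x fun j => EuclideanSpace.single (r j) 1) U := by
  induction k with
  | zero => intro x _; simp
  | succ k ih =>
    rw [List.ofFn_succ, wordD_cons]
    refine (partialD_congr hU (ih fun j => r j.succ) (r 0)).trans fun x hx => ?_
    have := (differentiableAt_iteratedFDeriv hf hU k hx).iteratedFDeriv_succ_apply_left'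
      (m := fun j => EuclideanSpace.single (r j) (1 : ℝ))
    exact this.symm

theorem iterate_directionalD {f : EuclideanSpace ℝ (Fin n) → ℂ}
    {U : Set (EuclideanSpace ℝ (Fin n))} (hf : SmoothOn f U) (hU : IsOpen U)
    (ξ : EuclideanSpace ℝ (Fin n)) (j : ℕ) :
    EqOn ((directionalD ξ)^[j] f)
      (fun x => (-Complex.I) ^ j * iteratedFDeriv ℝ j f x fun _ => ξ) U := by
  induction j with
  | zero => intro x _; simp
  | succ j ih =>
    intro x hx
    have h1 : (directionalD ξ)^[j] f =ᶠ[𝓝 x] _ := ih.eventuallyEq_of_mem (hU.mem_nhds hx)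
    have hd := differentiableAt_iteratedFDeriv hf hU j hx
    rw [Function.iterate_succ_apply']
    simp only [directionalD]
    rw [h1.fderiv_eq, fderiv_const_mul (hd.continuousMultilinear_apply_const _)]
    rw [hd.iteratedFDeriv_succ_apply_left' (m := fun _ => ξ)]
    simp only [smul_apply, smul_eq_mul, pow_succ']
    rw [← mul_assoc]
    rfl

/-- A multilinear map on `ℝⁿ` is controlled by its values at basis vectors. -/
theorem norm_le_of_forall_single {k : ℕ}
    (T : ContinuousMultilinearMap ℝ (fun _ : Fin k => EuclideanSpace ℝ (Fin n)) ℂ) {M : ℝ}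
    (hM : 0 ≤ M) (h : ∀ r : Fin k → Fin n, ‖T fun j => EuclideanSpace.single (r j) 1‖ ≤ M) :
    ‖T‖ ≤ n ^ k * M := by
  refine T.opNorm_le_bound (by positivity) fun v => ?_
  have hv : v = fun j => ∑ i, (v j i) • EuclideanSpace.single i (1 : ℝ) := by
    funext j
    ext i
    simp [Finset.sum_apply, Pi.single_apply]
  have : T v = ∑ r : Fin k → Fin n,
      (∏ j, v j (r j)) • T fun j => EuclideanSpace.single (r j) 1 := by
    conv_lhs => rw [hv]
    rw [T.map_sum]
    exact Finset.sum_congr rfl fun r _ => T.map_smul_univ _ _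
  rw [this]
  refine (norm_sum_le _ _).trans ?_
  have hb : ∀ r : Fin k → Fin n, ‖(∏ j, v j (r j)) • T fun j => EuclideanSpace.single (r j) 1‖ ≤
      M * ∏ j, ‖v j‖ := by
    intro r
    rw [norm_smul, mul_comm, norm_prod]
    exact mul_le_mul (h r) (Finset.prod_le_prod (fun _ _ => norm_nonneg _)
      fun j _ => PiLp.norm_apply_le (v j) (r j)) (by positivity) hM
  refine (Finset.sum_le_card_nsmul _ _ _ fun r _ => hb r).trans (le_of_eq ?_)
  simp [Finset.card_univ, mul_assoc]

/-- Sorting the word of directions leaves only the derivatives `multiD α`. The loss `n ^ k` is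
geometric in the order, hence invisible to Gevrey bounds. -/
theorem norm_iteratedFDeriv_le_of_multiD {f : EuclideanSpace ℝ (Fin n) → ℂ}
    {U : Set (EuclideanSpace ℝ (Fin n))} (hf : SmoothOn f U) (hU : IsOpen U)
    {x : EuclideanSpace ℝ (Fin n)} (hx : x ∈ U) {k : ℕ} {M : ℝ} (hM : 0 ≤ M)
    (h : ∀ α : Fin n → ℕ, ∑ i, α i = k → ‖multiD α f x‖ ≤ M) :
    ‖iteratedFDeriv ℝ k f x‖ ≤ n ^ k * M := by
  refine norm_le_of_forall_single _ hM fun r => ?_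
  refine (congrArg norm (wordD_ofFn hf hU r hx)).symm.trans_le ?_
  rw [wordD_perm hf hU (perm_multiWord_count _) hx, ← multiD_eq_wordD]
  exact h _ (by rw [sum_count_eq_length, List.length_ofFn])

end Ultradiff

namespace Ultradiff

/-! ### Estimates for Young conjugates -/

/-- The supremum defining the Young conjugate is finite. -/
def YoungBdd (ω : ℝ → ℝ) : Prop :=
  ∀ y : ℝ, BddAbove (range fun t : Ici (0 : ℝ) => y * (t : ℝ) - ω (Real.exp t))

theorem gevreyWeight_exp (r t : ℝ) : gevreyWeight r (Real.exp t) = Real.exp (t / r) := by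
  rw [gevreyWeight, ← Real.exp_mul, mul_one_div]

theorem youngBdd_gevreyWeight {r : ℝ} (hr : 0 < r) : YoungBdd (gevreyWeight r) := by
  intro y
  refine ⟨(y * r) ^ 2 / 2, ?_⟩
  rintro _ ⟨⟨t, ht⟩, rfl⟩
  have ht' : 0 ≤ t / r := div_nonneg ht hr.le
  have h1 := Real.quadratic_le_exp_of_nonneg ht'
  have h2 : y * t = (y * r) * (t / r) := by field_simp
  simp only [gevreyWeight_exp]
  rw [h2]
  nlinarith [sq_nonneg (y * r - t / r)]

/-- By (γ), `ω (exp t) ≥ (|y| + 1) t` for large `t`, which beats the linear term `y t`; the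
remaining `t` form a bounded range. -/
theorem IsWeight.youngBdd {ω : ℝ → ℝ} (hω : IsWeight ω) : YoungBdd ω := by
  intro y
  have hc : 0 < 1 / (|y| + 1) := by positivity
  obtain ⟨T, hT⟩ := eventually_atTop.1 (hω.gamma.bound hc)
  refine ⟨|y| * |Real.log (max T 1)|, ?_⟩
  rintro _ ⟨⟨t, ht⟩, rfl⟩
  have ht : 0 ≤ t := ht
  have hω0 : 0 ≤ ω (Real.exp t) := hω.nonneg _ (Real.exp_pos t).le
  have hy : y * t ≤ |y| * t := mul_le_mul_of_nonneg_right (le_abs_self y) ht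
  have hnn : 0 ≤ |y| * |Real.log (max T 1)| := by positivity
  simp only
  rcases le_or_gt T (Real.exp t) with h | h
  · have := hT _ h
    rw [Real.log_exp, Real.norm_of_nonneg ht, Real.norm_of_nonneg hω0, one_div,
      inv_mul_eq_div, le_div_iff₀ (by positivity)] at this
    nlinarith
  · have h1 : t ≤ Real.log (max T 1) := by
      rw [Real.le_log_iff_exp_le (by positivity)]
      exact h.le.trans (le_max_left _ _)
    have h2 := mul_le_mul_of_nonneg_left (h1.trans (le_abs_self _)) (abs_nonneg y)
    linarith

/-- A lower bound for a supremum needs one test point. At `t = s log (κ (N + 1))` the weight costs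
at most `c₀ κ (N + 1) + C`; since `l c₀ κ ≤ 1`, the loss is about `exp (-N)`, and the factor `e` in
`hAκ` pays for it. -/
theorem le_exp_youngConj {ω : ℝ → ℝ} (hb : YoungBdd ω) {s c₀ C κ l A : ℝ} (hs : 0 < s)
    (hω : ∀ t, 1 ≤ t → ω t ≤ c₀ * t ^ (1 / s) + C) (hκ : 1 ≤ κ) (hl : 0 < l)
    (hc : l * c₀ * κ ≤ 1) (hA : 0 ≤ A) (hAκ : A * Real.exp 1 ≤ κ ^ s) (N : ℕ) :
    Real.exp (-(1 + l * C)) * (A ^ N * (N : ℝ) ^ (s * N)) ≤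
      Real.exp (l * youngConj ω (N / l)) := by
  -- With `N + 1` in place of `N` the test point lies in `[0, ∞)` also when `N = 0`.
  have hN1 : (1 : ℝ) ≤ N + 1 := by simp
  have hκ0 : 0 < κ := by linarith
  have hκN : 1 ≤ κ * (N + 1) := by nlinarith
  have hκN0 : 0 < κ * (N + 1) := by linarith
  have ht : 0 ≤ s * Real.log (κ * (N + 1)) := mul_nonneg hs.le (Real.log_nonneg hκN)
  have h1 := le_ciSup (hb (N / l)) ⟨_, ht⟩
  change _ ≤ youngConj ω (N / l) at h1
  have hexp : Real.exp (s * Real.log (κ * (N + 1))) = (κ * (N + 1)) ^ s := by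
    rw [Real.rpow_def_of_pos hκN0, mul_comm]
  have h2 := hω _ (Real.one_le_rpow hκN hs.le)
  rw [← Real.rpow_mul hκN0.le, mul_one_div_cancel hs.ne', Real.rpow_one, ← hexp] at h2
  have h3 : l * (N / l * (s * Real.log (κ * (N + 1))) - (c₀ * (κ * (N + 1)) + C)) ≤
      l * youngConj ω (N / l) := mul_le_mul_of_nonneg_left (by simp only at h1; linarith) hl.le
  have h4 : s * N * Real.log (κ * (N + 1)) - (N + 1) - l * C ≤ l * youngConj ω (N / l) := by
    refine le_trans ?_ h3
    have : l * (N / l * (s * Real.log (κ * (N + 1))) - (c₀ * (κ * (N + 1)) + C)) =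
      s * N * Real.log (κ * (N + 1)) - (l * c₀ * κ) * (N + 1) - l * C := by
      field_simp
      ring
    rw [this]
    nlinarith
  refine le_trans ?_ (Real.exp_le_exp.2 h4)
  have h5 : s * N * Real.log (κ * (N + 1)) - (N + 1) - l * C =
      -(1 + l * C) + (Real.log (κ * (N + 1)) * (s * N) + -(N * 1)) := by ring
  rw [h5, Real.exp_add]
  refine mul_le_mul_of_nonneg_left ?_ (Real.exp_pos _).le
  rw [Real.exp_add, ← Real.rpow_def_of_pos hκN0, Real.mul_rpow hκ0.le (by positivity)]
  rw [Real.exp_neg, Real.exp_nat_mul, ← div_eq_mul_inv, le_div_iff₀ (by positivity)]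
  have h6 : (N : ℝ) ^ (s * N) ≤ (N + 1 : ℝ) ^ (s * N) :=
    Real.rpow_le_rpow (by positivity) (by linarith) (by positivity)
  have h7 : (A * Real.exp 1) ^ N ≤ κ ^ (s * N) := by
    rw [Real.rpow_mul hκ0.le, Real.rpow_natCast]
    exact pow_le_pow_left₀ (by positivity) hAκ N
  calc A ^ N * (N : ℝ) ^ (s * N) * Real.exp 1 ^ N = (A * Real.exp 1) ^ N * (N : ℝ) ^ (s * N) := by
        rw [mul_pow]; ring
    _ ≤ _ := mul_le_mul h7 h6 (by positivity) (by positivity)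

/-- Little-o allows the slope `c₀ = 1 / (l κ)` for any prescribed `A` and `l`; this uniformity in
`l` is what the Beurling condition asks for. -/
theorem exists_le_exp_youngConj_of_isLittleO {ω : ℝ → ℝ} (hb : YoungBdd ω)
    (hmono : MonotoneOn ω (Ici 0)) {s : ℝ} (hs : 0 < s) (hω : ω =o[atTop] gevreyWeight s)
    {A l : ℝ} (hA : 0 ≤ A) (hl : 0 < l) :
    ∃ c : ℝ, 0 < c ∧ ∀ N : ℕ, c * (A ^ N * (N : ℝ) ^ (s * N)) ≤
      Real.exp (l * youngConj ω (N / l)) := by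
  set κ := max 1 ((A * Real.exp 1) ^ (1 / s)) with hκ
  have hκ1 : 1 ≤ κ := le_max_left _ _
  have hκ0 : 0 < κ := by linarith
  have hAκ : A * Real.exp 1 ≤ κ ^ s := by
    calc A * Real.exp 1 = ((A * Real.exp 1) ^ (1 / s)) ^ s := by
          rw [← Real.rpow_mul (by positivity), one_div_mul_cancel hs.ne', Real.rpow_one]
      _ ≤ _ := Real.rpow_le_rpow (by positivity) (le_max_right _ _) hs.le
  obtain ⟨T, hT⟩ := eventually_atTop.1 (hω.bound (show 0 < 1 / (l * κ) by positivity))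
  have hω' : ∀ t, 1 ≤ t → ω t ≤ 1 / (l * κ) * t ^ (1 / s) + |ω (max T 1)| := by
    intro t ht
    have ht0 : 0 ≤ t := by linarith
    have hnn : 0 ≤ 1 / (l * κ) * t ^ (1 / s) := by positivity
    rcases le_or_gt T t with h | h
    · have := hT t h
      rw [gevreyWeight, Real.norm_of_nonneg (Real.rpow_nonneg ht0 _)] at this
      have h2 := (le_abs_self (ω t)).trans this
      linarith [abs_nonneg (ω (max T 1))]
    · have h1 : ω t ≤ ω (max T 1) := hmono ht0 (show (0 : ℝ) ≤ max T 1 by positivity)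
        (h.le.trans (le_max_left _ _))
      linarith [le_abs_self (ω (max T 1))]
  refine ⟨_, Real.exp_pos _, le_exp_youngConj hb hs hω' hκ1 hl (le_of_eq ?_) hA hAκ⟩
  field_simp

/-- Here the slope is fixed at `1`, and the freedom is in `l = 1 / k`: one large integer `k` serves
both as `κ` and as `1 / l`. -/
theorem exists_le_exp_youngConj_gevreyWeight {s : ℝ} (hs : 0 < s) {A : ℝ} (hA : 0 ≤ A) :
    ∃ k : ℕ, 1 ≤ k ∧ ∃ c : ℝ, 0 < c ∧ ∀ N : ℕ, c * (A ^ N * (N : ℝ) ^ (s * N)) ≤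
      Real.exp (1 / k * youngConj (gevreyWeight s) (N * k)) := by
  obtain ⟨k, hk⟩ := exists_nat_ge (max 1 ((A * Real.exp 1) ^ (1 / s)))
  have hk1 : (1 : ℝ) ≤ k := (le_max_left _ _).trans hk
  have hAκ : A * Real.exp 1 ≤ (k : ℝ) ^ s := by
    calc A * Real.exp 1 = ((A * Real.exp 1) ^ (1 / s)) ^ s := by
          rw [← Real.rpow_mul (by positivity), one_div_mul_cancel hs.ne', Real.rpow_one]
      _ ≤ _ := Real.rpow_le_rpow (by positivity) ((le_max_right _ _).trans hk) hs.le
  have hk0 : (0 : ℝ) < k := by linarith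
  refine ⟨k, by exact_mod_cast hk1, Real.exp (-(1 + 1 / k * 0)), Real.exp_pos _, fun N => ?_⟩
  have := le_exp_youngConj (youngBdd_gevreyWeight hs) (c₀ := 1) (C := 0) hs
    (fun t _ => by simp [gevreyWeight]) hk1 (show 0 < 1 / (k : ℝ) by positivity)
    (le_of_eq (by field_simp)) hA hAκ N
  rwa [div_div_eq_mul_div, div_one] at this

/-- The maximum of `N t - l exp (t / r)` is attained where `exp (t / r) = r N / l`; the inequality
`log x ≤ x - 1`, applied to the quotient of the two sides, gives the bound. -/
theorem exp_youngConj_gevreyWeight_le {r l : ℝ} (hr : 0 < r) (hl : 0 < l) (N : ℕ) :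
    Real.exp (l * youngConj (gevreyWeight r) (N / l)) ≤ (r * N / l) ^ (r * N) := by
  have : Nonempty (Ici (0 : ℝ)) := ⟨⟨0, self_mem_Ici⟩⟩
  rcases Nat.eq_zero_or_pos N with rfl | hN
  · have : youngConj (gevreyWeight r) ((0 : ℕ) / l) ≤ 0 := by
      refine ciSup_le fun t => ?_
      rw [gevreyWeight_exp]
      have := Real.exp_pos ((t : ℝ) / r)
      simp
      linarith
    simpa using mul_nonpos_of_nonneg_of_nonpos hl.le this
  · have hN' : (0 : ℝ) < N := by exact_mod_cast hN
    have hp : 0 < r * N / l := by positivity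
    rw [Real.rpow_def_of_pos hp, Real.exp_le_exp, ← le_div_iff₀' hl]
    refine ciSup_le fun ⟨t, ht⟩ => ?_
    rw [gevreyWeight_exp, le_div_iff₀' hl]
    have h1 := Real.log_le_sub_one_of_pos (show 0 < Real.exp (t / r) / (r * N / l) by positivity)
    rw [Real.log_div (Real.exp_pos _).ne' hp.ne', Real.log_exp] at h1
    have h2 := mul_le_mul_of_nonneg_left h1 (show 0 ≤ r * N by positivity)
    have e1 : r * N * (t / r - Real.log (r * N / l)) = N * t - Real.log (r * N / l) * (r * N) := by
      field_simp
    have e2 : r * N * (Real.exp (t / r) / (r * N / l) - 1) = l * Real.exp (t / r) - r * N := by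
      field_simp
    have e3 : l * (N / l * t - Real.exp (t / r)) = N * t - l * Real.exp (t / r) := by field_simp
    rw [e1, e2] at h2
    simp only
    rw [e3]
    linarith [show 0 < r * N by positivity]

/-! ### Membership in the classes -/

variable {n : ℕ}

theorem beurling_subset_roumieu (ω : ℝ → ℝ) (Ω : Set (EuclideanSpace ℝ (Fin n))) :
    beurling ω Ω ⊆ roumieu ω Ω :=
  fun _ hf => ⟨hf.1, fun K hK hKΩ => ⟨1, one_pos, hf.2 K hK hKΩ 1 one_pos⟩⟩

/-- A larger weight has a smaller conjugate: `t ^ (1 / r) ≤ ω t + C` makes the conjugate of `ω` at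
most that of the Gevrey weight plus `C`. Each seminorm keeps its `l` and only gains the factor `exp
(l C)`. -/
theorem roumieu_subset_of_isLittleO {ω : ℝ → ℝ} (hω : IsWeight ω) {r : ℝ} (hr : 0 < r)
    (h : gevreyWeight r =o[atTop] ω) (Ω : Set (EuclideanSpace ℝ (Fin n))) :
    roumieu ω Ω ⊆ roumieu (gevreyWeight r) Ω := by
  obtain ⟨T, hT⟩ := eventually_atTop.1 (h.bound one_pos)
  set C := (max T 1) ^ (1 / r) with hC
  have hC0 : 0 ≤ C := by positivity
  have hle : ∀ t, 1 ≤ t → gevreyWeight r t ≤ ω t + C := by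
    intro t ht
    have ht0 : 0 ≤ t := by linarith
    have hω0 := hω.nonneg t ht0
    rcases le_or_gt T t with h | h
    · have := hT t h
      rw [Real.norm_of_nonneg hω0, one_mul] at this
      linarith [Real.le_norm_self (gevreyWeight r t)]
    · have : gevreyWeight r t ≤ C :=
        Real.rpow_le_rpow ht0 (h.le.trans (le_max_left _ _)) (by positivity)
      linarith
  have : Nonempty (Ici (0 : ℝ)) := ⟨⟨0, self_mem_Ici⟩⟩
  have hY : ∀ y, youngConj ω y ≤ youngConj (gevreyWeight r) y + C := by
    intro y
    refine ciSup_le fun t => ?_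
    have h1 := le_ciSup (youngBdd_gevreyWeight hr y) t
    have h2 := hle (Real.exp t) (Real.one_le_exp t.2)
    change _ ≤ youngConj (gevreyWeight r) y at h1
    linarith
  rintro f ⟨hf, hK⟩
  refine ⟨hf, fun K hKc hKΩ => ?_⟩
  obtain ⟨l, hl, D, hD⟩ := hK K hKc hKΩ
  refine ⟨l, hl, D * Real.exp (l * C), fun α x hx => ?_⟩
  refine le_trans ?_ (mul_le_mul_of_nonneg_right (hD α x hx) (Real.exp_pos _).le)
  rw [mul_assoc, ← Real.exp_add]
  refine mul_le_mul_of_nonneg_left (Real.exp_le_exp.2 ?_) (norm_nonneg _)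
  have := mul_le_mul_of_nonneg_left (hY (((∑ i, α i : ℕ) : ℝ) / l)) hl.le
  linarith

/-- Derivative bounds of Gevrey type `s` on compact sets. -/
def GevreyBoundOn (s : ℝ) (f : EuclideanSpace ℝ (Fin n) → ℂ)
    (K : Set (EuclideanSpace ℝ (Fin n))) : Prop :=
  ∃ C A : ℝ, 0 ≤ C ∧ 0 ≤ A ∧ ∀ α : Fin n → ℕ, ∀ x ∈ K,
    ‖multiD α f x‖ ≤ C * (A ^ (∑ i, α i) * ((∑ i, α i : ℕ) : ℝ) ^ (s * (∑ i, α i : ℕ)))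

theorem mul_exp_neg_le {a b c C y : ℝ} (hc : 0 < c) (hC : 0 ≤ C) (ha : a ≤ C * b)
    (hb : c * b ≤ Real.exp y) : a * Real.exp (-y) ≤ C / c := by
  rw [Real.exp_neg, ← div_eq_mul_inv, div_le_iff₀ (Real.exp_pos _), div_mul_eq_mul_div,
    le_div_iff₀ hc]
  calc a * c ≤ C * b * c := mul_le_mul_of_nonneg_right ha hc.le
    _ = C * (c * b) := by ring
    _ ≤ _ := mul_le_mul_of_nonneg_left hb hC

theorem mem_beurling_of_gevreyBoundOn {ω : ℝ → ℝ} (hb : YoungBdd ω)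
    (hmono : MonotoneOn ω (Ici 0)) {s : ℝ} (hs : 0 < s) (hω : ω =o[atTop] gevreyWeight s)
    {f : EuclideanSpace ℝ (Fin n) → ℂ} {Ω : Set (EuclideanSpace ℝ (Fin n))} (hf : SmoothOn f Ω)
    (h : ∀ K, IsCompact K → K ⊆ Ω → GevreyBoundOn s f K) : f ∈ beurling ω Ω := by
  refine ⟨hf, fun K hK hKΩ l hl => ?_⟩
  obtain ⟨C, A, hC, hA, hb'⟩ := h K hK hKΩ
  obtain ⟨c, hc, hY⟩ := exists_le_exp_youngConj_of_isLittleO hb hmono hs hω hA hl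
  exact ⟨C / c, fun α x hx => mul_exp_neg_le hc hC (hb' α x hx) (hY _)⟩

theorem mem_roumieu_gevreyWeight {s : ℝ} (hs : 0 < s)
    {f : EuclideanSpace ℝ (Fin n) → ℂ} {Ω : Set (EuclideanSpace ℝ (Fin n))} (hf : SmoothOn f Ω)
    (h : ∀ K, IsCompact K → K ⊆ Ω → GevreyBoundOn s f K) : f ∈ roumieu (gevreyWeight s) Ω := by
  refine ⟨hf, fun K hK hKΩ => ?_⟩
  obtain ⟨C, A, hC, hA, hb'⟩ := h K hK hKΩ
  obtain ⟨k, hk, c, hc, hY⟩ := exists_le_exp_youngConj_gevreyWeight hs hA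
  have hk' : (0 : ℝ) < k := by exact_mod_cast hk
  refine ⟨1 / k, by positivity, C / c, fun α x hx => mul_exp_neg_le hc hC (hb' α x hx) ?_⟩
  rw [div_div_eq_mul_div, div_one]
  exact hY _

/-- Bounds of Gevrey type `s` for the iterates of a differential operator of order `m`. -/
def IterBoundOn (s : ℝ) (m : ℕ) (a : (Fin n → ℕ) → EuclideanSpace ℝ (Fin n) → ℂ)
    (f : EuclideanSpace ℝ (Fin n) → ℂ) (Ω : Set (EuclideanSpace ℝ (Fin n))) : Prop :=
  ∃ C A : ℝ, 0 ≤ C ∧ 0 ≤ A ∧ ∀ q : ℕ, ∀ x ∈ Ω,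
    ‖(diffOp m a)^[q] f x‖ ≤ C * (A ^ (q * m) * ((q * m : ℕ) : ℝ) ^ (s * (q * m : ℕ)))

/-- Pointwise bounds on `K` become `L²` bounds because `K` has finite measure; the factor `V` is the
square root of that measure. -/
theorem eLpNorm_iterate_le {s : ℝ} {m : ℕ} {a : (Fin n → ℕ) → EuclideanSpace ℝ (Fin n) → ℂ}
    {f : EuclideanSpace ℝ (Fin n) → ℂ} {K : Set (EuclideanSpace ℝ (Fin n))} (hK : IsCompact K)
    {C A c : ℝ} (hC : 0 ≤ C) (hc : 0 < c) {y : ℕ → ℝ}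
    (h : ∀ q : ℕ, ∀ x ∈ K,
      ‖(diffOp m a)^[q] f x‖ ≤ C * (A ^ (q * m) * ((q * m : ℕ) : ℝ) ^ (s * (q * m : ℕ))))
    (hy : ∀ q : ℕ, c * (A ^ (q * m) * ((q * m : ℕ) : ℝ) ^ (s * (q * m : ℕ))) ≤ Real.exp (y q)) :
    ∃ c' : ℝ, 0 < c' ∧ ∀ q : ℕ, eLpNorm ((diffOp m a)^[q] f) 2 (volume.restrict K) ≤
      ENNReal.ofReal (c' * Real.exp (y q)) := by
  set V := (volume.restrict K (univ : Set (EuclideanSpace ℝ (Fin n)))) ^ (2 : ENNReal).toReal⁻¹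
  have hV : V ≠ ⊤ := by
    refine ENNReal.rpow_ne_top_of_nonneg (by positivity) ?_
    rw [Measure.restrict_apply_univ]
    exact hK.measure_lt_top.ne
  refine ⟨(V.toReal + 1) * (C / c + 1), by positivity, fun q => ?_⟩
  have hle : ∀ᵐ x ∂volume.restrict K, ‖(diffOp m a)^[q] f x‖ ≤ C / c * Real.exp (y q) := by
    refine (ae_restrict_iff' hK.measurableSet).2 (Eventually.of_forall fun x hx => ?_)
    have := mul_exp_neg_le hc hC (h q x hx) (hy q)
    rwa [Real.exp_neg, ← div_eq_mul_inv, div_le_iff₀ (Real.exp_pos _)] at this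
  refine (eLpNorm_le_of_ae_bound hle).trans ?_
  change V * _ ≤ _
  have hV' : V * ENNReal.ofReal (C / c * Real.exp (y q)) =
      ENNReal.ofReal (V.toReal * (C / c * Real.exp (y q))) := by
    rw [ENNReal.ofReal_mul ENNReal.toReal_nonneg, ENNReal.ofReal_toReal hV]
  rw [hV']
  refine ENNReal.ofReal_le_ofReal ?_
  have hCc : 0 ≤ C / c := by positivity
  have : 0 ≤ V.toReal := ENNReal.toReal_nonneg
  rw [← mul_assoc]
  refine mul_le_mul_of_nonneg_right ?_ (Real.exp_pos _).le
  gcongr <;> linarith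

theorem mem_beurlingIter {ω : ℝ → ℝ} (hb : YoungBdd ω)
    (hmono : MonotoneOn ω (Ici 0)) {s : ℝ} (hs : 0 < s) (hω : ω =o[atTop] gevreyWeight s)
    {m : ℕ} {a : (Fin n → ℕ) → EuclideanSpace ℝ (Fin n) → ℂ}
    {f : EuclideanSpace ℝ (Fin n) → ℂ} {Ω : Set (EuclideanSpace ℝ (Fin n))} (hf : SmoothOn f Ω)
    (h : IterBoundOn s m a f Ω) : f ∈ beurlingIter m a ω Ω := by
  refine ⟨hf, fun K hK hKΩ k hk => ?_⟩
  obtain ⟨C, A, hC, hA, hb'⟩ := h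
  have hk' : (0 : ℝ) < k := by exact_mod_cast hk
  obtain ⟨c, hc, hY⟩ := exists_le_exp_youngConj_of_isLittleO hb hmono hs hω hA hk'
  refine eLpNorm_iterate_le hK hC hc (fun q x hx => hb' q x (hKΩ hx)) fun q => ?_
  simpa using hY (q * m)

theorem beurlingIter_subset_roumieuIter (m : ℕ)
    (a : (Fin n → ℕ) → EuclideanSpace ℝ (Fin n) → ℂ) (ω : ℝ → ℝ)
    (Ω : Set (EuclideanSpace ℝ (Fin n))) : beurlingIter m a ω Ω ⊆ roumieuIter m a ω Ω := by
  refine fun f hf => ⟨hf.1, fun K hK hKΩ => ⟨1, le_rfl, ?_⟩⟩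
  simpa using hf.2 K hK hKΩ 1 le_rfl

theorem mem_roumieuIter_gevreyWeight {s : ℝ} (hs : 0 < s)
    {m : ℕ} {a : (Fin n → ℕ) → EuclideanSpace ℝ (Fin n) → ℂ}
    {f : EuclideanSpace ℝ (Fin n) → ℂ} {Ω : Set (EuclideanSpace ℝ (Fin n))} (hf : SmoothOn f Ω)
    (h : IterBoundOn s m a f Ω) : f ∈ roumieuIter m a (gevreyWeight s) Ω := by
  refine ⟨hf, fun K hK hKΩ => ?_⟩
  obtain ⟨C, A, hC, hA, hb'⟩ := h
  obtain ⟨k, hk, c, hc, hY⟩ := exists_le_exp_youngConj_gevreyWeight hs hA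
  refine ⟨k, hk, eLpNorm_iterate_le hK hC hc (fun q x hx => hb' q x (hKΩ hx)) fun q => ?_⟩
  simpa using hY (q * m)

end Ultradiff

namespace Ultradiff

/-! ### Gevrey weights -/

theorem isSubadd_gevreyWeight {r : ℝ} (hr : 1 ≤ r) : IsSubadd (gevreyWeight r) :=
  fun _ _ h₁ h₂ => Real.rpow_add_le_add_rpow h₁ h₂ (by positivity)
    ((div_le_one (by linarith)).2 hr)

theorem IsSubadd.alpha {ω : ℝ → ℝ} (h : IsSubadd ω) :
    ∃ L : ℝ, 0 < L ∧ ∀ t, 0 ≤ t → ω (2 * t) ≤ L * (ω t + 1) := by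
  refine ⟨2, two_pos, fun t ht => ?_⟩
  have := h t t ht ht
  rw [two_mul]
  linarith

theorem monotoneOn_gevreyWeight {r : ℝ} (hr : 0 < r) : MonotoneOn (gevreyWeight r) (Ici 0) :=
  fun _ ha _ _ hab => Real.rpow_le_rpow ha hab (by positivity)

theorem isWeight_gevreyWeight {r : ℝ} (hr : 1 < r) : IsWeight (gevreyWeight r) where
  continuousOn := (Real.continuous_rpow_const (by positivity)).continuousOn
  monotoneOn := monotoneOn_gevreyWeight (by linarith)
  nonneg t ht := Real.rpow_nonneg ht _
  alpha := (isSubadd_gevreyWeight hr.le).alpha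
  beta := by
    have h1 : 1 / r < 1 := (div_lt_one (by linarith)).2 hr
    refine (integrableOn_Ioi_rpow_of_lt (a := 1 / r - 2) (by linarith) one_pos).congr_fun
      (fun t ht => ?_) measurableSet_Ioi
    have ht : 0 < t := lt_trans one_pos ht
    simp only [gevreyWeight]
    rw [Real.rpow_sub ht]
    norm_num
  gamma := isLittleO_log_rpow_atTop (by positivity)
  delta := by
    have : (fun t : ℝ => gevreyWeight r (Real.exp t)) =
        fun t : ℝ => Real.exp ((LinearMap.mulRight ℝ (1 / r)) t) := by
      funext t
      simp [gevreyWeight_exp, div_eq_mul_inv]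
    rw [this]
    exact convexOn_exp.comp_linearMap (LinearMap.mulRight ℝ (1 / r))

theorem isLittleO_gevreyWeight {r r' : ℝ} (hr : 0 < r) (h : r < r') :
    gevreyWeight r' =o[atTop] gevreyWeight r := by
  have hlt : 0 < 1 / r - 1 / r' := sub_pos.2 (one_div_lt_one_div_of_lt hr h)
  refine (isLittleO_iff_tendsto' ?_).2 ((tendsto_rpow_neg_atTop hlt).congr' ?_)
  · filter_upwards [eventually_gt_atTop 0] with t ht h0
    exact absurd h0 (Real.rpow_pos_of_pos ht _).ne'
  · filter_upwards [eventually_gt_atTop 0] with t ht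
    rw [gevreyWeight, gevreyWeight, ← Real.rpow_sub ht, neg_sub]

/-! ### The weight `t ^ (1 / s) / log t` -/

/-- A weight that agrees with `t ^ (1 / s) / log t` for `t ≥ exp s` and is constant before. -/
noncomputable def logWeight (s t : ℝ) : ℝ :=
  Real.exp (Real.log (max t (Real.exp s)) / s - Real.log (Real.log (max t (Real.exp s))))

theorem le_log_max (s t : ℝ) : s ≤ Real.log (max t (Real.exp s)) := by
  rw [Real.le_log_iff_exp_le (by positivity)]
  exact le_max_right _ _

theorem logWeight_eq {s t : ℝ} (hs : 1 < s) (ht : Real.exp s ≤ t) :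
    logWeight s t = t ^ (1 / s) / Real.log t := by
  have ht0 : 0 < t := (Real.exp_pos s).trans_le ht
  have hl : s ≤ Real.log t := (Real.le_log_iff_exp_le ht0).2 ht
  rw [logWeight, max_eq_left ht, Real.exp_sub, Real.exp_log (by linarith),
    Real.rpow_def_of_pos ht0, mul_one_div]

/-- The derivative `1 / s - 1 / y` is nonnegative for `y ≥ s`; this is why `logWeight` is frozen
below `exp s`. -/
theorem monotoneOn_div_sub_log {s : ℝ} (hs : 0 < s) :
    MonotoneOn (fun y : ℝ => y / s - Real.log y) (Ici s) := by
  intro x hx y hy hxy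
  have hx : s ≤ x := hx
  have hx0 : 0 < x := hs.trans_le hx
  have hy0 : 0 < y := hx0.trans_le hxy
  have h1 := Real.log_le_sub_one_of_pos (div_pos hy0 hx0)
  rw [Real.log_div hy0.ne' hx0.ne'] at h1
  have h2 : y / x - 1 = (y - x) / x := by field_simp
  have h3 : (y - x) / x ≤ (y - x) / s := div_le_div_of_nonneg_left (by linarith) hs hx
  have h4 : (y - x) / s = y / s - x / s := by ring
  simp only
  linarith

theorem monotone_logWeight {s : ℝ} (hs : 0 < s) : Monotone (logWeight s) := by
  intro x y hxy
  refine Real.exp_le_exp.2 (monotoneOn_div_sub_log hs (le_log_max s x) (le_log_max s y) ?_)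
  exact Real.log_le_log (by positivity) (max_le_max_right _ hxy)

theorem continuous_logWeight {s : ℝ} (hs : 0 < s) : Continuous (logWeight s) := by
  have h1 : Continuous fun t : ℝ => Real.log (max t (Real.exp s)) :=
    (continuous_id.max continuous_const).log fun t => by positivity
  exact Real.continuous_exp.comp ((h1.div_const s).sub
    (h1.log fun t => (hs.trans_le (le_log_max s t)).ne'))

/-- The quotient `ω(t) / t` decreases, the usual source of subadditivity: in the variable `log t`
the logarithm of the weight has slope at most `1 / s < 1`. -/
theorem logWeight_mul_le {s : ℝ} (hs : 1 < s) {t₁ t₂ : ℝ} (h₁ : 0 ≤ t₁) (h : t₁ ≤ t₂) :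
    logWeight s t₂ * t₁ ≤ logWeight s t₁ * t₂ := by
  set m₁ := max t₁ (Real.exp s) with hm₁
  set m₂ := max t₂ (Real.exp s) with hm₂
  have hp₁ : 0 < m₁ := by positivity
  have hp₂ : 0 < m₂ := by positivity
  have hm : m₁ ≤ m₂ := max_le_max_right _ h
  have hL : Real.log m₁ ≤ Real.log m₂ := Real.log_le_log hp₁ hm
  have hLs : s ≤ Real.log m₁ := le_log_max s t₁
  have hLL : Real.log (Real.log m₁) ≤ Real.log (Real.log m₂) :=
    Real.log_le_log (by linarith) hL
  have hdiv : Real.log m₂ / s - Real.log m₁ / s ≤ Real.log m₂ - Real.log m₁ := by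
    rw [← sub_div]
    exact div_le_self (by linarith) hs.le
  have h1 : logWeight s t₂ ≤ logWeight s t₁ * (m₂ / m₁) := by
    have : logWeight s t₁ * (m₂ / m₁) = Real.exp (Real.log m₁ / s - Real.log (Real.log m₁) +
        (Real.log m₂ - Real.log m₁)) := by
      rw [Real.exp_add, Real.exp_sub (Real.log m₂), Real.exp_log hp₁, Real.exp_log hp₂]
      rfl
    rw [this]
    exact Real.exp_le_exp.2 (by linarith)
  have h2 : m₂ * t₁ ≤ m₁ * t₂ := by
    rcases max_cases t₂ (Real.exp s) with ⟨e, _⟩ | ⟨e, _⟩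
    · rw [hm₂, e, mul_comm]
      exact mul_le_mul_of_nonneg_right (le_max_left _ _) (h₁.trans h)
    · rw [hm₂, e]
      exact mul_le_mul (le_max_right _ _) h h₁ hp₁.le
  have h3 : 0 < logWeight s t₁ := Real.exp_pos _
  calc logWeight s t₂ * t₁ ≤ logWeight s t₁ * (m₂ / m₁) * t₁ := mul_le_mul_of_nonneg_right h1 h₁
    _ = logWeight s t₁ * (m₂ * t₁ / m₁) := by ring
    _ ≤ logWeight s t₁ * t₂ := by
      refine mul_le_mul_of_nonneg_left ?_ h3.le
      rwa [div_le_iff₀ hp₁, mul_comm t₂]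

theorem isSubadd_logWeight {s : ℝ} (hs : 1 < s) : IsSubadd (logWeight s) := by
  intro t₁ t₂ h₁ h₂
  rcases (add_nonneg h₁ h₂).eq_or_lt with h | h
  · have e₁ : t₁ = 0 := by linarith
    have e₂ : t₂ = 0 := by linarith
    subst e₁ e₂
    have : 0 < logWeight s 0 := Real.exp_pos _
    rw [add_zero]
    linarith
  · have e₁ := logWeight_mul_le hs h₁ (le_add_of_nonneg_right h₂)
    have e₂ := logWeight_mul_le hs h₂ (le_add_of_nonneg_left h₁)
    refine le_of_mul_le_mul_right ?_ h
    linarith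

theorem logWeight_eventuallyEq {s : ℝ} (hs : 1 < s) :
    logWeight s =ᶠ[atTop] fun t => t ^ (1 / s) / Real.log t := by
  filter_upwards [eventually_ge_atTop (Real.exp s)] with t ht using logWeight_eq hs ht

theorem isLittleO_logWeight {s : ℝ} (hs : 1 < s) {f : ℝ → ℝ}
    (hf : (fun t => f t * Real.log t) =o[atTop] fun t : ℝ => t ^ (1 / s)) :
    f =o[atTop] logWeight s := by
  have h1 := hf.mul_isBigO (isBigO_refl (fun t => (Real.log t)⁻¹) atTop)
  refine h1.congr' ?_ ?_
  · filter_upwards [eventually_gt_atTop 1] with t ht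
    rw [mul_assoc, mul_inv_cancel₀ (Real.log_pos ht).ne', mul_one]
  · filter_upwards [logWeight_eventuallyEq hs] with t ht
    rw [ht, ← div_eq_mul_inv]

theorem logWeight_isLittleO {s : ℝ} (hs : 1 < s) :
    logWeight s =o[atTop] gevreyWeight s := by
  have h1 : (fun t => (Real.log t)⁻¹) =o[atTop] fun _ : ℝ => (1 : ℝ) :=
    (isLittleO_one_iff ℝ).2 Real.tendsto_log_atTop.inv_tendsto_atTop
  have h2 := (isBigO_refl (fun t : ℝ => t ^ (1 / s)) atTop).mul_isLittleO h1
  refine h2.congr' ?_ (Eventually.of_forall fun t => ?_)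
  · filter_upwards [logWeight_eventuallyEq hs] with t ht
    rw [ht, ← div_eq_mul_inv]
  · simp [gevreyWeight]

theorem logWeight_exp (s t : ℝ) :
    logWeight s (Real.exp t) = Real.exp (max t s / s - Real.log (max t s)) := by
  have : max (Real.exp t) (Real.exp s) = Real.exp (max t s) :=
    (Real.exp_monotone.map_max).symm
  rw [logWeight, this, Real.log_exp]

theorem isWeight_logWeight {s : ℝ} (hs : 1 < s) : IsWeight (logWeight s) where
  continuousOn := (continuous_logWeight (by linarith)).continuousOn
  monotoneOn := (monotone_logWeight (by linarith)).monotoneOn _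
  nonneg t _ := (Real.exp_pos _).le
  alpha := (isSubadd_logWeight hs).alpha
  beta := by
    have h1 : 1 / s < 1 := (div_lt_one (by linarith)).2 hs
    have hI := (integrableOn_Ioi_rpow_of_lt (a := 1 / s - 2) (by linarith) one_pos).const_mul
      (Real.exp 1)
    refine hI.mono' ?_ ?_
    · exact ((continuous_logWeight (by linarith)).measurable.div
        (measurable_id.pow_const 2)).aestronglyMeasurable
    · refine (ae_restrict_iff' measurableSet_Ioi).2 (Eventually.of_forall fun t ht => ?_)
      have ht1 : 1 < t := ht
      have ht0 : 0 < t := by linarith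
      have hls := le_log_max s t
      -- For `t > 1` one has `max t (exp s) ≤ t * exp s`; dividing the logarithm by `s` leaves the
      -- factor `exp 1`.
      have hle : logWeight s t ≤ Real.exp 1 * t ^ (1 / s) := by
        rw [Real.rpow_def_of_pos ht0, ← Real.exp_add]
        refine Real.exp_le_exp.2 ?_
        have h2 : 0 ≤ Real.log (Real.log (max t (Real.exp s))) := Real.log_nonneg (by linarith)
        have h3 : Real.log (max t (Real.exp s)) ≤ Real.log t + s := by
          rw [← Real.log_exp s, ← Real.log_mul ht0.ne' (Real.exp_pos _).ne', Real.log_exp]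
          refine Real.log_le_log (by positivity) (max_le ?_ ?_)
          · exact le_mul_of_one_le_right ht0.le (Real.one_le_exp (by linarith))
          · exact le_mul_of_one_le_left (Real.exp_pos _).le ht1.le
        have h4 : Real.log (max t (Real.exp s)) / s ≤ (Real.log t + s) / s :=
          div_le_div_of_nonneg_right h3 (by linarith)
        have h5 : (Real.log t + s) / s = 1 + Real.log t * (1 / s) := by field_simp; ring
        linarith
      have hnn : 0 ≤ logWeight s t := (Real.exp_pos _).le
      rw [Real.norm_of_nonneg (div_nonneg hnn (by positivity)), Real.rpow_sub ht0, ← mul_div_assoc]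
      norm_num
      norm_num at hle
      gcongr
  gamma := by
    refine isLittleO_logWeight hs ?_
    have := isLittleO_log_rpow_rpow_atTop 2 (show 0 < 1 / s by positivity)
    refine this.congr_left fun t => ?_
    norm_num [sq]
  delta := by
    simp only [logWeight_exp]
    have hs0 : 0 < s := by linarith
    have hmax : ConvexOn ℝ univ fun t : ℝ => max t s :=
      (convexOn_id convex_univ).sup (convexOn_const s convex_univ)
    have hg : ConvexOn ℝ (Ici s) fun y : ℝ => y / s - Real.log y := by
      refine ConvexOn.sub ?_ ((strictConcaveOn_log_Ioi.concaveOn).subset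
        (fun y hy => hs0.trans_le hy) (convex_Ici s))
      refine ((LinearMap.mulRight ℝ (1 / s)).convexOn (convex_Ici s)).congr fun y _ => ?_
      simp [div_eq_mul_inv]
    have hsub : (fun t : ℝ => max t s) '' univ ⊆ Ici s := by
      rintro _ ⟨t, _, rfl⟩
      exact mem_Ici.2 (le_max_right t s)
    have himg : Convex ℝ ((fun t : ℝ => max t s) '' univ) := by
      have : (fun t : ℝ => max t s) '' univ = Ici s :=
        hsub.antisymm fun y hy => ⟨y, trivial, max_eq_left hy⟩
      rw [this]
      exact convex_Ici s
    -- An increasing convex function of the convex function `max t s` is convex.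
    have h1 : ConvexOn ℝ univ fun t : ℝ => max t s / s - Real.log (max t s) :=
      (hg.subset hsub himg).comp hmax ((monotoneOn_div_sub_log hs0).mono hsub)
    refine ⟨convex_univ, fun x _ y _ p q hp hq hpq => ?_⟩
    exact (Real.exp_le_exp.2 (h1.2 (mem_univ x) (mem_univ y) hp hq hpq)).trans
      (convexOn_exp.2 (mem_univ _) (mem_univ _) hp hq hpq)

theorem isBetween_logWeight {s s' : ℝ} (hs : 1 < s) (hs' : s < s') :
    IsBetween s s' (logWeight s) where
  isWeight := isWeight_logWeight hs
  subadd := isSubadd_logWeight hs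
  upper := logWeight_isLittleO hs
  lower := by
    refine isLittleO_logWeight hs ?_
    have hlt : 1 / s' < 1 / s := one_div_lt_one_div_of_lt (by linarith) hs'
    have h1 := (isBigO_refl (gevreyWeight s') atTop).mul_isLittleO
      (isLittleO_log_rpow_atTop (r := 1 / s - 1 / s') (by linarith))
    refine h1.congr' EventuallyEq.rfl ?_
    filter_upwards [eventually_gt_atTop 0] with t ht
    rw [gevreyWeight, ← Real.rpow_add ht]
    ring_nf

/-- Equal growth would make `t ^ (1 / r)` little-o of itself: for `r ≤ s` because `ω = o(t ^ (1 /
s))`, for `r > s` because `t ^ (1 / r) = o(ω)`. -/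
theorem not_isTheta_logWeight {s : ℝ} (hs : 1 < s) {r : ℝ} (hr : 1 < r) :
    ¬ logWeight s =Θ[atTop] gevreyWeight r := by
  intro h
  have hne : ∃ᶠ t in atTop, gevreyWeight r t ≠ 0 := by
    refine Eventually.frequently ?_
    filter_upwards [eventually_gt_atTop 0] with t ht using (Real.rpow_pos_of_pos ht _).ne'
  refine isLittleO_irrefl hne ?_
  rcases le_or_gt r s with hrs | hrs
  · refine h.2.trans_isLittleO ((logWeight_isLittleO hs).trans_isBigO ?_)
    rcases hrs.eq_or_lt with rfl | hrs
    · exact isBigO_refl _ _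
    · exact (isLittleO_gevreyWeight (by linarith) hrs).isBigO
  · exact (isBetween_logWeight hs hrs).lower.trans_isBigO h.1

end Ultradiff

namespace Ultradiff

/-! ### Averages and a Gevrey step function -/

/-- The mean value of `f` over `[x - a, x]`. -/
noncomputable def avg (a : ℝ) (f : ℝ → ℝ) (x : ℝ) : ℝ := a⁻¹ * ∫ t in (x - a)..x, f t

/-- Averaging gains one derivative, at the price `2 / a` in the sup norm. -/
theorem hasDerivAt_avg (a : ℝ) {f : ℝ → ℝ} (hf : Continuous f) (x : ℝ) :
    HasDerivAt (avg a f) (a⁻¹ * (f x - f (x - a))) x := by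
  have hd : ∀ y, HasDerivAt (fun z => ∫ t in (0 : ℝ)..z, f t) (f y) y := fun y =>
    intervalIntegral.integral_hasDerivAt_right (hf.intervalIntegrable _ _)
      (hf.stronglyMeasurableAtFilter _ _) hf.continuousAt
  have he : avg a f = fun z => a⁻¹ * ((∫ t in (0 : ℝ)..z, f t) - ∫ t in (0 : ℝ)..(z - a), f t) := by
    funext z
    rw [avg, intervalIntegral.integral_interval_sub_left (hf.intervalIntegrable _ _)
      (hf.intervalIntegrable _ _)]
  rw [he]
  exact ((hd x).sub ((hd (x - a)).comp_sub_const x a)).const_mul _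

theorem continuous_avg (a : ℝ) {f : ℝ → ℝ} (hf : Continuous f) : Continuous (avg a f) :=
  continuous_iff_continuousAt.2 fun x => (hasDerivAt_avg a hf x).continuousAt

theorem abs_avg_sub_le {a : ℝ} (ha : 0 < a) {f g : ℝ → ℝ} (hf : Continuous f) (hg : Continuous g)
    {C : ℝ} {x : ℝ} (h : ∀ t ∈ Icc (x - a) x, |f t - g t| ≤ C) : |avg a f x - avg a g x| ≤ C := by
  have h1 : avg a f x - avg a g x = a⁻¹ * ∫ t in (x - a)..x, (f t - g t) := by
    rw [avg, avg, intervalIntegral.integral_sub (hf.intervalIntegrable _ _)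
      (hg.intervalIntegrable _ _), mul_sub]
  have h2 : ‖∫ t in (x - a)..x, (f t - g t)‖ ≤ C * |x - (x - a)| := by
    refine intervalIntegral.norm_integral_le_of_norm_le_const fun t ht => ?_
    rw [uIoc_of_le (by linarith)] at ht
    exact h t ⟨ht.1.le, ht.2⟩
  rw [sub_sub_cancel, abs_of_pos ha] at h2
  rw [h1, abs_mul, abs_inv, abs_of_pos ha, inv_mul_le_iff₀ ha, mul_comm]
  exact h2

theorem avg_const {a : ℝ} (ha : 0 < a) (c x : ℝ) : avg a (fun _ => c) x = c := by
  simp [avg, ha.ne']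

theorem abs_avg_sub_const_le {a : ℝ} (ha : 0 < a) {f : ℝ → ℝ} (hf : Continuous f) {c C x : ℝ}
    (h : ∀ t ∈ Icc (x - a) x, |f t - c| ≤ C) : |avg a f x - c| ≤ C := by
  have := abs_avg_sub_le ha hf (continuous_const (y := c)) h
  rwa [avg_const ha] at this

/-- The function `0` for `x ≤ 0`, `x` on `[0, 1]`, and `1` for `x ≥ 1`. -/
noncomputable def ramp (x : ℝ) : ℝ := max 0 (min 1 x)

theorem continuous_ramp : Continuous ramp :=
  continuous_const.max (continuous_const.min continuous_id)

theorem abs_ramp_sub_le (x y : ℝ) : |ramp x - ramp y| ≤ |x - y| := by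
  have h1 := abs_max_sub_max_le_max 0 (min 1 x) 0 (min 1 y)
  have h2 := abs_min_sub_min_le_max 1 x 1 y
  simp only [sub_self, abs_zero] at h1 h2
  exact h1.trans (max_le (abs_nonneg _) (h2.trans (max_le (abs_nonneg _) le_rfl)))

/-- `j` successive averages of the ramp, with lengths `a k, …, a (k + j - 1)`. -/
noncomputable def iterAvg (a : ℕ → ℝ) : ℕ → ℕ → ℝ → ℝ
  | _, 0 => ramp
  | k, j + 1 => avg (a k) (iterAvg a (k + 1) j)

theorem continuous_iterAvg (a : ℕ → ℝ) (k j : ℕ) : Continuous (iterAvg a k j) := by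
  induction j generalizing k with
  | zero => exact continuous_ramp
  | succ j ih => exact continuous_avg _ (ih _)


/-- The two iterates differ only in the innermost average, of length `a (k + j)`, applied to the
1-Lipschitz ramp; the outer averages do not increase distances. -/
theorem abs_iterAvg_succ_sub_le {a : ℕ → ℝ} (ha : ∀ k, 0 < a k) (k j : ℕ) (x : ℝ) :
    |iterAvg a k (j + 1) x - iterAvg a k j x| ≤ a (k + j) := by
  induction j generalizing k x with
  | zero =>
    refine abs_avg_sub_const_le (ha k) continuous_ramp fun t ht => ?_
    refine (abs_ramp_sub_le _ _).trans ?_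
    rw [abs_le]
    constructor <;> simp <;> linarith [ht.1, ht.2, ha k]
  | succ j ih =>
    refine abs_avg_sub_le (ha k) (continuous_iterAvg _ _ _) (continuous_iterAvg _ _ _) fun t _ => ?_
    have := ih (k + 1) t
    rwa [add_right_comm, add_assoc] at this

theorem abs_iterAvg_le {a : ℕ → ℝ} (ha : ∀ k, 0 < a k) (k j : ℕ) (x : ℝ) : |iterAvg a k j x| ≤ 1 := by
  induction j generalizing k x with
  | zero =>
    have h0 : 0 ≤ ramp x := le_max_left _ _
    have h1 : ramp x ≤ 1 := max_le zero_le_one (min_le_left _ _)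
    exact abs_le.2 ⟨by change _ ≤ ramp x; linarith, h1⟩
  | succ j ih =>
    have := abs_avg_sub_const_le (ha k) (continuous_iterAvg a (k + 1) j) (c := 0) (C := 1) (x := x)
      fun t _ => by simpa using ih (k + 1) t
    simpa [iterAvg] using this

theorem iterAvg_of_nonpos {a : ℕ → ℝ} (ha : ∀ k, 0 < a k) (k j : ℕ) {x : ℝ} (hx : x ≤ 0) : iterAvg a k j x = 0 := by
  induction j generalizing k x with
  | zero => simp [iterAvg, ramp, hx]
  | succ j ih =>
    have := abs_avg_sub_const_le (ha k) (continuous_iterAvg a (k + 1) j) (c := 0) (C := 0) (x := x)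
      fun t ht => by simp [ih (k + 1) (ht.2.trans hx)]
    simpa [iterAvg] using this

theorem iterAvg_of_ge {a : ℕ → ℝ} (ha : ∀ k, 0 < a k) (k j : ℕ) {x : ℝ} (hx : 1 + ∑ i ∈ Finset.range j, a (k + i) ≤ x) :
    iterAvg a k j x = 1 := by
  induction j generalizing k x with
  | zero =>
    have : 1 ≤ x := by simpa using hx
    simp [iterAvg, ramp, this]
  | succ j ih =>
    have := abs_avg_sub_const_le (ha k) (continuous_iterAvg a (k + 1) j) (c := 1) (C := 0) (x := x)
      fun t ht => by
        rw [ih (k + 1), sub_self, abs_zero]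
        rw [Finset.sum_range_succ'] at hx
        have e : ∀ i, k + 1 + i = k + (i + 1) := fun i => by ring
        simp only [e]
        simp only [add_zero] at hx
        linarith [ht.1]
    simpa [iterAvg, sub_eq_zero] using this

/-- The limit of the iterated averages of the ramp. -/
noncomputable def limAvg (a : ℕ → ℝ) (k : ℕ) (x : ℝ) : ℝ :=
  ramp x + ∑' j, (iterAvg a k (j + 1) x - iterAvg a k j x)


theorem tendstoUniformly_iterAvg {a : ℕ → ℝ} (ha : ∀ k, 0 < a k) (hs : Summable a)
    (k : ℕ) :
    TendstoUniformly (iterAvg a k) (limAvg a k) atTop := by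
  have h := tendstoUniformly_tsum_nat (hs.comp_injective (add_right_injective k))
    (f := fun j x => iterAvg a k (j + 1) x - iterAvg a k j x)
    fun j x => abs_iterAvg_succ_sub_le ha k j x
  rw [Metric.tendstoUniformly_iff] at h ⊢
  intro ε hε
  filter_upwards [h ε hε] with N hN x
  have := hN x
  rw [Finset.sum_range_sub (fun j => iterAvg a k j x)] at this
  rw [Real.dist_eq] at this ⊢
  convert this using 2
  simp only [limAvg, iterAvg]
  ring

theorem continuous_limAvg {a : ℕ → ℝ} (ha : ∀ k, 0 < a k) (hs : Summable a)
    (k : ℕ) : Continuous (limAvg a k) :=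
  (tendstoUniformly_iterAvg ha hs k).continuous
    (Eventually.of_forall fun j => continuous_iterAvg a k j).frequently

/-- Each limit is an average of the next one, so its derivative is a difference quotient of the next
one. Smoothness and the derivative bounds follow by induction from this. -/
theorem limAvg_eq_avg {a : ℕ → ℝ} (ha : ∀ k, 0 < a k) (hs : Summable a)
    (k : ℕ) : limAvg a k = avg (a k) (limAvg a (k + 1)) := by
  funext x
  have h1 : Tendsto (fun j => iterAvg a k (j + 1) x) atTop (𝓝 (limAvg a k x)) :=
    ((tendstoUniformly_iterAvg ha hs k).tendsto_at x).comp (tendsto_add_atTop_nat 1)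
  refine tendsto_nhds_unique h1 ?_
  rw [Metric.tendsto_nhds]
  intro ε hε
  filter_upwards [Metric.tendstoUniformly_iff.1 (tendstoUniformly_iterAvg ha hs (k + 1)) (ε / 2)
    (half_pos hε)] with j hj
  rw [Real.dist_eq]
  refine lt_of_le_of_lt (abs_avg_sub_le (ha k) (continuous_iterAvg _ _ _)
    (continuous_limAvg ha hs _) (C := ε / 2) fun t _ => ?_) (half_lt_self hε)
  have := hj t
  rw [dist_comm, Real.dist_eq] at this
  exact this.le

theorem deriv_limAvg {a : ℕ → ℝ} (ha : ∀ k, 0 < a k) (hs : Summable a)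
    (k : ℕ) : deriv (limAvg a k) =
    fun x => (a k)⁻¹ * (limAvg a (k + 1) x - limAvg a (k + 1) (x - a k)) := by
  funext x
  rw [limAvg_eq_avg ha hs k]
  exact (hasDerivAt_avg _ (continuous_limAvg ha hs _) x).deriv

theorem contDiff_limAvg {a : ℕ → ℝ} (ha : ∀ k, 0 < a k) (hs : Summable a)
    (p k : ℕ) : ContDiff ℝ p (limAvg a k) := by
  induction p generalizing k with
  | zero => exact contDiff_zero.2 (continuous_limAvg ha hs k)
  | succ p ih =>
    rw [Nat.cast_add, Nat.cast_one, contDiff_succ_iff_deriv]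
    refine ⟨fun x => ?_, by simp, ?_⟩
    · rw [limAvg_eq_avg ha hs k]
      exact (hasDerivAt_avg _ (continuous_limAvg ha hs _) x).differentiableAt
    · rw [deriv_limAvg ha hs]
      exact contDiff_const.mul ((ih _).sub ((ih _).comp (contDiff_id.sub contDiff_const)))

theorem abs_limAvg_le {a : ℕ → ℝ} (ha : ∀ k, 0 < a k) (hs : Summable a)
    (k : ℕ) (x : ℝ) : |limAvg a k x| ≤ 1 :=
  le_of_tendsto ((tendstoUniformly_iterAvg ha hs k).tendsto_at x).abs
    (Eventually.of_forall fun j => abs_iterAvg_le ha k j x)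

/-- Every derivative strips off the outermost average and leaves two terms divided by its length. -/
theorem abs_iteratedDeriv_limAvg_le {a : ℕ → ℝ} (ha : ∀ k, 0 < a k) (hs : Summable a)
    (p k : ℕ) (x : ℝ) :
    |iteratedDeriv p (limAvg a k) x| ≤ ∏ i ∈ Finset.range p, (2 / a (k + i)) := by
  induction p generalizing k x with
  | zero => simpa using abs_limAvg_le ha hs k x
  | succ p ih =>
    have hc := contDiff_limAvg ha hs p (k + 1)
    have hc' : ∀ y, ContDiffAt ℝ p (fun z => limAvg a (k + 1) (z - a k)) y := fun y =>
      (hc.comp (contDiff_id.sub contDiff_const)).contDiffAt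
    rw [iteratedDeriv_succ', deriv_limAvg ha hs, iteratedDeriv_const_mul_field,
      iteratedDeriv_fun_sub hc.contDiffAt
        (hc' x), iteratedDeriv_comp_sub_const,
      abs_mul, abs_inv, abs_of_pos (ha k), Finset.prod_range_succ']
    have e : ∀ i, k + 1 + i = k + (i + 1) := fun i => by ring
    have h1 := ih (k + 1) x
    have h2 := ih (k + 1) (x - a k)
    simp only [e] at h1 h2
    have h3 := (abs_sub _ _).trans (add_le_add h1 h2)
    rw [add_zero, div_eq_inv_mul 2, mul_comm, mul_comm (a k)⁻¹, ← mul_assoc, mul_two]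
    exact mul_le_mul_of_nonneg_right h3 (inv_pos.2 (ha k)).le

/-- A step function with derivative bounds of Gevrey type `τ > 1`. -/
theorem exists_gevrey_step {τ : ℝ} (hτ : 1 < τ) :
    ∃ (H : ℝ → ℝ) (R : ℝ), 0 < R ∧ ContDiff ℝ ((⊤ : ℕ∞) : WithTop ℕ∞) H ∧
      (∀ x ≤ 0, H x = 0) ∧ (∀ x, R ≤ x → H x = 1) ∧
      ∀ (p : ℕ) (x : ℝ), ‖iteratedFDeriv ℝ p H x‖ ≤ 2 ^ p * (p.factorial : ℝ) ^ τ := by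
  -- These lengths are summable because `τ > 1`, and the product of `2 / a k` over `k < p` is
  -- exactly `2 ^ p * (p!) ^ τ`.
  set a : ℕ → ℝ := fun k => ((k + 1 : ℕ) : ℝ) ^ (-τ) with ha_def
  have ha : ∀ k, 0 < a k := fun k => by positivity
  have hs : Summable a :=
    (summable_nat_add_iff 1).2 (Real.summable_nat_rpow.2 (by linarith))
  refine ⟨limAvg a 0, 1 + ∑' i, a i, 
    by have : 0 ≤ ∑' i, a i := tsum_nonneg fun i => (ha i).le
       linarith,
    contDiff_infty.2 fun p => contDiff_limAvg ha hs p 0, fun x hx => ?_, fun x hx => ?_,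
    fun p x => ?_⟩
  · refine tendsto_nhds_unique ((tendstoUniformly_iterAvg ha hs 0).tendsto_at x) ?_
    simp only [iterAvg_of_nonpos ha 0 _ hx, tendsto_const_nhds]
  · refine tendsto_nhds_unique ((tendstoUniformly_iterAvg ha hs 0).tendsto_at x) ?_
    have : ∀ j, iterAvg a 0 j x = 1 := fun j => by
      refine iterAvg_of_ge ha 0 j ?_
      simp only [zero_add]
      linarith [hs.sum_le_tsum (Finset.range j) fun i _ => (ha i).le]
    simp only [this, tendsto_const_nhds]
  · rw [norm_iteratedFDeriv_eq_norm_iteratedDeriv, Real.norm_eq_abs]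
    refine (abs_iteratedDeriv_limAvg_le ha hs p 0 x).trans (le_of_eq ?_)
    induction p with
    | zero => simp
    | succ p ih =>
      rw [Finset.prod_range_succ, ih, pow_succ, Nat.factorial_succ, zero_add, Nat.cast_mul,
        Real.mul_rpow (by positivity) (by positivity), ha_def]
      simp only
      rw [Real.rpow_neg (by positivity), div_inv_eq_mul]
      ring

/-! ### Functions with global Gevrey bounds -/

/-- Smooth functions with global derivative bounds of Gevrey type `τ`. -/
def GlobalGevrey {E F : Type*} [NormedAddCommGroup E] [NormedSpace ℝ E] [NormedAddCommGroup F]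
    [NormedSpace ℝ F] (τ : ℝ) (f : E → F) : Prop :=
  ContDiff ℝ ((⊤ : ℕ∞) : WithTop ℕ∞) f ∧ ∃ A B : ℝ, 0 ≤ A ∧ 0 ≤ B ∧ ∀ (k : ℕ) (x : E),
    ‖iteratedFDeriv ℝ k f x‖ ≤ A * B ^ k * (k.factorial : ℝ) ^ τ

variable {E : Type*} [NormedAddCommGroup E] [NormedSpace ℝ E]

theorem GlobalGevrey.comp_affine {τ : ℝ} {H : ℝ → ℝ} (hH : GlobalGevrey τ H) (b : ℝ)
    (φ : E →L[ℝ] ℝ) : GlobalGevrey τ fun x => H (b + φ x) := by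
  obtain ⟨hc, A, B, hA, hB, h⟩ := hH
  have hc' : ContDiff ℝ ((⊤ : ℕ∞) : WithTop ℕ∞) fun y => H (b + y) :=
    hc.comp (contDiff_const.add contDiff_id)
  refine ⟨hc'.comp φ.contDiff, A, B * ‖φ‖, hA, by positivity, fun k x => ?_⟩
  have e := φ.iteratedFDeriv_comp_right hc' x (i := k) (by norm_cast; exact le_top)
  rw [iteratedFDeriv_comp_add_left] at e
  change ‖iteratedFDeriv ℝ k ((fun y => H (b + y)) ∘ φ) x‖ ≤ _
  rw [e]
  refine (ContinuousMultilinearMap.norm_compContinuousLinearMap_le _ _).trans ?_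
  rw [Finset.prod_const, Finset.card_univ, Fintype.card_fin, mul_pow]
  calc _ ≤ A * B ^ k * (k.factorial : ℝ) ^ τ * ‖φ‖ ^ k :=
        mul_le_mul_of_nonneg_right (h k _) (by positivity)
    _ = _ := by ring

theorem factorial_rpow_mul_le {τ : ℝ} (hτ : 0 ≤ τ) {i k : ℕ} (hi : i ≤ k) :
    (i.factorial : ℝ) ^ τ * ((k - i).factorial : ℝ) ^ τ ≤ (k.factorial : ℝ) ^ τ := by
  rw [← Real.mul_rpow (by positivity) (by positivity)]
  refine Real.rpow_le_rpow (by positivity) ?_ hτ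
  exact_mod_cast Nat.le_of_dvd (Nat.factorial_pos k) (Nat.factorial_mul_factorial_dvd_factorial hi)

/-- By the Leibniz rule and the binomial theorem the geometric rates add up, since `i! (k - i)! ≤
k!`. -/
theorem GlobalGevrey.mul {τ : ℝ} (hτ : 0 ≤ τ) {f g : E → ℝ} (hf : GlobalGevrey τ f)
    (hg : GlobalGevrey τ g) : GlobalGevrey τ fun x => f x * g x := by
  obtain ⟨hfc, A, B, hA, hB, hf⟩ := hf
  obtain ⟨hgc, A', B', hA', hB', hg⟩ := hg
  refine ⟨hfc.mul hgc, A * A', B + B', by positivity, by positivity, fun k x => ?_⟩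
  refine (norm_iteratedFDeriv_mul_le hfc hgc x (n := k) (by norm_cast; exact le_top)).trans ?_
  rw [add_pow, Finset.mul_sum, Finset.sum_mul]
  refine Finset.sum_le_sum fun i hi => ?_
  have hi : i ≤ k := Nat.lt_succ_iff.1 (Finset.mem_range.1 hi)
  calc (k.choose i : ℝ) * ‖iteratedFDeriv ℝ i f x‖ * ‖iteratedFDeriv ℝ (k - i) g x‖
      ≤ (k.choose i : ℝ) * (A * B ^ i * (i.factorial : ℝ) ^ τ) *
        (A' * B' ^ (k - i) * ((k - i).factorial : ℝ) ^ τ) := by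
        gcongr
        · exact hf i x
        · exact hg (k - i) x
    _ = A * A' * (B ^ i * B' ^ (k - i) * k.choose i) *
        ((i.factorial : ℝ) ^ τ * ((k - i).factorial : ℝ) ^ τ) := by ring
    _ ≤ _ := mul_le_mul_of_nonneg_left (factorial_rpow_mul_le hτ hi) (by positivity)

theorem globalGevrey_one (τ : ℝ) : GlobalGevrey τ fun _ : E => (1 : ℝ) := by
  refine ⟨contDiff_const, 1, 0, zero_le_one, le_rfl, fun k x => ?_⟩
  rcases k with _ | k
  · simp
  · simp [iteratedFDeriv_const_of_ne (𝕜 := ℝ) (Nat.succ_ne_zero k) (1 : ℝ)]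

theorem GlobalGevrey.prod {ι : Type*} {τ : ℝ} (hτ : 0 ≤ τ) {f : ι → E → ℝ} (s : Finset ι)
    (hf : ∀ i ∈ s, GlobalGevrey τ (f i)) : GlobalGevrey τ fun x => ∏ i ∈ s, f i x := by
  classical
  induction s using Finset.induction_on with
  | empty => simpa using globalGevrey_one τ
  | insert i s hi ih =>
    simp only [Finset.prod_insert hi]
    exact (hf i (Finset.mem_insert_self i s)).mul hτ
      (ih fun j hj => hf j (Finset.mem_insert_of_mem hj))

theorem GlobalGevrey.ofReal {τ : ℝ} {f : E → ℝ} (hf : GlobalGevrey τ f) :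
    GlobalGevrey τ fun x => (f x : ℂ) := by
  obtain ⟨hc, A, B, hA, hB, h⟩ := hf
  refine ⟨Complex.ofRealCLM.contDiff.comp hc, A, B, hA, hB, fun k x => ?_⟩
  have := Complex.ofRealLI.norm_iteratedFDeriv_comp_left (hc.contDiffAt (x := x)) (i := k)
    (by norm_cast; exact le_top)
  exact this.trans_le (h k x)

theorem factorial_rpow_le {τ : ℝ} (hτ : 0 ≤ τ) (k : ℕ) :
    (k.factorial : ℝ) ^ τ ≤ (k : ℝ) ^ (τ * k) := by
  rw [mul_comm τ, Real.rpow_mul (by positivity), Real.rpow_natCast]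
  exact Real.rpow_le_rpow (by positivity) (by exact_mod_cast Nat.factorial_le_pow k) hτ

theorem norm_le_sum_abs {n : ℕ} (x : EuclideanSpace ℝ (Fin n)) : ‖x‖ ≤ ∑ i, |x i| := by
  have hx : x = ∑ i, (x i) • EuclideanSpace.single i (1 : ℝ) := by
    ext i
    simp [Finset.sum_apply, Pi.single_apply]
  calc ‖x‖ = ‖∑ i, (x i) • EuclideanSpace.single i (1 : ℝ)‖ := by rw [← hx]
    _ ≤ ∑ i, ‖(x i) • EuclideanSpace.single i (1 : ℝ)‖ := norm_sum_le _ _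
    _ = _ := by simp [norm_smul]

/-- Cut-off functions in Beurling classes of Gevrey type `σ > 1`. -/
theorem exists_cutoff (n : ℕ) {σ δ : ℝ} (hσ : 1 < σ) (hδ : 0 < δ) :
    ∃ χ : EuclideanSpace ℝ (Fin n) → ℂ, χ ∈ beurling (gevreyWeight σ) univ ∧
      tsupport χ ⊆ Metric.ball 0 (2 * δ) ∧ ∀ᶠ y in 𝓝 0, χ y = 1 := by
  -- Bounds of an order `τ` strictly below `σ` give the Beurling class of order `σ`.
  obtain ⟨τ, hτ1, hτσ⟩ := exists_between hσ
  obtain ⟨H, R, hR, hHc, hH0, hH1, hHb⟩ := exists_gevrey_step hτ1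
  have hH : GlobalGevrey τ H := ⟨hHc, 1, 2, zero_le_one, zero_le_two, fun k x => by
    simpa using hHb k x⟩
  -- The cube `|x_i| ≤ r` lies in the ball of radius `n r < δ`; the denominator `n + 1` covers `n =
  -- 0`. Below, the step arguments `2 R ± (2 R / r) x_i` are both at least `R` for `|x_i| ≤ r / 2`,
  -- and one of them is nonpositive for `|x_i| > r`.
  set r : ℝ := δ / (n + 1) with hr
  have hr0 : 0 < r := by positivity
  let π : Fin n → EuclideanSpace ℝ (Fin n) →L[ℝ] ℝ := fun i => EuclideanSpace.proj i
  let f : EuclideanSpace ℝ (Fin n) → ℝ := fun x => ∏ i,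
    (H (2 * R + ((R * 2 / r) • π i) x) * H (2 * R + (-(R * 2 / r) • π i) x))
  have hf : GlobalGevrey τ f := GlobalGevrey.prod (by linarith) _ fun i _ =>
    (hH.comp_affine _ _).mul (by linarith) (hH.comp_affine _ _)
  have hf0 : ∀ x, f x ≠ 0 → ∀ i, |x i| ≤ r := by
    intro x hx i
    by_contra hlt
    rw [not_le] at hlt
    refine hx (Finset.prod_eq_zero (Finset.mem_univ i) ?_)
    have key : ∀ y : ℝ, r < y → 2 * R + -(R * 2 / r) * y ≤ 0 := by
      intro y hy
      have : R * 2 ≤ R * 2 / r * y := by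
        rw [div_mul_eq_mul_div, le_div_iff₀ hr0]
        exact mul_le_mul_of_nonneg_left hy.le (by positivity)
      linarith
    rcases lt_abs.1 hlt with h | h
    · exact mul_eq_zero_of_right _ (hH0 _ (key _ h))
    · refine mul_eq_zero_of_left (hH0 _ ?_) _
      have := key _ h
      change 2 * R + R * 2 / r * x i ≤ 0
      linarith
  have hf1 : ∀ᶠ x in 𝓝 0, f x = 1 := by
    filter_upwards [Metric.ball_mem_nhds (0 : EuclideanSpace ℝ (Fin n)) (half_pos hr0)] with x hx
    refine Finset.prod_eq_one fun i _ => ?_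
    have hxi : |x i| ≤ r / 2 := by
      have h1 : ‖x i‖ ≤ ‖x‖ := PiLp.norm_apply_le x i
      rw [mem_ball_zero_iff] at hx
      exact (Real.norm_eq_abs _ ▸ h1).trans hx.le
    have h2 : |R * 2 / r * x i| ≤ R := by
      rw [abs_mul, abs_of_pos (by positivity)]
      calc R * 2 / r * |x i| ≤ R * 2 / r * (r / 2) := mul_le_mul_of_nonneg_left hxi (by positivity)
        _ = R := by field_simp
    rw [abs_le] at h2
    have e1 : H (2 * R + ((R * 2 / r) • π i) x) = 1 :=
      hH1 _ (by change R ≤ 2 * R + R * 2 / r * x i; linarith)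
    have e2 : H (2 * R + (-(R * 2 / r) • π i) x) = 1 :=
      hH1 _ (by change R ≤ 2 * R + -(R * 2 / r) * x i; linarith)
    rw [e1, e2, one_mul]
  refine ⟨fun x => (f x : ℂ), ?_, ?_, ?_⟩
  · have hσ0 : 0 < σ := by linarith
    refine mem_beurling_of_gevreyBoundOn (youngBdd_gevreyWeight hσ0)
      (monotoneOn_gevreyWeight hσ0) (s := τ) (by linarith)
      (isLittleO_gevreyWeight (by linarith) hτσ) hf.ofReal.1.contDiffOn fun K _ _ => ?_
    obtain ⟨hc, A, B, hA, hB, hb⟩ := hf.ofReal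
    refine ⟨A, B, hA, hB, fun α x _ => ?_⟩
    refine (norm_multiD_le hc.contDiffAt α).trans ((hb _ x).trans ?_)
    rw [mul_assoc]
    have := factorial_rpow_le (show 0 ≤ τ by linarith) (∑ i, α i)
    gcongr
  · have hsub : tsupport (fun x => (f x : ℂ)) ⊆ {x | ∀ i, |x i| ≤ r} := by
      refine closure_minimal (fun x hx => hf0 x (by simpa using hx)) ?_
      simp only [ofPred_forall]
      refine isClosed_iInter fun i => isClosed_le ?_ continuous_const
      exact (π i).continuous.abs
    intro x hx
    rw [mem_ball_zero_iff]
    calc ‖x‖ ≤ ∑ i, |x i| := norm_le_sum_abs x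
      _ ≤ ∑ _i : Fin n, r := Finset.sum_le_sum fun i _ => hsub hx i
      _ = n * r := by simp
      _ ≤ (n + 1) * r := by linarith
      _ = δ := by rw [hr]; field_simp
      _ < 2 * δ := by linarith
  · filter_upwards [hf1] with x hx
    rw [hx, Complex.ofReal_one]

end Ultradiff

namespace Ultradiff

/-! ### Cauchy estimates for real analytic functions -/

section Analytic

variable {E F : Type*} [NormedAddCommGroup E] [NormedSpace ℝ E] [NormedAddCommGroup F]
  [NormedSpace ℝ F]

/-- The series that bounds the recentred coefficients is increasing in `‖y‖`, so its value at radius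
`ρ` serves all `y`; it is finite because `2 ρ` stays inside the radius of convergence. -/
theorem exists_norm_changeOrigin_le (p : FormalMultilinearSeries ℝ E F) {ρ : NNReal}
    (h : (ρ + ρ : ENNReal) < p.radius) :
    ∃ C : NNReal, ∀ y : E, ‖y‖₊ ≤ ρ → ∀ k, ‖p.changeOrigin y k‖₊ * ρ ^ k ≤ C := by
  have hsum := NNReal.summable_sigma.1 (p.changeOriginSeries_summable_aux₁ h)
  refine ⟨_, fun y hy k => le_trans ?_ (hsum.2.le_tsum k fun _ _ => zero_le)⟩
  have hρ : (ρ : ENNReal) < p.radius := lt_of_le_of_lt le_self_add h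
  have hy' : (‖y‖₊ : ENNReal) < p.radius :=
    lt_of_le_of_lt (ENNReal.coe_le_coe.2 hy) hρ
  simp only [NNReal.tsum_mul_right]
  refine mul_le_mul_left ((p.nnnorm_changeOrigin_le k hy').trans ?_) _
  refine (p.changeOriginSeries_summable_aux₂ hy' k).tsum_le_tsum (fun s => ?_)
    (p.changeOriginSeries_summable_aux₂ hρ k)
  gcongr

/-- The `k`-th derivative is the sum of `p k` over the `k!` permutations of its arguments. -/
theorem norm_iteratedFDeriv_le_of_hasFPowerSeriesOnBall [CompleteSpace F] {f : E → F}
    {p : FormalMultilinearSeries ℝ E F} {x : E} {r : ENNReal} (h : HasFPowerSeriesOnBall f p x r)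
    (k : ℕ) : ‖iteratedFDeriv ℝ k f x‖ ≤ k.factorial * ‖p k‖ := by
  refine ContinuousMultilinearMap.opNorm_le_bound (by positivity) fun v => ?_
  rw [h.iteratedFDeriv_eq_sum_of_completeSpace]
  refine (norm_sum_le _ _).trans ?_
  have hb : ∀ e : Equiv.Perm (Fin k), ‖p k fun i => v (e i)‖ ≤ ‖p k‖ * ∏ i, ‖v i‖ := by
    intro e
    refine ((p k).le_opNorm _).trans (le_of_eq ?_)
    rw [Equiv.prod_comp e fun i => ‖v i‖]
  refine (Finset.sum_le_card_nsmul _ _ _ fun e _ => hb e).trans (le_of_eq ?_)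
  rw [Finset.card_univ, Fintype.card_perm, Fintype.card_fin, nsmul_eq_mul, mul_assoc]

/-- Half the radius leaves room to recentre the series at each nearby point, where the derivatives
can be read off. -/
theorem AnalyticAt.exists_iteratedFDeriv_le [CompleteSpace F] {f : E → F} {x : E}
    (hf : AnalyticAt ℝ f x) : ∃ C R : ℝ, 0 ≤ C ∧ 0 ≤ R ∧ ∀ᶠ y in 𝓝 x, ∀ k : ℕ,
      ‖iteratedFDeriv ℝ k f y‖ ≤ C * R ^ k * k.factorial := by
  obtain ⟨p, r, hp⟩ := hf
  obtain ⟨ρ', hρ0, hρ'⟩ := ENNReal.lt_iff_exists_nnreal_btwn.1 hp.r_pos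
  have hρ'0 : 0 < ρ' := by exact_mod_cast hρ0
  set ρ := ρ' / 2 with hρ
  have hρp : 0 < ρ := by positivity
  have hsum : (ρ + ρ : ENNReal) < r := by
    rw [← ENNReal.coe_add, hρ, add_halves]
    exact hρ'
  have hρr : (ρ : ENNReal) < r := lt_of_le_of_lt le_self_add hsum
  obtain ⟨C, hC⟩ := exists_norm_changeOrigin_le p (hsum.trans_le hp.r_le)
  refine ⟨C, (ρ : ℝ)⁻¹, C.2, by positivity, ?_⟩
  filter_upwards [Metric.ball_mem_nhds x (show (0 : ℝ) < ρ from hρp)] with y hy k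
  have hy1 : ‖y - x‖₊ ≤ ρ := by
    rw [mem_ball_iff_norm] at hy
    exact_mod_cast hy.le
  have hy2 := hp.changeOrigin (y := y - x) (lt_of_le_of_lt (ENNReal.coe_le_coe.2 hy1) hρr)
  rw [add_sub_cancel] at hy2
  refine (norm_iteratedFDeriv_le_of_hasFPowerSeriesOnBall hy2 k).trans ?_
  have h1 : ‖p.changeOrigin (y - x) k‖ * (ρ : ℝ) ^ k ≤ C := by exact_mod_cast hC _ hy1 k
  have h2 : ‖p.changeOrigin (y - x) k‖ ≤ C * (ρ : ℝ)⁻¹ ^ k := by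
    rw [inv_pow, ← div_eq_mul_inv, le_div_iff₀ (pow_pos (by exact_mod_cast hρp) k)]
    exact h1
  rw [mul_comm]
  exact mul_le_mul_of_nonneg_right h2 (by positivity)

theorem AnalyticOnNhd.exists_iteratedFDeriv_le [CompleteSpace F] {f : E → F} {K : Set E}
    (hK : IsCompact K) (hf : AnalyticOnNhd ℝ f K) : ∃ C R : ℝ, 0 ≤ C ∧ 0 ≤ R ∧ ∀ y ∈ K, ∀ k : ℕ,
      ‖iteratedFDeriv ℝ k f y‖ ≤ C * R ^ k * k.factorial := by
  refine hK.induction_on (p := fun S => ∃ C R : ℝ, 0 ≤ C ∧ 0 ≤ R ∧ ∀ y ∈ S, ∀ k : ℕ,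
      ‖iteratedFDeriv ℝ k f y‖ ≤ C * R ^ k * k.factorial) ?_ ?_ ?_ ?_
  · exact ⟨0, 0, le_rfl, le_rfl, fun y hy => absurd hy (notMem_empty y)⟩
  · rintro S T hST ⟨C, R, hC, hR, h⟩
    exact ⟨C, R, hC, hR, fun y hy => h y (hST hy)⟩
  · rintro S T ⟨C, R, hC, hR, h⟩ ⟨C', R', hC', hR', h'⟩
    refine ⟨max C C', max R R', le_max_of_le_left hC, le_max_of_le_left hR, ?_⟩
    rintro y (hy | hy) k
    · refine (h y hy k).trans ?_
      gcongr
      · exact le_max_left _ _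
      · exact le_max_left _ _
    · refine (h' y hy k).trans ?_
      gcongr
      · exact le_max_right _ _
      · exact le_max_right _ _
  · intro x hx
    obtain ⟨C, R, hC, hR, h⟩ := AnalyticAt.exists_iteratedFDeriv_le (hf x hx)
    exact ⟨_, mem_nhdsWithin_of_mem_nhds h, C, R, hC, hR, fun y hy => hy⟩

end Analytic

/-- Uniform Cauchy estimates for finitely many analytic functions. -/
theorem exists_iteratedFDeriv_le_finset {E ι : Type*} [NormedAddCommGroup E] [NormedSpace ℝ E]
    {f : ι → E → ℂ} {K : Set E} (hK : IsCompact K) (s : Finset ι)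
    (hf : ∀ i ∈ s, AnalyticOnNhd ℝ (f i) K) : ∃ C R : ℝ, 0 ≤ C ∧ 0 ≤ R ∧
      ∀ i ∈ s, ∀ y ∈ K, ∀ k : ℕ, ‖iteratedFDeriv ℝ k (f i) y‖ ≤ C * R ^ k * k.factorial := by
  classical
  induction s using Finset.induction_on with
  | empty => exact ⟨0, 0, le_rfl, le_rfl, by simp⟩
  | insert i s hi ih =>
    obtain ⟨C, R, hC, hR, h⟩ := ih fun j hj => hf j (Finset.mem_insert_of_mem hj)
    obtain ⟨C', R', hC', hR', h'⟩ :=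
      AnalyticOnNhd.exists_iteratedFDeriv_le hK (hf i (Finset.mem_insert_self i s))
    refine ⟨max C C', max R R', le_max_of_le_left hC, le_max_of_le_left hR, fun j hj y hy k => ?_⟩
    rcases Finset.mem_insert.1 hj with rfl | hj
    · refine (h' y hy k).trans ?_
      gcongr
      · exact le_max_right _ _
      · exact le_max_right _ _
    · refine (h j hj y hy k).trans ?_
      gcongr
      · exact le_max_left _ _
      · exact le_max_left _ _

variable {n : ℕ}

/-- Since `k! ≤ (k!) ^ s ≤ k ^ (s k)`, Cauchy estimates are Gevrey bounds of order `s`. -/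
theorem mem_beurling_of_analyticOnNhd {ω : ℝ → ℝ} (hω : IsWeight ω) {s : ℝ} (hs : 1 < s)
    (h : ω =o[atTop] gevreyWeight s) {f : EuclideanSpace ℝ (Fin n) → ℂ}
    {Ω : Set (EuclideanSpace ℝ (Fin n))} (hf : AnalyticOnNhd ℝ f Ω) : f ∈ beurling ω Ω := by
  refine mem_beurling_of_gevreyBoundOn hω.youngBdd hω.monotoneOn (by linarith) h
    (fun x hx => (hf x hx).contDiffAt.contDiffWithinAt) fun K hK hKΩ => ?_
  obtain ⟨C, R, hC, hR, hb⟩ := AnalyticOnNhd.exists_iteratedFDeriv_le hK (hf.mono hKΩ)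
  refine ⟨C, R, hC, hR, fun α x hx => ?_⟩
  refine (norm_multiD_le (hf x (hKΩ hx)).contDiffAt α).trans ((hb x hx _).trans ?_)
  rw [mul_assoc]
  have h1 : ((∑ i, α i).factorial : ℝ) ≤ ((∑ i, α i).factorial : ℝ) ^ s :=
    Real.self_le_rpow_of_one_le (by exact_mod_cast Nat.factorial_pos _) hs.le
  have h2 := factorial_rpow_le (show 0 ≤ s by linarith) (∑ i, α i)
  have h3 := h1.trans h2
  gcongr

end Ultradiff

namespace Ultradiff

/-! ### Parameter integrals of dominated smooth families -/

variable {n : ℕ}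

theorem SmoothOn.add {f g : EuclideanSpace ℝ (Fin n) → ℂ} {U : Set (EuclideanSpace ℝ (Fin n))}
    (hf : SmoothOn f U) (hg : SmoothOn g U) : SmoothOn (fun x => f x + g x) U :=
  ContDiffOn.add hf hg

theorem SmoothOn.mul {f g : EuclideanSpace ℝ (Fin n) → ℂ} {U : Set (EuclideanSpace ℝ (Fin n))}
    (hf : SmoothOn f U) (hg : SmoothOn g U) : SmoothOn (fun x => f x * g x) U :=
  ContDiffOn.mul hf hg

theorem partialD_add {f g : EuclideanSpace ℝ (Fin n) → ℂ} {U : Set (EuclideanSpace ℝ (Fin n))}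
    (hU : IsOpen U) (hf : SmoothOn f U) (hg : SmoothOn g U) (i : Fin n) :
    EqOn (partialD i fun x => f x + g x) (fun x => partialD i f x + partialD i g x) U := by
  intro x hx
  simp only [partialD]
  rw [fderiv_fun_add (hf.differentiableAt hU hx) (hg.differentiableAt hU hx)]
  rfl

theorem partialD_mul {f g : EuclideanSpace ℝ (Fin n) → ℂ} {U : Set (EuclideanSpace ℝ (Fin n))}
    (hU : IsOpen U) (hf : SmoothOn f U) (hg : SmoothOn g U) (i : Fin n) :
    EqOn (partialD i fun x => f x * g x)
      (fun x => f x * partialD i g x + partialD i f x * g x) U := by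
  intro x hx
  simp only [partialD]
  rw [fderiv_fun_mul (hf.differentiableAt hU hx) (hg.differentiableAt hU hx)]
  simp [mul_comm]

theorem wordD_add {f g : EuclideanSpace ℝ (Fin n) → ℂ} {U : Set (EuclideanSpace ℝ (Fin n))}
    (hU : IsOpen U) (hf : SmoothOn f U) (hg : SmoothOn g U) (l : List (Fin n)) :
    EqOn (wordD l fun x => f x + g x) (fun x => wordD l f x + wordD l g x) U := by
  induction l with
  | nil => exact fun _ _ => rfl
  | cons i l ih =>
    exact (partialD_congr hU ih i).trans (partialD_add hU (hf.wordD hU l) (hg.wordD hU l) i)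

theorem wordD_append_singleton (l : List (Fin n)) (i : Fin n)
    (f : EuclideanSpace ℝ (Fin n) → ℂ) : wordD (l ++ [i]) f = wordD l (partialD i f) := by
  simp [wordD, List.foldr_append]

/-- Local domination of a family of functions by an integrable function of the parameter. -/
def Dominated (G : ℝ → EuclideanSpace ℝ (Fin n) → ℂ) (Ω : Set (EuclideanSpace ℝ (Fin n))) : Prop :=
  ∀ x₁ ∈ Ω, ∃ b : ℝ → ℝ, IntegrableOn b (Ioi 1) ∧
    ∀ᶠ x in 𝓝 x₁, ∀ ρ, 1 < ρ → ‖G ρ x‖ ≤ b ρ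

/-- Jointly smooth families all of whose derivatives are locally dominated. -/
structure GoodFamily (G : ℝ → EuclideanSpace ℝ (Fin n) → ℂ)
    (Ω : Set (EuclideanSpace ℝ (Fin n))) : Prop where
  smooth : SmoothOn (Function.uncurry G) (Ioi 0 ×ˢ Ω)
  dominated : ∀ l : List (Fin n), Dominated (fun ρ => wordD l (G ρ)) Ω

variable {Ω : Set (EuclideanSpace ℝ (Fin n))} {G H : ℝ → EuclideanSpace ℝ (Fin n) → ℂ}

theorem Dominated.congr (hΩ : IsOpen Ω) (hG : Dominated G Ω)
    (h : ∀ ρ, 1 < ρ → EqOn (G ρ) (H ρ) Ω) : Dominated H Ω := by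
  intro x hx
  obtain ⟨b, hb, hbd⟩ := hG x hx
  refine ⟨b, hb, ?_⟩
  filter_upwards [hbd, hΩ.mem_nhds hx] with y hy hyΩ ρ hρ
  rw [← h ρ hρ hyΩ]
  exact hy ρ hρ

theorem Dominated.add (hG : Dominated G Ω) (hH : Dominated H Ω) :
    Dominated (fun ρ x => G ρ x + H ρ x) Ω := by
  intro x hx
  obtain ⟨b, hb, hbd⟩ := hG x hx
  obtain ⟨c, hc, hcd⟩ := hH x hx
  refine ⟨fun ρ => b ρ + c ρ, hb.add hc, ?_⟩
  filter_upwards [hbd, hcd] with y hy hy' ρ hρ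
  exact (norm_add_le _ _).trans (add_le_add (hy ρ hρ) (hy' ρ hρ))

theorem Dominated.mul (hG : Dominated G Ω) {a : EuclideanSpace ℝ (Fin n) → ℂ}
    (ha : ∀ x ∈ Ω, ContinuousAt a x) : Dominated (fun ρ x => a x * G ρ x) Ω := by
  intro x hx
  obtain ⟨b, hb, hbd⟩ := hG x hx
  refine ⟨fun ρ => (‖a x‖ + 1) * b ρ, hb.const_mul _, ?_⟩
  have h1 : ∀ᶠ y in 𝓝 x, ‖a y‖ < ‖a x‖ + 1 :=
    (ha x hx).norm.eventually (gt_mem_nhds (by linarith))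
  filter_upwards [hbd, h1] with y hy hy' ρ hρ
  rw [norm_mul]
  exact mul_le_mul hy'.le (hy ρ hρ) (norm_nonneg _) (by positivity)

/-! ### Slices of jointly smooth families and stability of good families. -/

theorem smoothOn_slice (hG : SmoothOn (Function.uncurry G) (Ioi 0 ×ˢ Ω)) {ρ : ℝ} (hρ : 0 < ρ) :
    SmoothOn (G ρ) Ω :=
  ContDiffOn.comp (g := Function.uncurry G) (f := fun x => (ρ, x)) hG
    (contDiff_const.prodMk contDiff_id).contDiffOn fun _ hx => ⟨hρ, hx⟩

theorem fderiv_slice (hΩ : IsOpen Ω) (hG : SmoothOn (Function.uncurry G) (Ioi 0 ×ˢ Ω)) {ρ : ℝ}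
    (hρ : 0 < ρ) {x : EuclideanSpace ℝ (Fin n)} (hx : x ∈ Ω) :
    fderiv ℝ (G ρ) x = (fderiv ℝ (Function.uncurry G) (ρ, x)).comp
      (ContinuousLinearMap.inr ℝ ℝ (EuclideanSpace ℝ (Fin n))) := by
  have h1 : HasFDerivAt (Function.uncurry G) (fderiv ℝ (Function.uncurry G) (ρ, x)) (ρ, x) :=
    (hG.differentiableAt (isOpen_Ioi.prod hΩ)
      (show (ρ, x) ∈ Ioi (0 : ℝ) ×ˢ Ω from ⟨hρ, hx⟩)).hasFDerivAt
  exact (HasFDerivAt.comp (f := fun y => (ρ, y)) x h1 (hasFDerivAt_prodMk_right ρ x)).fderiv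

theorem continuousOn_fderiv_slice (hΩ : IsOpen Ω)
    (hG : SmoothOn (Function.uncurry G) (Ioi 0 ×ˢ Ω)) {x : EuclideanSpace ℝ (Fin n)} (hx : x ∈ Ω) :
    ContinuousOn (fun ρ => fderiv ℝ (G ρ) x) (Ioi 0) := by
  have h1 : ContinuousOn (fderiv ℝ (Function.uncurry G)) (Ioi 0 ×ˢ Ω) :=
    hG.continuousOn_fderiv_of_isOpen (isOpen_Ioi.prod hΩ) (by simp)
  have h2 : ContinuousOn (fun ρ : ℝ => fderiv ℝ (Function.uncurry G) (ρ, x)) (Ioi 0) :=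
    h1.comp (by fun_prop) fun ρ hρ => ⟨hρ, hx⟩
  exact (h2.clm_comp continuousOn_const).congr fun ρ hρ => fderiv_slice hΩ hG hρ hx

theorem smoothOn_uncurry_partialD (hΩ : IsOpen Ω)
    (hG : SmoothOn (Function.uncurry G) (Ioi 0 ×ˢ Ω)) (i : Fin n) :
    SmoothOn (Function.uncurry fun ρ => partialD i (G ρ)) (Ioi 0 ×ˢ Ω) := by
  have h1 : ContDiffOn ℝ ((⊤ : ℕ∞) : WithTop ℕ∞) (fderiv ℝ (Function.uncurry G)) (Ioi 0 ×ˢ Ω) :=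
    hG.fderiv_of_isOpen (isOpen_Ioi.prod hΩ) (by simp)
  refine (h1.clm_apply (contDiffOn_const
    (c := ((0 : ℝ), EuclideanSpace.single i (1 : ℝ))))).congr fun z hz => ?_
  obtain ⟨ρ, x⟩ := z
  simp only [Function.uncurry, partialD]
  rw [fderiv_slice hΩ hG hz.1 hz.2]
  rfl

theorem GoodFamily.slice (hG : GoodFamily G Ω) {ρ : ℝ} (hρ : 1 < ρ) : SmoothOn (G ρ) Ω :=
  smoothOn_slice hG.smooth (by linarith)

theorem GoodFamily.partialD (hΩ : IsOpen Ω) (hG : GoodFamily G Ω) (i : Fin n) :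
    GoodFamily (fun ρ => partialD i (G ρ)) Ω where
  smooth := smoothOn_uncurry_partialD hΩ hG.smooth i
  dominated l := by
    have := hG.dominated (l ++ [i])
    simpa only [wordD_append_singleton] using this

theorem GoodFamily.wordD (hΩ : IsOpen Ω) (hG : GoodFamily G Ω) (l : List (Fin n)) :
    GoodFamily (fun ρ => wordD l (G ρ)) Ω := by
  induction l with
  | nil => exact hG
  | cons i l ih => exact ih.partialD hΩ i

theorem GoodFamily.add (hΩ : IsOpen Ω) (hG : GoodFamily G Ω) (hH : GoodFamily H Ω) :
    GoodFamily (fun ρ x => G ρ x + H ρ x) Ω where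
  smooth := ContDiffOn.add hG.smooth hH.smooth
  dominated l := ((hG.dominated l).add (hH.dominated l)).congr hΩ fun _ hρ =>
    (wordD_add hΩ (hG.slice hρ) (hH.slice hρ) l).symm

theorem dominated_wordD_mul (hΩ : IsOpen Ω) (l : List (Fin n)) (hG : GoodFamily G Ω)
    {a : EuclideanSpace ℝ (Fin n) → ℂ} (ha : SmoothOn a Ω) :
    Dominated (fun ρ => Ultradiff.wordD l fun x => a x * G ρ x) Ω := by
  -- The innermost derivative is peeled off first, so that the Leibniz rule again produces a smooth
  -- function times a good family; hence `a` and `G` vary in the induction.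
  induction l using List.reverseRecOn generalizing a G with
  | nil => exact (hG.dominated []).mul fun x hx => (ha.contDiffAt hΩ hx).continuousAt
  | append_singleton l i ih =>
    simp only [wordD_append_singleton]
    refine ((ih (hG.partialD hΩ i) ha).add (ih hG (ha.partialD hΩ i))).congr hΩ fun ρ hρ => ?_
    have hs := hG.slice hρ
    refine EqOn.trans ?_ (wordD_congr hΩ (partialD_mul hΩ ha hs i) l).symm
    exact (wordD_add hΩ (ha.mul (hs.partialD hΩ i)) ((ha.partialD hΩ i).mul hs) l).symm

theorem GoodFamily.mul (hΩ : IsOpen Ω) (hG : GoodFamily G Ω)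
    {a : EuclideanSpace ℝ (Fin n) → ℂ} (ha : SmoothOn a Ω) :
    GoodFamily (fun ρ x => a x * G ρ x) Ω where
  smooth := ContDiffOn.mul (ContDiffOn.comp (g := a) (f := Prod.snd) ha
    contDiff_snd.contDiffOn fun _ hz => hz.2) hG.smooth
  dominated l := dominated_wordD_mul hΩ l hG ha

theorem wordD_zero (l : List (Fin n)) :
    Ultradiff.wordD l (fun _ => (0 : ℂ)) = fun _ => 0 := by
  induction l with
  | nil => rfl
  | cons i l ih =>
    rw [wordD_cons, ih]
    funext x
    simp [Ultradiff.partialD]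

theorem goodFamily_zero : GoodFamily (fun _ _ => (0 : ℂ)) Ω where
  smooth := contDiffOn_const
  dominated l := fun x _ => ⟨fun _ => 0, integrableOn_zero,
    Eventually.of_forall fun y ρ _ => by simp [wordD_zero]⟩

theorem GoodFamily.sum (hΩ : IsOpen Ω) {ι : Type*} (s : Finset ι)
    {G : ι → ℝ → EuclideanSpace ℝ (Fin n) → ℂ} (hG : ∀ i ∈ s, GoodFamily (G i) Ω) :
    GoodFamily (fun ρ x => ∑ i ∈ s, G i ρ x) Ω := by
  classical
  induction s using Finset.induction_on with
  | empty => simpa using goodFamily_zero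
  | insert i s hi ih =>
    simp only [Finset.sum_insert hi]
    exact (hG i (Finset.mem_insert_self i s)).add hΩ
      (ih fun j hj => hG j (Finset.mem_insert_of_mem hj))

theorem GoodFamily.continuousOn (hG : GoodFamily G Ω) {x : EuclideanSpace ℝ (Fin n)} (hx : x ∈ Ω) :
    ContinuousOn (fun ρ => G ρ x) (Ioi 0) :=
  ContinuousOn.comp (g := Function.uncurry G) (f := fun ρ => (ρ, x)) hG.smooth.continuousOn
    (by fun_prop) fun _ hρ => ⟨hρ, hx⟩

theorem GoodFamily.aestronglyMeasurable (hG : GoodFamily G Ω) {x : EuclideanSpace ℝ (Fin n)}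
    (hx : x ∈ Ω) : AEStronglyMeasurable (fun ρ => G ρ x) (volume.restrict (Ioi 1)) :=
  ((hG.continuousOn hx).mono (Ioi_subset_Ioi zero_le_one)).aestronglyMeasurable measurableSet_Ioi

theorem GoodFamily.integrableOn (hG : GoodFamily G Ω) {x : EuclideanSpace ℝ (Fin n)}
    (hx : x ∈ Ω) : IntegrableOn (fun ρ => G ρ x) (Ioi 1) := by
  obtain ⟨b, hb, hbd⟩ := hG.dominated [] x hx
  refine Integrable.mono' hb (hG.aestronglyMeasurable hx) ?_
  refine (ae_restrict_iff' measurableSet_Ioi).2 (Eventually.of_forall fun ρ hρ => ?_)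
  exact hbd.self_of_nhds ρ hρ

/-! ### Differentiation under the integral sign. -/

theorem fderiv_apply_eq_sum (f : EuclideanSpace ℝ (Fin n) → ℂ) (x v : EuclideanSpace ℝ (Fin n)) :
    fderiv ℝ f x v = ∑ i, (v i : ℂ) * Ultradiff.partialD i f x := by
  have hv : v = ∑ i, (v i) • EuclideanSpace.single i (1 : ℝ) := by
    ext i
    simp [Finset.sum_apply, Pi.single_apply]
  conv_lhs => rw [hv, map_sum]
  exact Finset.sum_congr rfl fun i _ => by
    rw [map_smul]
    simp [Ultradiff.partialD]

theorem norm_fderiv_le_sum (f : EuclideanSpace ℝ (Fin n) → ℂ) (x : EuclideanSpace ℝ (Fin n)) :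
    ‖fderiv ℝ f x‖ ≤ ∑ i, ‖Ultradiff.partialD i f x‖ := by
  refine ContinuousLinearMap.opNorm_le_bound _ (by positivity) fun v => ?_
  rw [fderiv_apply_eq_sum, Finset.sum_mul]
  refine (norm_sum_le _ _).trans (Finset.sum_le_sum fun i _ => ?_)
  rw [norm_mul, mul_comm, Complex.norm_real]
  exact mul_le_mul_of_nonneg_left (PiLp.norm_apply_le v i) (norm_nonneg _)

theorem GoodFamily.hasFDerivAt_integral (hΩ : IsOpen Ω) (hG : GoodFamily G Ω)
    {x : EuclideanSpace ℝ (Fin n)} (hx : x ∈ Ω) :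
    IntegrableOn (fun ρ => fderiv ℝ (G ρ) x) (Ioi 1) ∧
    HasFDerivAt (fun y => ∫ ρ in Ioi (1 : ℝ), G ρ y) (∫ ρ in Ioi (1 : ℝ), fderiv ℝ (G ρ) x) x := by
  choose b hb hbd using fun i => hG.dominated [i] x hx
  have hev : ∀ᶠ y in 𝓝 x, y ∈ Ω ∧ ∀ i, ∀ ρ, 1 < ρ → ‖Ultradiff.partialD i (G ρ) y‖ ≤ b i ρ :=
    (hΩ.eventually_mem hx).and (eventually_all.2 hbd)
  have hbsum : Integrable (fun ρ => ∑ i, b i ρ) (volume.restrict (Ioi 1)) :=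
    integrable_finsetSum _ fun i _ => hb i
  have hmeas : AEStronglyMeasurable (fun ρ => fderiv ℝ (G ρ) x) (volume.restrict (Ioi 1)) :=
    ((continuousOn_fderiv_slice hΩ hG.smooth hx).mono
      (Ioi_subset_Ioi zero_le_one)).aestronglyMeasurable measurableSet_Ioi
  have hle : ∀ y, (y ∈ Ω ∧ ∀ i, ∀ ρ, 1 < ρ → ‖Ultradiff.partialD i (G ρ) y‖ ≤ b i ρ) →
      ∀ ρ, 1 < ρ → ‖fderiv ℝ (G ρ) y‖ ≤ ∑ i, b i ρ := fun y hy ρ hρ =>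
    (norm_fderiv_le_sum _ _).trans (Finset.sum_le_sum fun i _ => hy.2 i ρ hρ)
  refine ⟨Integrable.mono' hbsum hmeas ((ae_restrict_iff' measurableSet_Ioi).2
    (Eventually.of_forall fun ρ hρ => hle x hev.self_of_nhds ρ hρ)), ?_⟩
  refine hasFDerivAt_integral_of_dominated_of_fderiv_le (F := fun y ρ => G ρ y)
    (F' := fun y ρ => fderiv ℝ (G ρ) y) (bound := fun ρ => ∑ i, b i ρ) hev ?_
    (hG.integrableOn hx) hmeas ?_ hbsum ?_
  · filter_upwards [hΩ.mem_nhds hx] with y hy using hG.aestronglyMeasurable hy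
  · exact (ae_restrict_iff' measurableSet_Ioi).2 (Eventually.of_forall fun ρ hρ y hy =>
      hle y hy ρ hρ)
  · exact (ae_restrict_iff' measurableSet_Ioi).2 (Eventually.of_forall fun ρ hρ y hy =>
      ((hG.slice hρ).differentiableAt hΩ hy.1).hasFDerivAt)

theorem GoodFamily.partialD_integral (hΩ : IsOpen Ω) (hG : GoodFamily G Ω) (i : Fin n) :
    EqOn (Ultradiff.partialD i fun y => ∫ ρ in Ioi (1 : ℝ), G ρ y)
      (fun y => ∫ ρ in Ioi (1 : ℝ), Ultradiff.partialD i (G ρ) y) Ω := by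
  intro x hx
  obtain ⟨h1, h2⟩ := hG.hasFDerivAt_integral hΩ hx
  simp only [Ultradiff.partialD]
  rw [h2.fderiv, ContinuousLinearMap.integral_apply h1]

theorem GoodFamily.wordD_integral (hΩ : IsOpen Ω) (hG : GoodFamily G Ω) (l : List (Fin n)) :
    EqOn (Ultradiff.wordD l fun y => ∫ ρ in Ioi (1 : ℝ), G ρ y)
      (fun y => ∫ ρ in Ioi (1 : ℝ), Ultradiff.wordD l (G ρ) y) Ω := by
  induction l with
  | nil => exact fun _ _ => rfl
  | cons i l ih =>
    exact (partialD_congr hΩ ih i).trans ((hG.wordD hΩ l).partialD_integral hΩ i)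

/-- The derivative of the integral is assembled from the integrals of the families `∂_i G`, which
are good again; the induction on the order runs over all good families at once. -/
theorem GoodFamily.smoothOn_integral (hΩ : IsOpen Ω) (hG : GoodFamily G Ω) :
    SmoothOn (fun y => ∫ ρ in Ioi (1 : ℝ), G ρ y) Ω := by
  refine contDiffOn_infty.2 fun p => ?_
  induction p generalizing G with
  | zero =>
    exact contDiffOn_zero.2 fun x hx =>
      (hG.hasFDerivAt_integral hΩ hx).2.continuousAt.continuousWithinAt
  | succ p ih =>
    rw [Nat.cast_add, Nat.cast_one, contDiffOn_succ_iff_fderiv_of_isOpen hΩ]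
    refine ⟨fun x hx => (hG.hasFDerivAt_integral hΩ hx).2.differentiableAt.differentiableWithinAt,
      by simp, ?_⟩
    have h1 : ContDiffOn ℝ p (fun x => ∑ i : Fin n,
        (EuclideanSpace.proj i : EuclideanSpace ℝ (Fin n) →L[ℝ] ℝ).smulRight
          (∫ ρ in Ioi (1 : ℝ), Ultradiff.partialD i (G ρ) x)) Ω :=
      ContDiffOn.sum fun i _ => contDiffOn_const.smulRight (ih (hG.partialD hΩ i))
    refine h1.congr fun x hx => ?_
    ext v
    rw [fderiv_apply_eq_sum]
    simp only [sum_apply, ContinuousLinearMap.smulRight_apply]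
    exact Finset.sum_congr rfl fun i _ => by
      rw [hG.partialD_integral hΩ i hx]
      simp

/-! ### Differential operators and parameter integrals -/

theorem diffOp_congr {f g : EuclideanSpace ℝ (Fin n) → ℂ} (hΩ : IsOpen Ω) (h : EqOn f g Ω) (m : ℕ)
    (a : (Fin n → ℕ) → EuclideanSpace ℝ (Fin n) → ℂ) : EqOn (diffOp m a f) (diffOp m a g) Ω := by
  intro x hx
  simp only [diffOp, multiD_eq_wordD]
  refine Finset.sum_congr rfl fun k _ => Finset.sum_congr rfl fun α _ => ?_
  rw [wordD_congr hΩ h _ hx]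

theorem iterate_diffOp_congr {f g : EuclideanSpace ℝ (Fin n) → ℂ} (hΩ : IsOpen Ω) (h : EqOn f g Ω)
    (m : ℕ) (a : (Fin n → ℕ) → EuclideanSpace ℝ (Fin n) → ℂ) (q : ℕ) :
    EqOn ((diffOp m a)^[q] f) ((diffOp m a)^[q] g) Ω := by
  induction q with
  | zero => exact h
  | succ q ih =>
    simp only [Function.iterate_succ_apply']
    exact diffOp_congr hΩ ih m a

theorem smoothOn_coeff {m : ℕ} {a : (Fin n → ℕ) → EuclideanSpace ℝ (Fin n) → ℂ}
    (ha : ∀ α : Fin n → ℕ, ∑ i, α i ≤ m → SmoothOn (a α) Ω) {k : ℕ}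
    (hk : k ∈ Finset.range (m + 1)) {α : Fin n → ℕ}
    (hα : α ∈ Finset.piAntidiag Finset.univ k) : SmoothOn (a α) Ω :=
  ha α (by
    rw [(Finset.mem_piAntidiag.1 hα).1]
    exact Nat.lt_succ_iff.1 (Finset.mem_range.1 hk))

theorem GoodFamily.diffOp (hΩ : IsOpen Ω) (hG : GoodFamily G Ω) {m : ℕ}
    {a : (Fin n → ℕ) → EuclideanSpace ℝ (Fin n) → ℂ}
    (ha : ∀ α : Fin n → ℕ, ∑ i, α i ≤ m → SmoothOn (a α) Ω) :
    GoodFamily (fun ρ => diffOp m a (G ρ)) Ω := by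
  refine GoodFamily.sum hΩ _ fun k hk => GoodFamily.sum hΩ _ fun α hα => ?_
  have h1 := ((hG.wordD hΩ (multiWord α)).mul hΩ
    (contDiffOn_const (c := (-Complex.I) ^ k))).mul hΩ (smoothOn_coeff ha hk hα)
  simpa only [multiD_eq_wordD] using h1

theorem GoodFamily.diffOp_integral (hΩ : IsOpen Ω) (hG : GoodFamily G Ω) (m : ℕ)
    (a : (Fin n → ℕ) → EuclideanSpace ℝ (Fin n) → ℂ) :
    EqOn (Ultradiff.diffOp m a fun y => ∫ ρ in Ioi (1 : ℝ), G ρ y)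
      (fun y => ∫ ρ in Ioi (1 : ℝ), Ultradiff.diffOp m a (G ρ) y) Ω := by
  intro x hx
  simp only [Ultradiff.diffOp, multiD_eq_wordD]
  have hI : ∀ k ∈ Finset.range (m + 1), ∀ α ∈ Finset.piAntidiag Finset.univ k,
      Integrable (fun ρ => a α x * ((-Complex.I) ^ k * Ultradiff.wordD (multiWord α) (G ρ) x))
        (volume.restrict (Ioi 1)) := fun k _ α _ =>
    (((hG.wordD hΩ (multiWord α)).integrableOn hx).const_mul _).const_mul _
  rw [integral_finsetSum _ fun k hk => integrable_finsetSum _ fun α hα => hI k hk α hα]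
  refine Finset.sum_congr rfl fun k hk => ?_
  rw [integral_finsetSum _ fun α hα => hI k hk α hα]
  refine Finset.sum_congr rfl fun α _ => ?_
  rw [hG.wordD_integral hΩ _ hx, integral_const_mul, integral_const_mul]

theorem GoodFamily.iterate_diffOp (hΩ : IsOpen Ω) (hG : GoodFamily G Ω) {m : ℕ}
    {a : (Fin n → ℕ) → EuclideanSpace ℝ (Fin n) → ℂ}
    (ha : ∀ α : Fin n → ℕ, ∑ i, α i ≤ m → SmoothOn (a α) Ω) (q : ℕ) :
    GoodFamily (fun ρ => (Ultradiff.diffOp m a)^[q] (G ρ)) Ω := by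
  induction q with
  | zero => exact hG
  | succ q ih =>
    simp only [Function.iterate_succ_apply']
    exact ih.diffOp hΩ ha

theorem GoodFamily.iterate_diffOp_integral (hΩ : IsOpen Ω) (hG : GoodFamily G Ω) {m : ℕ}
    {a : (Fin n → ℕ) → EuclideanSpace ℝ (Fin n) → ℂ}
    (ha : ∀ α : Fin n → ℕ, ∑ i, α i ≤ m → SmoothOn (a α) Ω) (q : ℕ) :
    EqOn ((Ultradiff.diffOp m a)^[q] fun y => ∫ ρ in Ioi (1 : ℝ), G ρ y)
      (fun y => ∫ ρ in Ioi (1 : ℝ), (Ultradiff.diffOp m a)^[q] (G ρ) y) Ω := by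
  induction q with
  | zero => exact fun _ _ => rfl
  | succ q ih =>
    simp only [Function.iterate_succ_apply']
    exact (diffOp_congr hΩ ih m a).trans ((hG.iterate_diffOp hΩ ha q).diffOp_integral hΩ m a)

theorem directionalD_eq_sum (ξ : EuclideanSpace ℝ (Fin n)) (f : EuclideanSpace ℝ (Fin n) → ℂ)
    (x : EuclideanSpace ℝ (Fin n)) :
    directionalD ξ f x = ∑ i, (-Complex.I * (ξ i : ℂ)) * Ultradiff.partialD i f x := by
  rw [directionalD, fderiv_apply_eq_sum, Finset.mul_sum]
  simp only [mul_assoc]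

theorem directionalD_congr {f g : EuclideanSpace ℝ (Fin n) → ℂ} (hΩ : IsOpen Ω) (h : EqOn f g Ω)
    (ξ : EuclideanSpace ℝ (Fin n)) : EqOn (directionalD ξ f) (directionalD ξ g) Ω := by
  intro x hx
  simp only [directionalD_eq_sum]
  exact Finset.sum_congr rfl fun i _ => by rw [partialD_congr hΩ h i hx]

theorem GoodFamily.directionalD (hΩ : IsOpen Ω) (hG : GoodFamily G Ω)
    (ξ : EuclideanSpace ℝ (Fin n)) : GoodFamily (fun ρ => directionalD ξ (G ρ)) Ω := by
  have : (fun ρ => Ultradiff.directionalD ξ (G ρ)) =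
      fun ρ x => ∑ i, (-Complex.I * (ξ i : ℂ)) * Ultradiff.partialD i (G ρ) x := by
    funext ρ x
    exact directionalD_eq_sum ξ (G ρ) x
  rw [this]
  exact GoodFamily.sum hΩ _ fun i _ => (hG.partialD hΩ i).mul hΩ contDiffOn_const

theorem GoodFamily.directionalD_integral (hΩ : IsOpen Ω) (hG : GoodFamily G Ω)
    (ξ : EuclideanSpace ℝ (Fin n)) :
    EqOn (Ultradiff.directionalD ξ fun y => ∫ ρ in Ioi (1 : ℝ), G ρ y)
      (fun y => ∫ ρ in Ioi (1 : ℝ), Ultradiff.directionalD ξ (G ρ) y) Ω := by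
  intro x hx
  simp only [directionalD_eq_sum]
  rw [integral_finsetSum _ fun i _ => ((hG.partialD hΩ i).integrableOn hx).const_mul _]
  exact Finset.sum_congr rfl fun i _ => by
    rw [hG.partialD_integral hΩ i hx, integral_const_mul]

theorem GoodFamily.iterate_directionalD_integral (hΩ : IsOpen Ω) (hG : GoodFamily G Ω)
    (ξ : EuclideanSpace ℝ (Fin n)) (j : ℕ) :
    GoodFamily (fun ρ => (Ultradiff.directionalD ξ)^[j] (G ρ)) Ω ∧
    EqOn ((Ultradiff.directionalD ξ)^[j] fun y => ∫ ρ in Ioi (1 : ℝ), G ρ y)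
      (fun y => ∫ ρ in Ioi (1 : ℝ), (Ultradiff.directionalD ξ)^[j] (G ρ) y) Ω := by
  induction j with
  | zero => exact ⟨hG, fun _ _ => rfl⟩
  | succ j ih =>
    simp only [Function.iterate_succ_apply']
    exact ⟨ih.1.directionalD hΩ ξ,
      (directionalD_congr hΩ ih.2 ξ).trans (ih.1.directionalD_integral hΩ ξ)⟩

end Ultradiff

namespace Ultradiff

/-! ### Majorants for iterated derivatives -/

/-- A doubly indexed majorant: differentiation shifts the indices at the cost of a factor `Λ`, and
multiplication by functions whose `i`-th derivatives are at most `C * r ^ i * i!` costs a factor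
`2 * C`. -/
structure IsMajorant (Φ : ℕ → ℕ → ℝ) (Λ r : ℝ) : Prop where
  nonneg : ∀ k J, 0 ≤ Φ k J
  mono : ∀ k, Monotone (Φ k)
  shift : ∀ k J, Φ (k + 1) J ≤ Λ * Φ k (J + 1)
  leibniz : ∀ k J, ∑ i ∈ Finset.range (k + 1), k.choose i * (r ^ i * i.factorial) * Φ (k - i) J ≤
    2 * Φ k J

/-- The majorant `(B μ) ^ k * ∑_{j ≤ J} (h B) ^ j * ((k + j)!) ^ σ`. -/
noncomputable def gevreyMajorant (σ B μ h : ℝ) (k J : ℕ) : ℝ :=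
  (B * μ) ^ k * ∑ j ∈ Finset.range (J + 1), (h * B) ^ j * ((k + j).factorial : ℝ) ^ σ

/-- As `x ≤ x ^ σ` for `x ≥ 1`, the binomial coefficient and `i!` move inside the power, where
enlarging `k` to `k + j` in the binomial completes the product to `(k + j)!`. -/
theorem choose_mul_factorial_rpow_le {σ : ℝ} (hσ : 1 ≤ σ) {k i : ℕ} (hi : i ≤ k) (j : ℕ) :
    (k.choose i : ℝ) * i.factorial * ((k - i + j).factorial : ℝ) ^ σ ≤
      ((k + j).factorial : ℝ) ^ σ := by
  have h1 : (1 : ℝ) ≤ k.choose i * i.factorial := by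
    exact_mod_cast Nat.mul_pos (Nat.choose_pos hi) (Nat.factorial_pos i)
  refine (mul_le_mul_of_nonneg_right (Real.self_le_rpow_of_one_le h1 hσ) (by positivity)).trans ?_
  rw [← Real.mul_rpow (by positivity) (by positivity)]
  refine Real.rpow_le_rpow (by positivity) ?_ (by linarith)
  have h2 : k.choose i ≤ (k + j).choose i := Nat.choose_le_choose i (Nat.le_add_right k j)
  have h3 := Nat.choose_mul_factorial_mul_factorial (show i ≤ k + j by omega)
  have h4 : k - i + j = k + j - i := by omega
  rw [h4]
  exact_mod_cast (Nat.mul_le_mul_right _ (Nat.mul_le_mul_right _ h2)).trans h3.le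

theorem isMajorant_gevreyMajorant {σ B μ h R : ℝ} (hσ : 1 ≤ σ) (hR : 0 ≤ R) (hB : 0 < B)
    (hRB : 2 * R ≤ B) (hμ : 0 ≤ μ) (hh : 0 < h) :
    IsMajorant (gevreyMajorant σ B μ h) (μ / h) (R * μ) where
  nonneg k J := by unfold gevreyMajorant; positivity
  mono k := by
    intro J J' hJ
    refine mul_le_mul_of_nonneg_left ?_ (by positivity)
    exact Finset.sum_le_sum_of_subset_of_nonneg (Finset.range_mono (by omega))
      fun _ _ _ => by positivity
  -- The shift `j → j + 1` trades a factor `B μ` for `h B`; the term `j = 0` on the right is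
  -- discarded.
  shift k J := by
    unfold gevreyMajorant
    rw [Finset.sum_range_succ' _ (J + 1), mul_add, mul_add]
    have h0 : 0 ≤ μ / h * ((B * μ) ^ k * ((h * B) ^ 0 * ((k + 0).factorial : ℝ) ^ σ)) := by
      positivity
    refine le_trans (le_of_eq ?_) (le_add_of_nonneg_right h0)
    rw [Finset.mul_sum, Finset.mul_sum, Finset.mul_sum]
    refine Finset.sum_congr rfl fun j _ => ?_
    rw [show k + 1 + j = k + (j + 1) by ring, pow_succ, pow_succ (h * B)]
    field_simp
  leibniz k J := by
    have hterm : ∀ i ∈ Finset.range (k + 1),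
        k.choose i * ((R * μ) ^ i * i.factorial) * gevreyMajorant σ B μ h (k - i) J ≤
          (1 / 2) ^ i * gevreyMajorant σ B μ h k J := by
      intro i hi
      have hi : i ≤ k := Nat.lt_succ_iff.1 (Finset.mem_range.1 hi)
      -- The condition `2 R ≤ B` yields a factor `2 ^ (-i)`, whose sum is the constant `2` of
      -- `leibniz`.
      have h1 : (R * μ) ^ i * (B * μ) ^ (k - i) ≤ (1 / 2) ^ i * (B * μ) ^ k := by
        have e : (1 / 2 : ℝ) ^ i * (B * μ) ^ k = (1 / 2 * (B * μ)) ^ i * (B * μ) ^ (k - i) := by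
          rw [mul_pow (1 / 2 : ℝ), mul_assoc, ← pow_add, Nat.add_sub_cancel' hi]
        rw [e]
        refine mul_le_mul_of_nonneg_right (pow_le_pow_left₀ (by positivity) ?_ i) (by positivity)
        nlinarith
      have h2 : ∑ j ∈ Finset.range (J + 1), (h * B) ^ j *
          ((k.choose i : ℝ) * i.factorial * ((k - i + j).factorial : ℝ) ^ σ) ≤
          ∑ j ∈ Finset.range (J + 1), (h * B) ^ j * ((k + j).factorial : ℝ) ^ σ :=
        Finset.sum_le_sum fun j _ => mul_le_mul_of_nonneg_left
          (choose_mul_factorial_rpow_le hσ hi j) (by positivity)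
      have e : k.choose i * ((R * μ) ^ i * i.factorial) * gevreyMajorant σ B μ h (k - i) J =
          ((R * μ) ^ i * (B * μ) ^ (k - i)) * ∑ j ∈ Finset.range (J + 1), (h * B) ^ j *
          ((k.choose i : ℝ) * i.factorial * ((k - i + j).factorial : ℝ) ^ σ) := by
        unfold gevreyMajorant
        rw [Finset.mul_sum, Finset.mul_sum, Finset.mul_sum]
        exact Finset.sum_congr rfl fun j _ => by ring
      rw [e, gevreyMajorant, ← mul_assoc]
      exact mul_le_mul h1 h2 (by positivity) (by positivity)
    refine (Finset.sum_le_sum hterm).trans ?_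
    rw [← Finset.sum_mul]
    refine mul_le_mul_of_nonneg_right (sum_geometric_two_le _) ?_
    unfold gevreyMajorant
    positivity

variable {n : ℕ}

/-- All derivatives of `w` at `x` are bounded by `M * Φ · J`. -/
def MajorizedAt (Φ : ℕ → ℕ → ℝ) (M : ℝ) (J : ℕ) (w : EuclideanSpace ℝ (Fin n) → ℂ)
    (x : EuclideanSpace ℝ (Fin n)) : Prop :=
  ContDiffAt ℝ ((⊤ : ℕ∞) : WithTop ℕ∞) w x ∧ ∀ k, ‖iteratedFDeriv ℝ k w x‖ ≤ M * Φ k J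

namespace MajorizedAt

variable {Φ : ℕ → ℕ → ℝ} {Λ r M M' : ℝ} {J J' : ℕ} {w w' : EuclideanSpace ℝ (Fin n) → ℂ}
  {x : EuclideanSpace ℝ (Fin n)}

theorem mono (hΦ : IsMajorant Φ Λ r) (hw : MajorizedAt Φ M J w x) (hM0 : 0 ≤ M) (hM : M ≤ M')
    (hJ : J ≤ J') : MajorizedAt Φ M' J' w x :=
  ⟨hw.1, fun k => (hw.2 k).trans
    (mul_le_mul hM (hΦ.mono k hJ) (hΦ.nonneg k J) (hM0.trans hM))⟩

theorem partialD (hΦ : IsMajorant Φ Λ r) (hM : 0 ≤ M) (hw : MajorizedAt Φ M J w x) (i : Fin n) :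
    MajorizedAt Φ (M * Λ) (J + 1) (partialD i w) x := by
  refine ⟨ContDiffAt.partialD hw.1 i, fun k => ?_⟩
  refine (norm_iteratedFDeriv_partialD_le hw.1 i k).trans ((hw.2 (k + 1)).trans ?_)
  rw [mul_assoc]
  exact mul_le_mul_of_nonneg_left (hΦ.shift k J) hM

theorem add (hw : MajorizedAt Φ M J w x) (hw' : MajorizedAt Φ M' J w' x) :
    MajorizedAt Φ (M + M') J (fun y => w y + w' y) x := by
  refine ⟨hw.1.add hw'.1, fun k => ?_⟩
  have hk : (k : WithTop ℕ∞) ≤ ((⊤ : ℕ∞) : WithTop ℕ∞) := by norm_cast; exact le_top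
  rw [fun_iteratedFDeriv_add_apply (hw.1.of_le hk) (hw'.1.of_le hk), add_mul]
  exact (norm_add_le _ _).trans (add_le_add (hw.2 k) (hw'.2 k))

theorem const_mul (hw : MajorizedAt Φ M J w x) (c : ℂ) :
    MajorizedAt Φ (‖c‖ * M) J (fun y => c * w y) x := by
  refine ⟨contDiffAt_const.mul hw.1, fun k => ?_⟩
  have hk : (k : WithTop ℕ∞) ≤ ((⊤ : ℕ∞) : WithTop ℕ∞) := by norm_cast; exact le_top
  have := iteratedFDeriv_const_smul_apply (a := c) (hw.1.of_le hk)
  change ‖iteratedFDeriv ℝ k (c • w) x‖ ≤ _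
  rw [this, norm_smul, mul_assoc]
  exact mul_le_mul_of_nonneg_left (hw.2 k) (norm_nonneg c)

theorem zero (hΦ : IsMajorant Φ Λ r) (hM : 0 ≤ M) : MajorizedAt Φ M J (fun _ => (0 : ℂ)) x := by
  refine ⟨contDiffAt_const, fun k => ?_⟩
  have : iteratedFDeriv ℝ k (fun _ : EuclideanSpace ℝ (Fin n) => (0 : ℂ)) = 0 :=
    iteratedFDeriv_fun_zero
  rw [this]
  simpa using mul_nonneg hM (hΦ.nonneg k J)

theorem sum (hΦ : IsMajorant Φ Λ r) {ι : Type*} (s : Finset ι) {M : ι → ℝ}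
    {w : ι → EuclideanSpace ℝ (Fin n) → ℂ} (h : ∀ i ∈ s, MajorizedAt Φ (M i) J (w i) x) :
    MajorizedAt Φ (∑ i ∈ s, M i) J (fun y => ∑ i ∈ s, w i y) x := by
  classical
  induction s using Finset.induction_on with
  | empty => simpa using zero hΦ le_rfl
  | insert i s hi ih =>
    simp only [Finset.sum_insert hi]
    exact (h i (Finset.mem_insert_self i s)).add (ih fun j hj => h j (Finset.mem_insert_of_mem hj))

theorem norm_iteratedFDeriv_mul_le_at {f g : EuclideanSpace ℝ (Fin n) → ℂ}
    (hf : ContDiffAt ℝ ((⊤ : ℕ∞) : WithTop ℕ∞) f x)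
    (hg : ContDiffAt ℝ ((⊤ : ℕ∞) : WithTop ℕ∞) g x) (k : ℕ) :
    ‖iteratedFDeriv ℝ k (fun y => f y * g y) x‖ ≤ ∑ i ∈ Finset.range (k + 1),
      (k.choose i : ℝ) * ‖iteratedFDeriv ℝ i f x‖ * ‖iteratedFDeriv ℝ (k - i) g x‖ := by
  have hk : (k : WithTop ℕ∞) ≤ ((⊤ : ℕ∞) : WithTop ℕ∞) := by norm_cast; exact le_top
  obtain ⟨U, hU, hfU⟩ := (hf.of_le hk).contDiffOn le_rfl (by simp)
  obtain ⟨V, hV, hgV⟩ := (hg.of_le hk).contDiffOn le_rfl (by simp)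
  obtain ⟨W, hW, hWo, hxW⟩ := mem_nhds_iff.1 (inter_mem hU hV)
  have := norm_iteratedFDerivWithin_mul_le (hfU.mono (hW.trans inter_subset_left))
    (hgV.mono (hW.trans inter_subset_right)) hWo.uniqueDiffOn hxW le_rfl
  simpa only [iteratedFDerivWithin_of_isOpen _ hWo hxW] using this

theorem mul (hΦ : IsMajorant Φ Λ r) (hM : 0 ≤ M) (hw : MajorizedAt Φ M J w x)
    {a : EuclideanSpace ℝ (Fin n) → ℂ} (ha : ContDiffAt ℝ ((⊤ : ℕ∞) : WithTop ℕ∞) a x) {C : ℝ}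
    (hC : 0 ≤ C) (hb : ∀ i : ℕ, ‖iteratedFDeriv ℝ i a x‖ ≤ C * (r ^ i * i.factorial)) :
    MajorizedAt Φ (2 * C * M) J (fun y => a y * w y) x := by
  refine ⟨ha.mul hw.1, fun k => ?_⟩
  refine (norm_iteratedFDeriv_mul_le_at ha hw.1 k).trans ?_
  calc ∑ i ∈ Finset.range (k + 1),
        (k.choose i : ℝ) * ‖iteratedFDeriv ℝ i a x‖ * ‖iteratedFDeriv ℝ (k - i) w x‖
      ≤ ∑ i ∈ Finset.range (k + 1),
        (k.choose i : ℝ) * (C * (r ^ i * i.factorial)) * (M * Φ (k - i) J) := by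
        refine Finset.sum_le_sum fun i _ => ?_
        have h1 := (norm_nonneg _).trans (hb i)
        have := hb i
        have := hw.2 (k - i)
        gcongr
    _ = C * M * ∑ i ∈ Finset.range (k + 1),
        k.choose i * (r ^ i * i.factorial) * Φ (k - i) J := by
        rw [Finset.mul_sum]
        exact Finset.sum_congr rfl fun i _ => by ring
    _ ≤ C * M * (2 * Φ k J) := mul_le_mul_of_nonneg_left (hΦ.leibniz k J) (by positivity)
    _ = 2 * C * M * Φ k J := by ring

end MajorizedAt

/-! ### Conjugation by an exponential -/

/-- `D_i + ρ ξ_i`, the conjugate of `D_i` by `exp (i ρ ⟨x, ξ⟩)`. -/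
noncomputable def shiftedD (ρ : ℝ) (ξ : EuclideanSpace ℝ (Fin n)) (i : Fin n)
    (w : EuclideanSpace ℝ (Fin n) → ℂ) : EuclideanSpace ℝ (Fin n) → ℂ :=
  fun x => -Complex.I * partialD i w x + ((ρ * ξ i : ℝ) : ℂ) * w x

/-- The product of the operators `D_i + ρ ξ_i` along a word. -/
noncomputable def shiftedWord (ρ : ℝ) (ξ : EuclideanSpace ℝ (Fin n)) (l : List (Fin n))
    (w : EuclideanSpace ℝ (Fin n) → ℂ) : EuclideanSpace ℝ (Fin n) → ℂ :=
  l.foldr (shiftedD ρ ξ) w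

/-- The conjugate of `diffOp m a` by `exp (i ρ ⟨x, ξ⟩)`. -/
noncomputable def shiftedOp (ρ : ℝ) (ξ : EuclideanSpace ℝ (Fin n)) (m : ℕ)
    (a : (Fin n → ℕ) → EuclideanSpace ℝ (Fin n) → ℂ)
    (w : EuclideanSpace ℝ (Fin n) → ℂ) : EuclideanSpace ℝ (Fin n) → ℂ :=
  fun x => ∑ k ∈ Finset.range (m + 1), ∑ α ∈ Finset.piAntidiag Finset.univ k,
    a α x * shiftedWord ρ ξ (multiWord α) w x

/-- The oscillating factor `exp (i ρ ⟨x - x₀, ξ⟩)`. -/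
noncomputable def wave (x₀ ξ : EuclideanSpace ℝ (Fin n)) (ρ : ℝ) (x : EuclideanSpace ℝ (Fin n)) :
    ℂ :=
  Complex.exp (Complex.I * (ρ * inner ℝ (x - x₀) ξ : ℝ))

theorem norm_wave (x₀ ξ : EuclideanSpace ℝ (Fin n)) (ρ : ℝ) (x : EuclideanSpace ℝ (Fin n)) :
    ‖wave x₀ ξ ρ x‖ = 1 := by
  rw [wave, mul_comm, Complex.norm_exp_ofReal_mul_I]

theorem hasFDerivAt_wave (x₀ ξ : EuclideanSpace ℝ (Fin n)) (ρ : ℝ)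
    (x : EuclideanSpace ℝ (Fin n)) :
    HasFDerivAt (wave x₀ ξ ρ) ((innerSL ℝ ξ).smulRight
      (Complex.I * ρ * wave x₀ ξ ρ x)) x := by
  have h1 : HasFDerivAt (fun y => inner ℝ (y - x₀) ξ) (innerSL ℝ ξ) x := by
    have h := (innerSL ℝ ξ).hasFDerivAt (x := x - x₀)
    have h2 := h.comp x ((hasFDerivAt_id x).sub_const x₀)
    refine (h2.congr_of_eventuallyEq (Eventually.of_forall fun y => ?_))
    simp [real_inner_comm]
  have h2 := ((Complex.ofRealCLM.hasFDerivAt.comp x (h1.const_mul ρ)).const_mul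
    Complex.I).cexp
  refine h2.congr_fderiv ?_
  ext v
  simp [wave]
  ring

theorem contDiff_wave (x₀ ξ : EuclideanSpace ℝ (Fin n)) (ρ : ℝ) :
    ContDiff ℝ ((⊤ : ℕ∞) : WithTop ℕ∞) (wave x₀ ξ ρ) := by
  unfold wave
  refine ContDiff.cexp (contDiff_const.mul (Complex.ofRealCLM.contDiff.comp ?_))
  exact contDiff_const.mul ((contDiff_id.sub contDiff_const).inner ℝ contDiff_const)

theorem partialD_wave (x₀ ξ : EuclideanSpace ℝ (Fin n)) (ρ : ℝ) (i : Fin n)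
    (x : EuclideanSpace ℝ (Fin n)) :
    partialD i (wave x₀ ξ ρ) x = Complex.I * ((ρ * ξ i : ℝ) : ℂ) * wave x₀ ξ ρ x := by
  rw [partialD, (hasFDerivAt_wave x₀ ξ ρ x).fderiv]
  simp [EuclideanSpace.inner_single_right]
  ring

section Conjugation

variable {Ω : Set (EuclideanSpace ℝ (Fin n))} {w : EuclideanSpace ℝ (Fin n) → ℂ} {ρ : ℝ}
  {ξ : EuclideanSpace ℝ (Fin n)}

theorem SmoothOn.shiftedD (hΩ : IsOpen Ω) (hw : SmoothOn w Ω) (ρ : ℝ)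
    (ξ : EuclideanSpace ℝ (Fin n)) (i : Fin n) : SmoothOn (shiftedD ρ ξ i w) Ω :=
  SmoothOn.add (SmoothOn.mul contDiffOn_const (hw.partialD hΩ i))
    (SmoothOn.mul contDiffOn_const hw)

theorem SmoothOn.shiftedWord (hΩ : IsOpen Ω) (hw : SmoothOn w Ω) (ρ : ℝ)
    (ξ : EuclideanSpace ℝ (Fin n)) (l : List (Fin n)) : SmoothOn (shiftedWord ρ ξ l w) Ω := by
  induction l with
  | nil => exact hw
  | cons i l ih => exact ih.shiftedD hΩ ρ ξ i

theorem SmoothOn.shiftedOp (hΩ : IsOpen Ω) (hw : SmoothOn w Ω) (ρ : ℝ)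
    (ξ : EuclideanSpace ℝ (Fin n)) {m : ℕ} {a : (Fin n → ℕ) → EuclideanSpace ℝ (Fin n) → ℂ}
    (ha : ∀ α : Fin n → ℕ, ∑ i, α i ≤ m → SmoothOn (a α) Ω) :
    SmoothOn (shiftedOp ρ ξ m a w) Ω :=
  ContDiffOn.sum fun _ hk => ContDiffOn.sum fun α hα =>
    (smoothOn_coeff ha hk hα).mul (hw.shiftedWord hΩ ρ ξ (multiWord α))

theorem partialD_mul_wave (hΩ : IsOpen Ω) (hw : SmoothOn w Ω) (x₀ ξ : EuclideanSpace ℝ (Fin n))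
    (ρ : ℝ) (i : Fin n) :
    EqOn (partialD i fun x => w x * wave x₀ ξ ρ x)
      (fun x => Complex.I * (shiftedD ρ ξ i w x * wave x₀ ξ ρ x)) Ω := by
  intro x hx
  rw [partialD_mul hΩ hw (contDiff_wave x₀ ξ ρ).contDiffOn i hx]
  simp only [partialD_wave, Ultradiff.shiftedD]
  linear_combination ((partialD i w x) * wave x₀ ξ ρ x) * Complex.I_sq

theorem partialD_const_mul (hΩ : IsOpen Ω) (hw : SmoothOn w Ω) (c : ℂ) (i : Fin n) :
    EqOn (partialD i fun x => c * w x) (fun x => c * partialD i w x) Ω := by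
  intro x hx
  simp only [partialD]
  rw [fderiv_const_mul (hw.differentiableAt hΩ hx)]
  simp

theorem wordD_mul_wave (hΩ : IsOpen Ω) (hw : SmoothOn w Ω) (x₀ ξ : EuclideanSpace ℝ (Fin n))
    (ρ : ℝ) (l : List (Fin n)) :
    EqOn (wordD l fun x => w x * wave x₀ ξ ρ x)
      (fun x => Complex.I ^ l.length * (shiftedWord ρ ξ l w x * wave x₀ ξ ρ x)) Ω := by
  induction l with
  | nil => intro x _; simp [shiftedWord]
  | cons i l ih =>
    have hs := hw.shiftedWord hΩ ρ ξ l
    refine (partialD_congr hΩ ih i).trans fun x hx => ?_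
    rw [partialD_const_mul hΩ (hs.mul (contDiff_wave x₀ ξ ρ).contDiffOn) _ i hx]
    simp only []
    rw [partialD_mul_wave hΩ hs x₀ ξ ρ i hx, List.length_cons, pow_succ]
    simp only [shiftedWord, List.foldr_cons]
    ring

theorem diffOp_mul_wave (hΩ : IsOpen Ω) (hw : SmoothOn w Ω) (x₀ ξ : EuclideanSpace ℝ (Fin n))
    (ρ : ℝ) (m : ℕ) (a : (Fin n → ℕ) → EuclideanSpace ℝ (Fin n) → ℂ) :
    EqOn (diffOp m a fun x => w x * wave x₀ ξ ρ x)
      (fun x => shiftedOp ρ ξ m a w x * wave x₀ ξ ρ x) Ω := by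
  intro x hx
  simp only [diffOp, shiftedOp, multiD_eq_wordD, Finset.sum_mul]
  refine Finset.sum_congr rfl fun k _ => Finset.sum_congr rfl fun α hα => ?_
  have hlen : (multiWord α).length = k := by
    rw [length_multiWord, (Finset.mem_piAntidiag.1 hα).1]
  rw [wordD_mul_wave hΩ hw x₀ ξ ρ _ hx, hlen]
  have h1 : (-Complex.I) ^ k * Complex.I ^ k = 1 := by
    rw [← mul_pow]
    simp
  linear_combination (a α x * (shiftedWord ρ ξ (multiWord α) w x * wave x₀ ξ ρ x)) * h1

theorem iterate_diffOp_mul_wave (hΩ : IsOpen Ω) (hw : SmoothOn w Ω)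
    (x₀ ξ : EuclideanSpace ℝ (Fin n)) (ρ : ℝ) {m : ℕ}
    {a : (Fin n → ℕ) → EuclideanSpace ℝ (Fin n) → ℂ}
    (ha : ∀ α : Fin n → ℕ, ∑ i, α i ≤ m → SmoothOn (a α) Ω) (q : ℕ) :
    SmoothOn ((shiftedOp ρ ξ m a)^[q] w) Ω ∧
    EqOn ((diffOp m a)^[q] fun x => w x * wave x₀ ξ ρ x)
      (fun x => (shiftedOp ρ ξ m a)^[q] w x * wave x₀ ξ ρ x) Ω := by
  induction q with
  | zero => exact ⟨hw, fun _ _ => rfl⟩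
  | succ q ih =>
    simp only [Function.iterate_succ_apply']
    exact ⟨ih.1.shiftedOp hΩ ρ ξ ha,
      (diffOp_congr hΩ ih.2 m a).trans (diffOp_mul_wave hΩ ih.1 x₀ ξ ρ m a)⟩

end Conjugation

end Ultradiff

namespace Ultradiff

/-! ### Majorants for conjugated operators -/

variable {n : ℕ}

theorem prod_map_multiWord (α : Fin n → ℕ) (g : Fin n → ℂ) :
    ((multiWord α).map g).prod = ∏ i, g i ^ α i := by
  rw [multiWord, List.map_flatMap, List.flatMap_def, List.prod_flatten,
    Fin.prod_univ_def]
  simp [Function.comp_def]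

theorem MajorizedAt.congr {Φ : ℕ → ℕ → ℝ} {M : ℝ} {J : ℕ} {w w' : EuclideanSpace ℝ (Fin n) → ℂ}
    {x : EuclideanSpace ℝ (Fin n)} {Ω : Set (EuclideanSpace ℝ (Fin n))} (hΩ : IsOpen Ω)
    (hx : x ∈ Ω) (hw : MajorizedAt Φ M J w x) (h : EqOn w' w Ω) : MajorizedAt Φ M J w' x := by
  have he : w' =ᶠ[𝓝 x] w := h.eventuallyEq_of_mem (hΩ.mem_nhds hx)
  refine ⟨hw.1.congr_of_eventuallyEq he, fun k => ?_⟩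
  rw [(he.iteratedFDeriv ℝ k).eq_of_nhds]
  exact hw.2 k

section

variable {Φ : ℕ → ℕ → ℝ} {Λ r M ρ : ℝ} {J : ℕ} {w : EuclideanSpace ℝ (Fin n) → ℂ}
  {x ξ : EuclideanSpace ℝ (Fin n)} {Ω : Set (EuclideanSpace ℝ (Fin n))}

/-- The derivative costs `Λ ≤ ρ` and the multiplication costs `ρ |ξ_i| ≤ ρ`. This crude count
suffices for lower order terms and for plain derivatives of the packets. -/
theorem majorizedAt_shiftedD (hΦ : IsMajorant Φ Λ r) (hM : 0 ≤ M) (hΛ : 0 ≤ Λ) (hΛρ : Λ ≤ ρ)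
    (hξ : ‖ξ‖ = 1) (hw : MajorizedAt Φ M J w x) (i : Fin n) :
    MajorizedAt Φ (2 * ρ * M) (J + 1) (shiftedD ρ ξ i w) x := by
  have hρ : 0 ≤ ρ := hΛ.trans hΛρ
  have hξi : ‖ξ i‖ ≤ 1 := hξ ▸ PiLp.norm_apply_le ξ i
  have h1 := (hw.partialD hΦ hM i).const_mul (-Complex.I)
  have h2 := (hw.mono hΦ hM le_rfl (Nat.le_succ J)).const_mul ((ρ * ξ i : ℝ) : ℂ)
  refine (h1.add h2).mono hΦ (by positivity) ?_ le_rfl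
  rw [norm_neg, Complex.norm_I, one_mul, Complex.norm_real, norm_mul, Real.norm_of_nonneg hρ]
  have h3 : ρ * ‖ξ i‖ ≤ ρ := mul_le_of_le_one_right hρ hξi
  nlinarith

theorem majorizedAt_shiftedWord (hΦ : IsMajorant Φ Λ r) (hM : 0 ≤ M) (hΛ : 0 ≤ Λ) (hΛρ : Λ ≤ ρ)
    (hξ : ‖ξ‖ = 1) (hw : MajorizedAt Φ M J w x) (l : List (Fin n)) :
    MajorizedAt Φ ((2 * ρ) ^ l.length * M) (J + l.length) (shiftedWord ρ ξ l w) x := by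
  have hρ : 0 ≤ ρ := hΛ.trans hΛρ
  induction l with
  | nil => simpa [shiftedWord] using hw
  | cons i l ih =>
    have := majorizedAt_shiftedD hΦ (by positivity) hΛ hΛρ hξ ih i
    rw [← mul_assoc, ← pow_succ', add_assoc] at this
    exact this

/-- Subtracting the symbol leaves terms with at least one derivative on `w`, and that derivative
costs `Λ = ρ θ` instead of `ρ`. A new letter multiplies the old error by `2 ρ` and adds one term, so
a factor `3 ρ` per letter is enough. -/
theorem majorizedAt_shiftedWord_sub {θ : ℝ} (hΦ : IsMajorant Φ Λ r) (hM : 0 ≤ M) (hΛ : 0 ≤ Λ)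
    (hΛρ : Λ ≤ ρ) (hθ : 0 ≤ θ) (hΛθ : Λ = ρ * θ) (hξ : ‖ξ‖ = 1) (hΩ : IsOpen Ω) (hx : x ∈ Ω)
    (hws : SmoothOn w Ω) (hw : MajorizedAt Φ M J w x) (l : List (Fin n)) :
    MajorizedAt Φ (3 ^ l.length * ρ ^ l.length * θ * M) (J + l.length)
      (fun y => shiftedWord ρ ξ l w y - (l.map fun i => ((ρ * ξ i : ℝ) : ℂ)).prod * w y) x := by
  have hρ : 0 ≤ ρ := hΛ.trans hΛρ
  induction l with
  | nil =>
    have := MajorizedAt.zero (J := J) (x := x) hΦ (M := θ * M) (by positivity)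
    simpa [shiftedWord] using this
  | cons i l ih =>
    set c := (l.map fun i => ((ρ * ξ i : ℝ) : ℂ)).prod with hc
    have hcn : ‖c‖ ≤ ρ ^ l.length := by
      have : ∀ l : List (Fin n), ‖(l.map fun i => ((ρ * ξ i : ℝ) : ℂ)).prod‖ ≤ ρ ^ l.length := by
        intro l
        induction l with
        | nil => simp
        | cons i l ih =>
          rw [List.map_cons, List.prod_cons, norm_mul, List.length_cons, pow_succ']
          refine mul_le_mul ?_ ih (norm_nonneg _) hρ
          have hξi : ‖ξ i‖ ≤ 1 := hξ ▸ PiLp.norm_apply_le ξ i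
          rw [Complex.norm_real, norm_mul, Real.norm_of_nonneg hρ]
          exact mul_le_of_le_one_right hρ hξi
      exact this l
    have h1 := majorizedAt_shiftedD hΦ (by positivity) hΛ hΛρ hξ ih i
    have h2 := ((hw.partialD hΦ hM i).const_mul (-Complex.I * c)).mono hΦ (by positivity) le_rfl
      (show J + 1 ≤ J + l.length + 1 by omega)
    have h3 := (h1.add h2).congr (w' := fun y => shiftedWord ρ ξ (i :: l) w y -
      ((i :: l).map fun i => ((ρ * ξ i : ℝ) : ℂ)).prod * w y) hΩ hx ?_
    · refine h3.mono hΦ (by positivity) ?_ (by simp [add_assoc])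
      rw [norm_mul, norm_neg, Complex.norm_I, one_mul, List.length_cons, hΛθ]
      have h4 : ‖c‖ * (M * (ρ * θ)) ≤ ρ ^ l.length * (M * (ρ * θ)) :=
        mul_le_mul_of_nonneg_right hcn (by positivity)
      have h5 : ρ ^ l.length * (M * (ρ * θ)) ≤ 3 ^ l.length * (ρ ^ l.length * (M * (ρ * θ))) :=
        le_mul_of_one_le_left (by positivity) (one_le_pow₀ (by norm_num))
      have e : (3 : ℝ) ^ (l.length + 1) * ρ ^ (l.length + 1) * θ * M =
          2 * ρ * (3 ^ l.length * ρ ^ l.length * θ * M) +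
            3 ^ l.length * (ρ ^ l.length * (M * (ρ * θ))) := by ring
      rw [e]
      linarith
    · intro y hy
      have hW := (hws.shiftedWord hΩ ρ ξ l).differentiableAt hΩ hy
      have hwd := hws.differentiableAt hΩ hy
      have hd : partialD i (fun y => shiftedWord ρ ξ l w y - c * w y) y =
          partialD i (shiftedWord ρ ξ l w) y - c * partialD i w y := by
        simp only [partialD]
        rw [fderiv_fun_sub hW (hwd.const_mul c), fderiv_const_mul hwd]
        simp
      simp only [shiftedWord, List.foldr_cons, List.map_cons, List.prod_cons, ← hc]
      rw [shiftedD, shiftedD]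
      simp only [shiftedWord] at hd
      rw [hd]
      ring

/-- The sum of `3 ^ |α|` over all multi-indices with `|α| ≤ m`. -/
noncomputable def multiIndexConst (n m : ℕ) : ℝ :=
  ∑ k ∈ Finset.range (m + 1), ∑ _α ∈ Finset.piAntidiag (Finset.univ : Finset (Fin n)) k, (3 : ℝ) ^ k

theorem multiIndexConst_nonneg (n m : ℕ) : 0 ≤ multiIndexConst n m := by
  unfold multiIndexConst
  positivity

/-- Separates the three sources of the gain `θ`: lower order, a derivative on `w`, and smallness of
the principal symbol. -/
theorem shiftedOp_eq (ρ : ℝ) (ξ : EuclideanSpace ℝ (Fin n)) (m : ℕ)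
    (a : (Fin n → ℕ) → EuclideanSpace ℝ (Fin n) → ℂ) (w : EuclideanSpace ℝ (Fin n) → ℂ) :
    shiftedOp ρ ξ m a w = fun y =>
      ((∑ k ∈ Finset.range m, ∑ α ∈ Finset.piAntidiag Finset.univ k,
        a α y * shiftedWord ρ ξ (multiWord α) w y) +
      ∑ α ∈ Finset.piAntidiag Finset.univ m, a α y * (shiftedWord ρ ξ (multiWord α) w y -
        ((multiWord α).map fun i => ((ρ * ξ i : ℝ) : ℂ)).prod * w y)) +
      (ρ : ℂ) ^ m * (principalSymbol m a y ξ * w y) := by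
  funext y
  rw [shiftedOp, Finset.sum_range_succ, add_assoc]
  congr 1
  rw [principalSymbol, Finset.sum_mul, Finset.mul_sum, ← Finset.sum_add_distrib]
  refine Finset.sum_congr rfl fun α hα => ?_
  have h1 : ((multiWord α).map fun i => ((ρ * ξ i : ℝ) : ℂ)).prod =
      (ρ : ℂ) ^ m * ∏ i, ((ξ i : ℝ) : ℂ) ^ α i := by
    rw [prod_map_multiWord, ← (Finset.mem_piAntidiag.1 hα).1, ← Finset.prod_pow_eq_pow_sum,
      ← Finset.prod_mul_distrib]
    exact Finset.prod_congr rfl fun i _ => by rw [Complex.ofReal_mul, mul_pow]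
  rw [h1]
  ring

/-- Each part is of size `ρ ^ m * θ`. For order `k < m` this is `ρ ^ k ≤ ρ ^ (m - 1) * Λ`, by `Λ ≥
1`; in top order it comes from subtracting the symbol and from `hp`. -/
theorem majorizedAt_shiftedOp {θ C : ℝ} (hΦ : IsMajorant Φ Λ r) (hM : 0 ≤ M) (hΛ : 1 ≤ Λ)
    (hΛρ : Λ ≤ ρ) (hθ : 0 ≤ θ) (hΛθ : Λ = ρ * θ) (hξ : ‖ξ‖ = 1) (hΩ : IsOpen Ω) (hx : x ∈ Ω)
    {m : ℕ} {a : (Fin n → ℕ) → EuclideanSpace ℝ (Fin n) → ℂ}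
    (ha : ∀ α : Fin n → ℕ, ∑ i, α i ≤ m → SmoothOn (a α) Ω) (hC : 0 ≤ C)
    (hab : ∀ α : Fin n → ℕ, ∑ i, α i ≤ m → ∀ i : ℕ,
      ‖iteratedFDeriv ℝ i (a α) x‖ ≤ C * (r ^ i * i.factorial))
    (hp : ∀ i : ℕ, ‖iteratedFDeriv ℝ i (fun y => principalSymbol m a y ξ) x‖ ≤
      C * θ * (r ^ i * i.factorial))
    (hws : SmoothOn w Ω) (hw : MajorizedAt Φ M J w x) :
    MajorizedAt Φ (2 * C * (multiIndexConst n m + 1) * (ρ ^ m * θ) * M) (J + m)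
      (shiftedOp ρ ξ m a w) x := by
  have hΛ0 : 0 ≤ Λ := by linarith
  have hρ1 : 1 ≤ ρ := hΛ.trans hΛρ
  have hρ : 0 ≤ ρ := by linarith
  have hsum : ∀ {k : ℕ} {α : Fin n → ℕ}, α ∈ Finset.piAntidiag Finset.univ k → ∑ i, α i = k :=
    fun hα => (Finset.mem_piAntidiag.1 hα).1
  have h1 : MajorizedAt Φ (∑ k ∈ Finset.range m,
      ∑ α ∈ Finset.piAntidiag (Finset.univ : Finset (Fin n)) k, 3 ^ k * (2 * C * (ρ ^ m * θ) * M))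
      (J + m) (fun y => ∑ k ∈ Finset.range m, ∑ α ∈ Finset.piAntidiag Finset.univ k,
        a α y * shiftedWord ρ ξ (multiWord α) w y) x := by
    refine MajorizedAt.sum hΦ _ fun k hk => MajorizedAt.sum hΦ _ fun α hα => ?_
    have hk : k < m := Finset.mem_range.1 hk
    have hαm : ∑ i, α i ≤ m := (hsum hα).le.trans hk.le
    have h := (majorizedAt_shiftedWord hΦ hM hΛ0 hΛρ hξ hw (multiWord α)).mul hΦ (by positivity)
      ((ha α hαm).contDiffAt hΩ hx) hC (hab α hαm)
    rw [length_multiWord, hsum hα] at h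
    refine h.mono hΦ (by positivity) ?_ (by omega)
    have e1 : ρ ^ k ≤ ρ ^ m * θ := by
      calc ρ ^ k ≤ ρ ^ (m - 1) := pow_le_pow_right₀ hρ1 (by omega)
        _ ≤ ρ ^ (m - 1) * Λ := le_mul_of_one_le_right (by positivity) hΛ
        _ = ρ ^ m * θ := by
          rw [hΛθ, ← mul_assoc, ← pow_succ, Nat.sub_add_cancel (by omega)]
    have e2 : (2 : ℝ) ^ k ≤ 3 ^ k := pow_le_pow_left₀ (by norm_num) (by norm_num) k
    calc 2 * C * ((2 * ρ) ^ k * M) = 2 ^ k * (2 * C * ρ ^ k * M) := by rw [mul_pow]; ring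
      _ ≤ 3 ^ k * (2 * C * (ρ ^ m * θ) * M) := by gcongr
  have h2 : MajorizedAt Φ (∑ α ∈ Finset.piAntidiag (Finset.univ : Finset (Fin n)) m,
      3 ^ m * (2 * C * (ρ ^ m * θ) * M)) (J + m)
      (fun y => ∑ α ∈ Finset.piAntidiag Finset.univ m, a α y * (shiftedWord ρ ξ (multiWord α) w y -
        ((multiWord α).map fun i => ((ρ * ξ i : ℝ) : ℂ)).prod * w y)) x := by
    refine MajorizedAt.sum hΦ _ fun α hα => ?_
    have hαm : ∑ i, α i ≤ m := (hsum hα).le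
    have h := (majorizedAt_shiftedWord_sub hΦ hM hΛ0 hΛρ hθ hΛθ hξ hΩ hx hws hw
      (multiWord α)).mul hΦ (by positivity) ((ha α hαm).contDiffAt hΩ hx) hC (hab α hαm)
    rw [length_multiWord, hsum hα] at h
    exact h.mono hΦ (by positivity) (le_of_eq (by ring)) le_rfl
  have hps : SmoothOn (fun y => principalSymbol m a y ξ) Ω :=
    ContDiffOn.sum fun α hα => (ha α (hsum hα).le).mul contDiffOn_const
  have h3 := ((hw.mul hΦ hM (hps.contDiffAt hΩ hx) (by positivity) hp).const_mul
    ((ρ : ℂ) ^ m)).mono hΦ (by positivity) le_rfl (Nat.le_add_right J m)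
  rw [shiftedOp_eq]
  refine ((h1.add h2).add h3).mono hΦ (by positivity) (le_of_eq ?_) le_rfl
  rw [norm_pow, Complex.norm_real, Real.norm_of_nonneg hρ, multiIndexConst, Finset.sum_range_succ]
  simp only [Finset.sum_const, nsmul_eq_mul, ← mul_assoc, ← Finset.sum_mul]
  ring

/-- The prefactor is purely geometric in `q`: all factorials are hidden in the index `J = q m` of
the majorant. -/
theorem majorizedAt_iterate_shiftedOp {θ C : ℝ} (hΦ : IsMajorant Φ Λ r) (hM : 0 ≤ M)
    (hΛ : 1 ≤ Λ) (hΛρ : Λ ≤ ρ) (hθ : 0 ≤ θ) (hΛθ : Λ = ρ * θ) (hξ : ‖ξ‖ = 1) (hΩ : IsOpen Ω)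
    (hx : x ∈ Ω) {m : ℕ} {a : (Fin n → ℕ) → EuclideanSpace ℝ (Fin n) → ℂ}
    (ha : ∀ α : Fin n → ℕ, ∑ i, α i ≤ m → SmoothOn (a α) Ω) (hC : 0 ≤ C)
    (hab : ∀ α : Fin n → ℕ, ∑ i, α i ≤ m → ∀ i : ℕ,
      ‖iteratedFDeriv ℝ i (a α) x‖ ≤ C * (r ^ i * i.factorial))
    (hp : ∀ i : ℕ, ‖iteratedFDeriv ℝ i (fun y => principalSymbol m a y ξ) x‖ ≤
      C * θ * (r ^ i * i.factorial))
    (hws : SmoothOn w Ω) (hw : MajorizedAt Φ M 0 w x) (q : ℕ) :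
    SmoothOn ((shiftedOp ρ ξ m a)^[q] w) Ω ∧
    MajorizedAt Φ ((2 * C * (multiIndexConst n m + 1)) ^ q * (ρ ^ m * θ) ^ q * M) (q * m)
      ((shiftedOp ρ ξ m a)^[q] w) x := by
  have hρ : 0 ≤ ρ := by linarith
  have hκ := multiIndexConst_nonneg n m
  induction q with
  | zero => exact ⟨hws, by simpa using hw⟩
  | succ q ih =>
    simp only [Function.iterate_succ_apply']
    refine ⟨ih.1.shiftedOp hΩ ρ ξ ha, ?_⟩
    have := majorizedAt_shiftedOp hΦ (by positivity) hΛ hΛρ hθ hΛθ hξ hΩ hx ha hC hab hp ih.1 ih.2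
    refine this.mono hΦ (by positivity) (le_of_eq (by ring)) (le_of_eq (by ring))

end

/-! ### Numerical estimates -/

/-- The maximum is at `X = 2 p`, and `log x ≤ x - 1` is applied to `x = X / (2 p)`. -/
theorem rpow_mul_exp_neg_half_le {X p : ℝ} (hX : 0 < X) (hp : 0 ≤ p) :
    X ^ p * Real.exp (-(X / 2)) ≤ (2 * p) ^ p := by
  rcases hp.eq_or_lt with rfl | hp
  · simpa using by positivity
  · have h1 := Real.log_le_sub_one_of_pos (show 0 < X / (2 * p) by positivity)
    rw [Real.log_div hX.ne' (by positivity)] at h1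
    rw [Real.rpow_def_of_pos hX, Real.rpow_def_of_pos (by positivity), ← Real.exp_add]
    refine Real.exp_le_exp.2 ?_
    have h2 := mul_le_mul_of_nonneg_right h1 hp.le
    have e : (X / (2 * p) - 1) * p = X / 2 - p := by field_simp
    rw [e] at h2
    linarith

theorem pow_le_one_add_pow {y : ℝ} (hy : 0 ≤ y) {j N : ℕ} (hj : j ≤ N) : y ^ j ≤ 1 + y ^ N := by
  rcases le_total y 1 with h | h
  · have := pow_le_one₀ hy h (n := j)
    linarith [pow_nonneg hy N]
  · have := pow_le_pow_right₀ h hj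
    linarith

/-- The bound `h ≤ X ^ (-σ)` turns `h ^ j (j!) ^ σ` into at most `(N / X) ^ (σ j)`, and a power with
exponent between `0` and `N` is at most the sum of the two extreme ones. -/
theorem gevreyMajorant_zero_le {σ B h X μ : ℝ} (hσ : 0 ≤ σ) (hB : 1 ≤ B) (hX : 0 < X)
    (hh : 0 ≤ h) (hhX : h ≤ X ^ (-σ)) (N : ℕ) :
    gevreyMajorant σ B μ h 0 N ≤ (N + 1) * (B ^ N * (1 + ((N : ℝ) / X) ^ (σ * N))) := by
  rw [gevreyMajorant, pow_zero, one_mul]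
  refine (Finset.sum_le_card_nsmul _ _ (B ^ N * (1 + ((N : ℝ) / X) ^ (σ * N)))
    fun j hj => ?_).trans (le_of_eq (by simp))
  have hj : j ≤ N := Nat.lt_succ_iff.1 (Finset.mem_range.1 hj)
  have hy : 0 ≤ ((N : ℝ) / X) ^ σ := by positivity
  have h1 : h ^ j * ((0 + j).factorial : ℝ) ^ σ ≤ (((N : ℝ) / X) ^ σ) ^ j := by
    have e1 : ((0 + j).factorial : ℝ) ^ σ ≤ ((N : ℝ) ^ σ) ^ j := by
      rw [zero_add, ← Real.rpow_natCast ((N : ℝ) ^ σ), ← Real.rpow_mul (by positivity),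
        mul_comm σ, Real.rpow_mul (by positivity), Real.rpow_natCast]
      refine Real.rpow_le_rpow (by positivity) ?_ hσ
      exact_mod_cast (Nat.factorial_le_pow j).trans (Nat.pow_le_pow_left hj j)
    have e2 : h ^ j ≤ (X ^ (-σ)) ^ j := pow_le_pow_left₀ hh hhX j
    calc h ^ j * ((0 + j).factorial : ℝ) ^ σ ≤ (X ^ (-σ)) ^ j * ((N : ℝ) ^ σ) ^ j := by gcongr
      _ = (((N : ℝ) / X) ^ σ) ^ j := by
        rw [← mul_pow, Real.div_rpow (by positivity) hX.le, Real.rpow_neg hX.le, mul_comm,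
          div_eq_mul_inv]
  have h2 := h1.trans (pow_le_one_add_pow hy hj)
  rw [← Real.rpow_natCast _ N, ← Real.rpow_mul (by positivity)] at h2
  rw [mul_pow, mul_comm (h ^ j), mul_assoc]
  have h3 : B ^ j ≤ B ^ N := pow_le_pow_right₀ hB hj
  gcongr

/-- Both extremes of the majorant give `N ^ (τ N)` up to geometric factors: one through `X ^ (τ N)
exp (-X / 2)`, the other through `N ^ (σ N) X ^ ((τ - σ) N) exp (-X / 2)`, where `σ ≤ τ` is needed.
The other half of the exponential is kept for the integration over `ρ`. -/
theorem rpow_mul_gevreyMajorant_le {σ τ B h X μ : ℝ} (hσ : 1 ≤ σ) (hτ : σ ≤ τ) (hB : 1 ≤ B)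
    (hX : 0 < X) (hh : 0 ≤ h) (hhX : h ≤ X ^ (-σ)) (N : ℕ) :
    X ^ (τ * N) * gevreyMajorant σ B μ h 0 N * Real.exp (-X) ≤
      2 * ((2 * B * (2 * τ) ^ τ) ^ N * (N : ℝ) ^ (τ * N)) * Real.exp (-(X / 2)) := by
  have hτ0 : 0 ≤ τ := by linarith
  have hσ0 : 0 ≤ σ := by linarith
  have hτσ : 0 ≤ τ - σ := by linarith
  have hN : (0 : ℝ) ≤ N := by positivity
  have hA : X ^ (τ * N) * Real.exp (-(X / 2)) ≤ ((2 * τ) ^ τ) ^ N * (N : ℝ) ^ (τ * N) := by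
    refine (rpow_mul_exp_neg_half_le hX (by positivity)).trans (le_of_eq ?_)
    rw [← mul_assoc, Real.mul_rpow (by positivity) hN, Real.rpow_mul (x := 2 * τ) (by positivity),
      Real.rpow_natCast]
  have hBd : X ^ (τ * N) * ((N : ℝ) / X) ^ (σ * N) * Real.exp (-(X / 2)) ≤
      ((2 * τ) ^ τ) ^ N * (N : ℝ) ^ (τ * N) := by
    have e1 : X ^ (τ * N) * ((N : ℝ) / X) ^ (σ * N) * Real.exp (-(X / 2)) =
        (N : ℝ) ^ (σ * N) * (X ^ ((τ - σ) * N) * Real.exp (-(X / 2))) := by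
      rw [Real.div_rpow hN hX.le, sub_mul, Real.rpow_sub hX]
      ring
    rw [e1]
    have e2 := rpow_mul_exp_neg_half_le hX (show 0 ≤ (τ - σ) * N by positivity)
    have e3 : (2 * ((τ - σ) * N)) ^ ((τ - σ) * N) ≤
        ((2 * τ) ^ τ) ^ N * (N : ℝ) ^ ((τ - σ) * N) := by
      rw [← mul_assoc, Real.mul_rpow (by positivity) hN,
        Real.rpow_mul (x := 2 * (τ - σ)) (by positivity), Real.rpow_natCast]
      refine mul_le_mul_of_nonneg_right (pow_le_pow_left₀ (by positivity) ?_ N) (by positivity)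
      calc (2 * (τ - σ)) ^ (τ - σ) ≤ (2 * τ) ^ (τ - σ) :=
            Real.rpow_le_rpow (by positivity) (by linarith) hτσ
        _ ≤ (2 * τ) ^ τ := Real.rpow_le_rpow_of_exponent_le (by linarith) (by linarith)
    calc (N : ℝ) ^ (σ * N) * (X ^ ((τ - σ) * N) * Real.exp (-(X / 2)))
        ≤ (N : ℝ) ^ (σ * N) * (((2 * τ) ^ τ) ^ N * (N : ℝ) ^ ((τ - σ) * N)) :=
          mul_le_mul_of_nonneg_left (e2.trans e3) (by positivity)
      _ = ((2 * τ) ^ τ) ^ N * ((N : ℝ) ^ (σ * N) * (N : ℝ) ^ ((τ - σ) * N)) := by ring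
      _ = ((2 * τ) ^ τ) ^ N * (N : ℝ) ^ (τ * N) := by
        rw [← Real.rpow_add_of_nonneg hN (by positivity) (by positivity)]
        ring_nf
  have hN2 : (N + 1 : ℝ) ≤ 2 ^ N := by exact_mod_cast Nat.lt_two_pow_self (n := N)
  have hexp : Real.exp (-X) = Real.exp (-(X / 2)) * Real.exp (-(X / 2)) := by
    rw [← Real.exp_add]
    ring_nf
  set D := ((2 * τ) ^ τ) ^ N * (N : ℝ) ^ (τ * N)
  have hD : 0 ≤ D := by positivity
  calc X ^ (τ * N) * gevreyMajorant σ B μ h 0 N * Real.exp (-X)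
      ≤ X ^ (τ * N) * ((N + 1) * (B ^ N * (1 + ((N : ℝ) / X) ^ (σ * N)))) * Real.exp (-X) := by
        have := gevreyMajorant_zero_le (μ := μ) hσ0 hB hX hh hhX N
        gcongr
    _ = (N + 1) * B ^ N * (X ^ (τ * N) * Real.exp (-(X / 2)) +
        X ^ (τ * N) * ((N : ℝ) / X) ^ (σ * N) * Real.exp (-(X / 2))) * Real.exp (-(X / 2)) := by
        rw [hexp]; ring
    _ ≤ 2 ^ N * B ^ N * (D + D) * Real.exp (-(X / 2)) := by gcongr
    _ = _ := by
        rw [mul_pow, mul_pow]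
        ring

end Ultradiff

namespace Ultradiff

/-! ### The oscillating family -/

variable {n : ℕ}

theorem natCast_pow_self_le (k : ℕ) : (k : ℝ) ^ k ≤ Real.exp 1 ^ k * k.factorial := by
  have h := Real.pow_div_factorial_le_exp (k : ℝ) (Nat.cast_nonneg k) k
  rw [div_le_iff₀ (by positivity)] at h
  rwa [← Real.exp_nat_mul, mul_one]

theorem exists_mul_rpow_le_factorial {σ : ℝ} (hσ : 0 < σ) : ∃ D : ℝ, 0 ≤ D ∧ ∀ k : ℕ,
    (σ * k) ^ (σ * k) ≤ D ^ k * (k.factorial : ℝ) ^ σ := by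
  refine ⟨σ ^ σ * Real.exp 1 ^ σ, by positivity, fun k => ?_⟩
  rw [Real.mul_rpow hσ.le (by positivity), Real.rpow_mul hσ.le, Real.rpow_natCast, mul_pow,
    mul_assoc, mul_comm σ, Real.rpow_mul (by positivity), Real.rpow_natCast]
  refine mul_le_mul_of_nonneg_left ?_ (by positivity)
  refine (Real.rpow_le_rpow (by positivity) (natCast_pow_self_le k) hσ.le).trans (le_of_eq ?_)
  rw [Real.mul_rpow (by positivity) (by positivity), ← Real.rpow_natCast,
    ← Real.rpow_natCast (Real.exp 1 ^ σ), ← Real.rpow_mul (by positivity),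
    ← Real.rpow_mul (by positivity), mul_comm σ]

/-- Compact support makes the estimate on `tsupport χ` global; the Beurling condition is used at `l
= 1` alone. -/
theorem globalGevrey_of_mem_beurling {σ : ℝ} (hσ : 0 < σ) {χ : EuclideanSpace ℝ (Fin n) → ℂ}
    (hχ : χ ∈ beurling (gevreyWeight σ) univ) (hc : HasCompactSupport χ) : GlobalGevrey σ χ := by
  obtain ⟨C, hC⟩ := hχ.2 (tsupport χ) hc (subset_univ _) 1 one_pos
  obtain ⟨D, hD0, hD⟩ := exists_mul_rpow_le_factorial hσ
  refine ⟨contDiffOn_univ.1 hχ.1, max C 0, n * D, le_max_right _ _, by positivity, fun k x => ?_⟩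
  by_cases hx : x ∈ tsupport χ
  · have h1 : ‖iteratedFDeriv ℝ k χ x‖ ≤ n ^ k * (max C 0 * (σ * k / 1) ^ (σ * k)) := by
      refine norm_iteratedFDeriv_le_of_multiD hχ.1 isOpen_univ (mem_univ x) (by positivity)
        fun α hα => ?_
      have h2 := hC α x hx
      rw [Real.exp_neg, ← div_eq_mul_inv, div_le_iff₀ (Real.exp_pos _), hα] at h2
      refine h2.trans ?_
      exact mul_le_mul (le_max_left _ _) (exp_youngConj_gevreyWeight_le hσ one_pos k)
        (Real.exp_pos _).le (le_max_right _ _)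
    rw [div_one] at h1
    refine h1.trans ?_
    calc (n : ℝ) ^ k * (max C 0 * (σ * k) ^ (σ * k))
        ≤ (n : ℝ) ^ k * (max C 0 * (D ^ k * (k.factorial : ℝ) ^ σ)) := by
          have := hD k
          gcongr
      _ = _ := by rw [mul_pow]; ring
  · have : iteratedFDeriv ℝ k χ x = 0 := by
      by_contra h
      exact hx (tsupport_iteratedFDeriv_subset k (subset_tsupport _ h))
    rw [this, norm_zero]
    positivity

theorem contDiff_dilate {χ : EuclideanSpace ℝ (Fin n) → ℂ}
    (hχ : ContDiff ℝ ((⊤ : ℕ∞) : WithTop ℕ∞) χ) (μ : ℝ) (x₀ : EuclideanSpace ℝ (Fin n)) :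
    ContDiff ℝ ((⊤ : ℕ∞) : WithTop ℕ∞) fun y => χ (μ • (y - x₀)) :=
  hχ.comp ((contDiff_id.sub contDiff_const).const_smul μ)

theorem norm_iteratedFDeriv_dilate_le {χ : EuclideanSpace ℝ (Fin n) → ℂ}
    (hχ : ContDiff ℝ ((⊤ : ℕ∞) : WithTop ℕ∞) χ) {μ : ℝ} (hμ : 0 ≤ μ)
    (x₀ x : EuclideanSpace ℝ (Fin n)) (k : ℕ) :
    ‖iteratedFDeriv ℝ k (fun y => χ (μ • (y - x₀))) x‖ ≤
      μ ^ k * ‖iteratedFDeriv ℝ k χ (μ • (x - x₀))‖ := by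
  let φ : EuclideanSpace ℝ (Fin n) →L[ℝ] EuclideanSpace ℝ (Fin n) :=
    μ • ContinuousLinearMap.id ℝ _
  have hφ : ‖φ‖ ≤ μ := by
    refine ContinuousLinearMap.opNorm_le_bound _ hμ fun v => ?_
    simp [φ, norm_smul, abs_of_nonneg hμ]
  have hc : ContDiff ℝ ((⊤ : ℕ∞) : WithTop ℕ∞) fun y => χ (-(μ • x₀) + y) :=
    hχ.comp (contDiff_const.add contDiff_id)
  have e := φ.iteratedFDeriv_comp_right hc x (i := k) (by norm_cast; exact le_top)
  rw [iteratedFDeriv_comp_add_left] at e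
  have e1 : (fun y => χ (μ • (y - x₀))) = (fun y => χ (-(μ • x₀) + y)) ∘ φ := by
    funext y
    simp only [Function.comp_apply, φ, smul_apply, ContinuousLinearMap.id_apply, smul_sub]
    congr 1
    abel
  have e2 : -(μ • x₀) + φ x = μ • (x - x₀) := by
    simp only [φ, smul_apply, ContinuousLinearMap.id_apply, smul_sub]
    abel
  rw [e1, e, e2]
  refine (ContinuousMultilinearMap.norm_compContinuousLinearMap_le _ _).trans ?_
  rw [Finset.prod_const, Finset.card_univ, Fintype.card_fin, mul_comm]
  gcongr

/-- At `J = 0` the majorant reduces to `(B μ) ^ k (k!) ^ σ`, the natural bound after dilation by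
`μ`, so `h` is still free. -/
theorem GlobalGevrey.majorizedAt_dilate {σ : ℝ} {χ : EuclideanSpace ℝ (Fin n) → ℂ}
    (hχ : GlobalGevrey σ χ) : ∃ A B₀ : ℝ, 0 ≤ A ∧ 0 ≤ B₀ ∧ ∀ B μ h c : ℝ, B₀ ≤ B → 0 ≤ μ → 0 ≤ c →
      ∀ x₀ x, MajorizedAt (gevreyMajorant σ B μ h) (A * c) 0
        (fun y => χ (μ • (y - x₀)) * (c : ℂ)) x := by
  obtain ⟨hc, A, B₀, hA, hB₀, hb⟩ := hχ
  refine ⟨A, B₀, hA, hB₀, fun B μ h c hB hμ hc0 x₀ x => ?_⟩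
  have h1 : MajorizedAt (gevreyMajorant σ B μ h) A 0 (fun y => χ (μ • (y - x₀))) x := by
    refine ⟨(contDiff_dilate hc μ x₀).contDiffAt,
      fun k => (norm_iteratedFDeriv_dilate_le hc hμ x₀ x k).trans ?_⟩
    calc μ ^ k * ‖iteratedFDeriv ℝ k χ (μ • (x - x₀))‖
        ≤ μ ^ k * (A * B ^ k * (k.factorial : ℝ) ^ σ) := by
          refine mul_le_mul_of_nonneg_left ((hb k _).trans ?_) (by positivity)
          gcongr
      _ = A * gevreyMajorant σ B μ h k 0 := by
          simp [gevreyMajorant, mul_pow]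
          ring
  have h2 := h1.const_mul (c : ℂ)
  rw [Complex.norm_real, Real.norm_of_nonneg hc0, mul_comm c] at h2
  simpa only [mul_comm] using h2

/-- The amplitude `χ (ρ ^ ε (x - x₀)) * exp (-ρ ^ η)`. -/
noncomputable def amplitude (x₀ : EuclideanSpace ℝ (Fin n)) (ε η : ℝ)
    (χ : EuclideanSpace ℝ (Fin n) → ℂ) (ρ : ℝ) (x : EuclideanSpace ℝ (Fin n)) : ℂ :=
  χ (ρ ^ ε • (x - x₀)) * (Real.exp (-(ρ ^ η)) : ℂ)

/-- The integrand of Métivier's function. -/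
noncomputable def metivierFamily (x₀ ξ₀ : EuclideanSpace ℝ (Fin n)) (ε η : ℝ)
    (χ : EuclideanSpace ℝ (Fin n) → ℂ) (ρ : ℝ) (x : EuclideanSpace ℝ (Fin n)) : ℂ :=
  amplitude x₀ ε η χ ρ x * wave x₀ ξ₀ ρ x

theorem metivierFun_eq (x₀ ξ₀ : EuclideanSpace ℝ (Fin n)) (ε η : ℝ)
    (χ : EuclideanSpace ℝ (Fin n) → ℂ) : metivierFun x₀ ξ₀ ε η χ =
      fun x => ∫ ρ in Ioi (1 : ℝ), metivierFamily x₀ ξ₀ ε η χ ρ x := rfl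

theorem smoothOn_metivierFamily {χ : EuclideanSpace ℝ (Fin n) → ℂ}
    (hχ : ContDiff ℝ ((⊤ : ℕ∞) : WithTop ℕ∞) χ) (x₀ ξ₀ : EuclideanSpace ℝ (Fin n)) (ε η : ℝ) :
    SmoothOn (Function.uncurry (metivierFamily x₀ ξ₀ ε η χ)) (Ioi 0 ×ˢ univ) := by
  have hr : ∀ p : ℝ, ContDiffOn ℝ ((⊤ : ℕ∞) : WithTop ℕ∞)
      (fun z : ℝ × EuclideanSpace ℝ (Fin n) => z.1 ^ p) (Ioi 0 ×ˢ univ) := fun p =>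
    contDiff_fst.contDiffOn.rpow_const_of_ne fun z hz => (show (0 : ℝ) < z.1 from hz.1).ne'
  have hx : ContDiffOn ℝ ((⊤ : ℕ∞) : WithTop ℕ∞)
      (fun z : ℝ × EuclideanSpace ℝ (Fin n) => z.2 - x₀) (Ioi 0 ×ˢ univ) :=
    (contDiff_snd.sub contDiff_const).contDiffOn
  refine ContDiffOn.mul (ContDiffOn.mul ?_ ?_) ?_
  · exact hχ.comp_contDiffOn ((hr ε).smul hx)
  · exact Complex.ofRealCLM.contDiff.comp_contDiffOn ((hr η).neg.exp)
  · refine ContDiffOn.cexp (contDiffOn_const.mul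
      (Complex.ofRealCLM.contDiff.comp_contDiffOn ?_))
    exact contDiff_fst.contDiffOn.mul (hx.inner ℝ contDiffOn_const)

/-- The integral of a non-integrable function is `0` by convention, while the Gamma formula gives a
positive value. -/
theorem integrableOn_rpow_mul_exp_neg_mul_rpow_Ioi {η b q : ℝ} (hη : 0 < η) (hb : 0 < b)
    (hq : -1 < q) : IntegrableOn (fun ρ : ℝ => ρ ^ q * Real.exp (-b * ρ ^ η)) (Ioi 0) := by
  by_contra h
  have h1 := integral_rpow_mul_exp_neg_mul_rpow hη hq hb
  rw [integral_undef h] at h1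
  have h2 : 0 < (q + 1) / η := div_pos (by linarith) hη
  have h3 := Real.Gamma_pos_of_pos h2
  have h4 : 0 < b ^ (-(q + 1) / η) * (1 / η) * Real.Gamma ((q + 1) / η) := by positivity
  exact h4.ne h1

theorem integrableOn_exp_neg_half_rpow {η : ℝ} (hη : 0 < η) :
    IntegrableOn (fun ρ : ℝ => Real.exp (-(ρ ^ η / 2))) (Ioi 1) := by
  have h := integrableOn_rpow_mul_exp_neg_mul_rpow_Ioi hη (show (0 : ℝ) < 1 / 2 by norm_num)
    (show (-1 : ℝ) < 0 by norm_num)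
  refine (h.mono_set (Ioi_subset_Ioi zero_le_one)).congr_fun (fun ρ _ => ?_) measurableSet_Ioi
  simp only [Real.rpow_zero, one_mul]
  congr 1
  ring

/-- The choice of `h` meets two demands: `μ / h = ρ θ` with `θ = ρ ^ (-ε)`, and, by `rho_rpow_le`,
`h ≤ (ρ ^ η) ^ (-σ)`. -/
theorem isMajorant_rho {σ B R ρ ε : ℝ} (hσ : 1 ≤ σ) (hR : 0 ≤ R) (hB : 0 < B) (hRB : 2 * R ≤ B)
    (hρ : 1 ≤ ρ) :
    IsMajorant (gevreyMajorant σ B (ρ ^ ε) (ρ ^ (-(1 - 2 * ε)))) (ρ * ρ ^ (-ε)) (R * ρ ^ ε) := by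
  have hρ0 : 0 < ρ := by linarith
  have h := isMajorant_gevreyMajorant (μ := ρ ^ ε) (h := ρ ^ (-(1 - 2 * ε))) hσ hR hB hRB
    (by positivity) (by positivity)
  have e : ρ ^ ε / ρ ^ (-(1 - 2 * ε)) = ρ * ρ ^ (-ε) := by
    rw [← Real.rpow_sub hρ0]
    nth_rewrite 2 [← Real.rpow_one ρ]
    rw [← Real.rpow_add hρ0]
    ring_nf
  rwa [e] at h

theorem one_le_rho_mul {ρ ε : ℝ} (hρ : 1 ≤ ρ) (hε1 : ε ≤ 1) : 1 ≤ ρ * ρ ^ (-ε) := by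
  have hρ0 : 0 < ρ := by linarith
  have e : ρ * ρ ^ (-ε) = ρ ^ (1 - ε) := by
    nth_rewrite 1 [← Real.rpow_one ρ]
    rw [← Real.rpow_add hρ0]
    ring_nf
  rw [e]
  exact Real.one_le_rpow hρ (by linarith)

theorem rho_mul_le {ρ ε : ℝ} (hρ : 1 ≤ ρ) (hε : 0 ≤ ε) : ρ * ρ ^ (-ε) ≤ ρ :=
  mul_le_of_le_one_right (by linarith) (Real.rpow_le_one_of_one_le_of_nonpos hρ (by linarith))

theorem rho_rpow_le {ρ ε η σ : ℝ} (hρ : 1 ≤ ρ) (h : η * σ ≤ 1 - 2 * ε) :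
    ρ ^ (-(1 - 2 * ε)) ≤ (ρ ^ η) ^ (-σ) := by
  rw [← Real.rpow_mul (by linarith)]
  exact Real.rpow_le_rpow_of_exponent_le hρ (by linarith)

/-- Bounds for all partial derivatives of the integrand. -/
theorem exists_norm_wordD_metivierFamily_le {σ ε η : ℝ} (hσ : 1 ≤ σ) (hε : 0 ≤ ε) (hε1 : ε ≤ 1)
    (hη : 0 < η) (hησ : η * σ ≤ 1 - 2 * ε) (hση : σ ≤ 1 / η)
    {χ : EuclideanSpace ℝ (Fin n) → ℂ} (hχ : GlobalGevrey σ χ)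
    (x₀ : EuclideanSpace ℝ (Fin n)) {ξ₀ : EuclideanSpace ℝ (Fin n)} (hξ₀ : ‖ξ₀‖ = 1) :
    ∃ C A : ℝ, 0 ≤ C ∧ 0 ≤ A ∧ ∀ (l : List (Fin n)) (x : EuclideanSpace ℝ (Fin n)) (ρ : ℝ),
      1 < ρ → ‖wordD l (metivierFamily x₀ ξ₀ ε η χ ρ) x‖ ≤
        C * (A ^ l.length * (l.length : ℝ) ^ (1 / η * l.length)) *
          Real.exp (-(ρ ^ η / 2)) := by
  obtain ⟨A, B₀, hA, hB₀, hmaj⟩ := hχ.majorizedAt_dilate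
  set B := max 1 B₀ with hB
  have hB1 : 1 ≤ B := le_max_left _ _
  set D := 2 * B * (2 * (1 / η)) ^ (1 / η) with hD
  refine ⟨2 * A, 2 * D, by positivity, by positivity, fun l x ρ hρ => ?_⟩
  have hρ0 : 0 < ρ := by linarith
  set N := l.length with hN
  set h := ρ ^ (-(1 - 2 * ε)) with hh
  set Φ := gevreyMajorant σ B (ρ ^ ε) h with hΦ
  have hamp : MajorizedAt Φ (A * Real.exp (-(ρ ^ η))) 0 (amplitude x₀ ε η χ ρ) x :=
    hmaj B (ρ ^ ε) h _ (le_max_right _ _) (by positivity) (Real.exp_pos _).le x₀ x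
  -- No coefficients are multiplied here, so `R = 0` is enough.
  have hM := isMajorant_rho (ε := ε) hσ le_rfl (by linarith : 0 < B) (by linarith) hρ.le
  have hw := (majorizedAt_shiftedWord hM (by positivity)
    (zero_le_one.trans (one_le_rho_mul hρ.le hε1)) (rho_mul_le hρ.le hε) hξ₀ hamp l).2 0
  have hs : SmoothOn (amplitude x₀ ε η χ ρ) univ := by
    refine ContDiff.contDiffOn (ContDiff.mul ?_ contDiff_const)
    exact contDiff_dilate hχ.1 _ x₀
  have hword := wordD_mul_wave isOpen_univ hs x₀ ξ₀ ρ l (mem_univ x)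
  change wordD l (metivierFamily x₀ ξ₀ ε η χ ρ) x = _ at hword
  rw [hword, norm_mul, norm_mul, norm_pow, Complex.norm_I, one_pow, one_mul, norm_wave, mul_one]
  rw [norm_iteratedFDeriv_zero, zero_add] at hw
  refine hw.trans ?_
  have hX : 0 < ρ ^ η := by positivity
  have hnum := rpow_mul_gevreyMajorant_le (μ := ρ ^ ε) hσ hση hB1 hX
    (show 0 ≤ h by positivity) (rho_rpow_le hρ.le hησ) N
  -- The order `1 / η` is the one for which `X ^ (N / η)` with `X = ρ ^ η` is the cost `ρ ^ N` of
  -- `N` derivatives.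
  have e1 : (ρ ^ η) ^ (1 / η * N) = ρ ^ N := by
    rw [← Real.rpow_mul hρ0.le, ← mul_assoc, mul_one_div_cancel hη.ne', one_mul,
      Real.rpow_natCast]
  rw [e1, ← hD] at hnum
  calc (2 * ρ) ^ N * (A * Real.exp (-(ρ ^ η))) * Φ 0 N
      = 2 ^ N * A * (ρ ^ N * Φ 0 N * Real.exp (-(ρ ^ η))) := by rw [mul_pow]; ring
    _ ≤ 2 ^ N * A * (2 * (D ^ N * (N : ℝ) ^ (1 / η * N)) * Real.exp (-(ρ ^ η / 2))) :=
        mul_le_mul_of_nonneg_left hnum (by positivity)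
    _ = _ := by rw [mul_pow 2 D]; ring

theorem GoodFamily.mono {G : ℝ → EuclideanSpace ℝ (Fin n) → ℂ}
    {Ω Ω' : Set (EuclideanSpace ℝ (Fin n))} (hG : GoodFamily G Ω) (h : Ω' ⊆ Ω) :
    GoodFamily G Ω' where
  smooth := ContDiffOn.mono hG.smooth (prod_mono_right h)
  dominated l x hx := hG.dominated l x (h hx)

theorem goodFamily_metivierFamily {σ ε η : ℝ} (hσ : 1 ≤ σ) (hε : 0 ≤ ε) (hε1 : ε ≤ 1)
    (hη : 0 < η) (hησ : η * σ ≤ 1 - 2 * ε) (hση : σ ≤ 1 / η)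
    {χ : EuclideanSpace ℝ (Fin n) → ℂ} (hχ : GlobalGevrey σ χ)
    (x₀ : EuclideanSpace ℝ (Fin n)) {ξ₀ : EuclideanSpace ℝ (Fin n)} (hξ₀ : ‖ξ₀‖ = 1) :
    GoodFamily (metivierFamily x₀ ξ₀ ε η χ) univ where
  smooth := smoothOn_metivierFamily hχ.1 x₀ ξ₀ ε η
  dominated l x _ := by
    obtain ⟨C, A, -, -, h⟩ :=
      exists_norm_wordD_metivierFamily_le hσ hε hε1 hη hησ hση hχ x₀ hξ₀
    exact ⟨_, (integrableOn_exp_neg_half_rpow hη).const_mul _,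
      Eventually.of_forall fun y ρ hρ => h l y ρ hρ⟩

theorem norm_integral_le_of_exp_bound {η C : ℝ} (hη : 0 < η) {f : ℝ → ℂ}
    (h : ∀ ρ, 1 < ρ → ‖f ρ‖ ≤ C * Real.exp (-(ρ ^ η / 2))) :
    ‖∫ ρ in Ioi (1 : ℝ), f ρ‖ ≤ C * ∫ ρ in Ioi (1 : ℝ), Real.exp (-(ρ ^ η / 2)) := by
  rw [← integral_const_mul]
  refine norm_integral_le_of_norm_le ((integrableOn_exp_neg_half_rpow hη).const_mul C) ?_
  exact (ae_restrict_iff' measurableSet_Ioi).2 (Eventually.of_forall fun ρ hρ => h ρ hρ)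

theorem metivierFun_mem_roumieu {σ ε η : ℝ} (hσ : 1 ≤ σ) (hε : 0 ≤ ε) (hε1 : ε ≤ 1)
    (hη : 0 < η) (hησ : η * σ ≤ 1 - 2 * ε) (hση : σ ≤ 1 / η)
    {χ : EuclideanSpace ℝ (Fin n) → ℂ} (hχ : GlobalGevrey σ χ)
    (x₀ : EuclideanSpace ℝ (Fin n)) {ξ₀ : EuclideanSpace ℝ (Fin n)} (hξ₀ : ‖ξ₀‖ = 1) :
    metivierFun x₀ ξ₀ ε η χ ∈ roumieu (gevreyWeight (1 / η)) univ := by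
  have hG := goodFamily_metivierFamily hσ hε hε1 hη hησ hση hχ x₀ hξ₀
  rw [metivierFun_eq]
  refine mem_roumieu_gevreyWeight (by positivity) (hG.smoothOn_integral isOpen_univ)
    fun K _ _ => ?_
  obtain ⟨C, A, hC, hA, h⟩ :=
    exists_norm_wordD_metivierFamily_le hσ hε hε1 hη hησ hση hχ x₀ hξ₀
  refine ⟨C * ∫ ρ in Ioi (1 : ℝ), Real.exp (-(ρ ^ η / 2)), A,
    mul_nonneg hC (integral_nonneg fun ρ => (Real.exp_pos _).le), hA, fun α x _ => ?_⟩
  rw [multiD_eq_wordD, hG.wordD_integral isOpen_univ _ (mem_univ x)]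
  refine (norm_integral_le_of_exp_bound hη fun ρ hρ => h (multiWord α) x ρ hρ).trans
    (le_of_eq ?_)
  rw [length_multiWord]
  ring

/-! ### Iterates of the operator -/

theorem iterate_diffOp_zero (m : ℕ) (a : (Fin n → ℕ) → EuclideanSpace ℝ (Fin n) → ℂ) (q : ℕ) :
    (diffOp m a)^[q] (fun _ => 0) = fun _ => 0 := by
  refine Function.iterate_fixed ?_ q
  funext x
  simp [diffOp, multiD_eq_wordD, wordD_zero]

/-- Uniform bounds for the coefficients and for the principal symbol near a point where the latter
vanishes. -/
theorem exists_coeff_bounds {m : ℕ} {Ω : Set (EuclideanSpace ℝ (Fin n))}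
    {a : (Fin n → ℕ) → EuclideanSpace ℝ (Fin n) → ℂ}
    (ha : ∀ α : Fin n → ℕ, ∑ i, α i ≤ m → AnalyticOnNhd ℝ (a α) Ω)
    {x₀ ξ₀ : EuclideanSpace ℝ (Fin n)} (hP : principalSymbol m a x₀ ξ₀ = 0) {d : ℝ} (hd : 0 < d)
    (hball : Metric.closedBall x₀ d ⊆ Ω) :
    ∃ C R : ℝ, 0 ≤ C ∧ 0 ≤ R ∧ ∀ (μ : ℝ), 1 ≤ μ → ∀ x ∈ Metric.closedBall x₀ (d / μ),
      (∀ α : Fin n → ℕ, ∑ i, α i ≤ m → ∀ i : ℕ,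
        ‖iteratedFDeriv ℝ i (a α) x‖ ≤ C * ((R * μ) ^ i * i.factorial)) ∧
      ∀ i : ℕ, ‖iteratedFDeriv ℝ i (fun y => principalSymbol m a y ξ₀) x‖ ≤
        C * μ⁻¹ * ((R * μ) ^ i * i.factorial) := by
  classical
  have hK : IsCompact (Metric.closedBall x₀ d) := isCompact_closedBall x₀ d
  set S := (Finset.range (m + 1)).biUnion
    (fun k => Finset.piAntidiag (Finset.univ : Finset (Fin n)) k)
  have hS : ∀ α : Fin n → ℕ, ∑ i, α i ≤ m ↔ α ∈ S := by
    intro α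
    simp [S]
  obtain ⟨C₁, R₁, hC₁, hR₁, h₁⟩ := exists_iteratedFDeriv_le_finset hK S
    fun α hα => (ha α ((hS α).2 hα)).mono hball
  have hpan : AnalyticOnNhd ℝ (fun y => principalSymbol m a y ξ₀) Ω := by
    intro y hy
    refine Finset.analyticAt_fun_sum _ fun α hα => ?_
    exact (ha α (Finset.mem_piAntidiag.1 hα).1.le y hy).mul analyticAt_const
  obtain ⟨C₂, R₂, hC₂, hR₂, h₂⟩ :=
    AnalyticOnNhd.exists_iteratedFDeriv_le hK (hpan.mono hball)
  set p := fun y => principalSymbol m a y ξ₀ with hp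
  -- The symbol vanishes at `x₀`, so the mean value inequality makes it `O(1 / μ)` on the ball of
  -- radius `d / μ`.
  have hlip : ∀ x ∈ Metric.closedBall x₀ d, ‖p x‖ ≤ C₂ * R₂ * ‖x - x₀‖ := by
    intro x hx
    have := (convex_closedBall x₀ d).norm_image_sub_le_of_norm_fderiv_le (𝕜 := ℝ) (f := p)
      (C := C₂ * R₂) (fun y hy => (hpan y (hball hy)).differentiableAt)
      (fun y hy => by
        have := h₂ y hy 1
        rw [norm_iteratedFDeriv_one] at this
        simpa using this)
      (Metric.mem_closedBall_self hd.le) hx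
    have hp0 : p x₀ = 0 := hP
    rwa [hp0, sub_zero] at this
  refine ⟨C₁ + C₂ * (1 + R₂ * d), R₁ + R₂, by positivity, by positivity, fun μ hμ x hx => ?_⟩
  have hμ0 : 0 < μ := by linarith
  have hxd : x ∈ Metric.closedBall x₀ d :=
    Metric.closedBall_subset_closedBall (div_le_self hd.le hμ) hx
  constructor
  · intro α hα i
    refine (h₁ α ((hS α).1 hα) x hxd i).trans ?_
    rw [mul_assoc]
    have e1 : R₁ ≤ (R₁ + R₂) * μ := by nlinarith
    have e2 : C₁ ≤ C₁ + C₂ * (1 + R₂ * d) := le_add_of_nonneg_right (by positivity)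
    gcongr
  · intro i
    rcases Nat.eq_zero_or_pos i with rfl | hi
    · rw [norm_iteratedFDeriv_zero, pow_zero, Nat.factorial_zero, Nat.cast_one, mul_one, mul_one]
      refine (hlip x hxd).trans ?_
      have hxn : ‖x - x₀‖ ≤ d / μ := by rwa [← dist_eq_norm]
      calc C₂ * R₂ * ‖x - x₀‖ ≤ C₂ * R₂ * (d / μ) := by gcongr
        _ = C₂ * (R₂ * d) * μ⁻¹ := by ring
        _ ≤ (C₁ + C₂ * (1 + R₂ * d)) * μ⁻¹ := by
          refine mul_le_mul_of_nonneg_right ?_ (by positivity)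
          linarith
    · refine (h₂ x hxd i).trans ?_
      -- For `i ≥ 1` the power `μ ^ i` in the rate pays for `μ⁻¹`; only `i = 0` needs the zero of
      -- the symbol.
      have e1 : R₂ ^ i ≤ μ⁻¹ * ((R₁ + R₂) * μ) ^ i := by
        have e3 : R₂ ^ i ≤ (R₁ + R₂) ^ i := pow_le_pow_left₀ hR₂ (by linarith) i
        have e4 : 1 ≤ μ⁻¹ * μ ^ i := by
          rw [← div_eq_inv_mul, le_div_iff₀ hμ0, one_mul]
          exact le_self_pow₀ hμ hi.ne'
        rw [mul_pow]
        calc R₂ ^ i ≤ (R₁ + R₂) ^ i * 1 := by rwa [mul_one]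
          _ ≤ (R₁ + R₂) ^ i * (μ⁻¹ * μ ^ i) := by gcongr
          _ = _ := by ring
      have e2 : C₂ ≤ C₁ + C₂ * (1 + R₂ * d) := by
        have : 0 ≤ C₂ * (R₂ * d) := by positivity
        linarith
      calc C₂ * R₂ ^ i * i.factorial
          ≤ (C₁ + C₂ * (1 + R₂ * d)) * (μ⁻¹ * ((R₁ + R₂) * μ) ^ i) * i.factorial := by gcongr
        _ = _ := by ring

theorem iterBoundOn_metivierFun {m : ℕ} (hm : 1 ≤ m) {s σ ε η δ : ℝ} (hσ : 1 ≤ σ) (hε : 0 ≤ ε)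
    (hε1 : ε ≤ 1) (hη : 0 < η) (hησ : η * σ ≤ 1 - 2 * ε) (hση : σ ≤ 1 / η) (hσs : σ ≤ s)
    (hηs : η * s * m = m - ε) {χ : EuclideanSpace ℝ (Fin n) → ℂ} (hχ : GlobalGevrey σ χ)
    {Ω : Set (EuclideanSpace ℝ (Fin n))} (hΩ : IsOpen Ω) (hδ : 0 < δ)
    {x₀ ξ₀ : EuclideanSpace ℝ (Fin n)} (hball : Metric.closedBall x₀ (2 * δ) ⊆ Ω)
    (hsupp : tsupport χ ⊆ Metric.ball 0 (2 * δ)) (hξ₀ : ‖ξ₀‖ = 1)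
    {a : (Fin n → ℕ) → EuclideanSpace ℝ (Fin n) → ℂ}
    (ha : ∀ α : Fin n → ℕ, ∑ i, α i ≤ m → AnalyticOnNhd ℝ (a α) Ω)
    (hP : principalSymbol m a x₀ ξ₀ = 0) :
    IterBoundOn s m a (metivierFun x₀ ξ₀ ε η χ) Ω := by
  have hG := (goodFamily_metivierFamily hσ hε hε1 hη hησ hση hχ x₀ hξ₀).mono (subset_univ Ω)
  have has : ∀ α : Fin n → ℕ, ∑ i, α i ≤ m → SmoothOn (a α) Ω := fun α hα x hx =>
    (ha α hα x hx).contDiffAt.contDiffWithinAt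
  obtain ⟨C, R, hC, hR, hcoef⟩ := exists_coeff_bounds ha hP (show 0 < 2 * δ by positivity) hball
  obtain ⟨A, B₀, hA, hB₀, hmaj⟩ := hχ.majorizedAt_dilate
  -- The three lower bounds on `B` serve the monotonicity of its powers, the cut-off, and the
  -- Leibniz rule.
  set B := max (max 1 B₀) (2 * R) with hB
  have hB1 : 1 ≤ B := (le_max_left _ _).trans (le_max_left _ _)
  set D := 2 * B * (2 * s) ^ s with hD
  have hs0 : 0 ≤ s := by linarith
  have hκ := multiIndexConst_nonneg n m
  set E := max 1 (2 * C * (multiIndexConst n m + 1)) with hE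
  have hE1 : 1 ≤ E := le_max_left _ _
  have key : ∀ (q : ℕ), ∀ x ∈ Ω, ∀ ρ : ℝ, 1 < ρ →
      ‖(diffOp m a)^[q] (metivierFamily x₀ ξ₀ ε η χ ρ) x‖ ≤
        2 * A * ((E * D) ^ (q * m) * ((q * m : ℕ) : ℝ) ^ (s * (q * m : ℕ))) *
          Real.exp (-(ρ ^ η / 2)) := by
    intro q x hx ρ hρ
    have hρ0 : 0 < ρ := by linarith
    have hμ : 1 ≤ ρ ^ ε := Real.one_le_rpow hρ.le hε
    have hμ0 : 0 < ρ ^ ε := by linarith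
    -- On the support of the packet `x` is within `2 δ / ρ ^ ε` of `x₀`, where the symbol is small.
    -- Off the support the packet vanishes in a neighbourhood of `x`, and so do all its iterates.
    by_cases hxs : ρ ^ ε • (x - x₀) ∈ tsupport χ
    · have hxb : x ∈ Metric.closedBall x₀ (2 * δ / ρ ^ ε) := by
        have := hsupp hxs
        rw [mem_ball_zero_iff, norm_smul, Real.norm_of_nonneg hμ0.le] at this
        rw [mem_closedBall_iff_norm, le_div_iff₀ hμ0, mul_comm]
        exact this.le
      set N := q * m with hN
      set h := ρ ^ (-(1 - 2 * ε)) with hh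
      set Φ := gevreyMajorant σ B (ρ ^ ε) h with hΦ
      have hamp : MajorizedAt Φ (A * Real.exp (-(ρ ^ η))) 0 (amplitude x₀ ε η χ ρ) x :=
        hmaj B (ρ ^ ε) h _ ((le_max_right _ _).trans (le_max_left _ _)) (by positivity)
          (Real.exp_pos _).le x₀ x
      have hM := isMajorant_rho (ε := ε) hσ hR (by linarith : 0 < B) (le_max_right _ _) hρ.le
      have hsm : SmoothOn (amplitude x₀ ε η χ ρ) Ω := by
        refine ContDiff.contDiffOn (ContDiff.mul ?_ contDiff_const)
        exact contDiff_dilate hχ.1 _ x₀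
      obtain ⟨hab, hpb⟩ := hcoef (ρ ^ ε) hμ x hxb
      rw [← Real.rpow_neg hρ0.le] at hpb
      have hw := (majorizedAt_iterate_shiftedOp hM (by positivity)
        (one_le_rho_mul hρ.le hε1) (rho_mul_le hρ.le hε) (by positivity) rfl hξ₀ hΩ hx has hC hab
        hpb hsm hamp q).2.2 0
      rw [norm_iteratedFDeriv_zero] at hw
      have hq := (iterate_diffOp_mul_wave hΩ hsm x₀ ξ₀ ρ has q).2 hx
      change (diffOp m a)^[q] (metivierFamily x₀ ξ₀ ε η χ ρ) x = _ at hq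
      rw [hq, norm_mul, norm_wave, mul_one]
      refine hw.trans ?_
      have hX : 0 < ρ ^ η := by positivity
      have hnum := rpow_mul_gevreyMajorant_le (μ := ρ ^ ε) hσ hσs hB1 hX
        (show 0 ≤ h by positivity) (rho_rpow_le hρ.le hησ) N
      -- This identity fixes `η`: by `η s m = m - ε`, the cost of `q` applications of `P` is `X ^ (s
      -- q m)` with `X = ρ ^ η`.
      have e1 : (ρ ^ η) ^ (s * N) = (ρ ^ m * ρ ^ (-ε)) ^ q := by
        rw [← Real.rpow_natCast ρ m, ← Real.rpow_add hρ0, ← Real.rpow_natCast _ q,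
          ← Real.rpow_mul hρ0.le, ← Real.rpow_mul hρ0.le, hN, Nat.cast_mul]
        congr 1
        linear_combination (q : ℝ) * hηs
      rw [e1, ← hD] at hnum
      have hEq : (2 * C * (multiIndexConst n m + 1)) ^ q ≤ E ^ N :=
        (pow_le_pow_left₀ (by positivity) (le_max_right _ _) q).trans
          (pow_le_pow_right₀ hE1 (Nat.le_mul_of_pos_right q hm))
      calc (2 * C * (multiIndexConst n m + 1)) ^ q * (ρ ^ m * ρ ^ (-ε)) ^ q *
            (A * Real.exp (-(ρ ^ η))) * Φ 0 N
          = (2 * C * (multiIndexConst n m + 1)) ^ q * (A * ((ρ ^ m * ρ ^ (-ε)) ^ q *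
            Φ 0 N * Real.exp (-(ρ ^ η)))) := by ring
        _ ≤ E ^ N * (A * (2 * (D ^ N * (N : ℝ) ^ (s * N)) * Real.exp (-(ρ ^ η / 2)))) := by
            have hnn : 0 ≤ (ρ ^ m * ρ ^ (-ε)) ^ q * Φ 0 N * Real.exp (-(ρ ^ η)) :=
              mul_nonneg (mul_nonneg (by positivity) (hM.nonneg 0 N)) (Real.exp_pos _).le
            gcongr
        _ = _ := by rw [mul_pow E D]; ring
    · set U := {y | ρ ^ ε • (y - x₀) ∈ (tsupport χ)ᶜ} with hU
      have hUo : IsOpen U :=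
        (isClosed_tsupport χ).isOpen_compl.preimage (by fun_prop)
      have h0 : EqOn (metivierFamily x₀ ξ₀ ε η χ ρ) (fun _ => 0) U := by
        intro y hy
        have : χ (ρ ^ ε • (y - x₀)) = 0 := image_eq_zero_of_notMem_tsupport hy
        simp [metivierFamily, amplitude, this]
      have h1 := iterate_diffOp_congr hUo h0 m a q (show x ∈ U from hxs)
      rw [h1, iterate_diffOp_zero, norm_zero]
      positivity
  refine ⟨2 * A * ∫ ρ in Ioi (1 : ℝ), Real.exp (-(ρ ^ η / 2)), E * D,
    mul_nonneg (by positivity) (integral_nonneg fun ρ => (Real.exp_pos _).le), by positivity,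
    fun q x hx => ?_⟩
  rw [metivierFun_eq, hG.iterate_diffOp_integral hΩ has q hx]
  refine (norm_integral_le_of_exp_bound hη fun ρ hρ => key q x hx ρ hρ).trans (le_of_eq ?_)
  ring

end Ultradiff

namespace Ultradiff

/-! ### Derivatives of Métivier's function at the base point -/

variable {n : ℕ}

theorem iterate_directionalD_congr {f g : EuclideanSpace ℝ (Fin n) → ℂ}
    {Ω : Set (EuclideanSpace ℝ (Fin n))} (hΩ : IsOpen Ω) (h : EqOn f g Ω)
    (ξ : EuclideanSpace ℝ (Fin n)) (j : ℕ) :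
    EqOn ((directionalD ξ)^[j] f) ((directionalD ξ)^[j] g) Ω := by
  induction j with
  | zero => exact h
  | succ j ih =>
    simp only [Function.iterate_succ_apply']
    exact directionalD_congr hΩ ih ξ

theorem iterate_directionalD_const_mul_wave (x₀ : EuclideanSpace ℝ (Fin n))
    {ξ : EuclideanSpace ℝ (Fin n)} (hξ : ‖ξ‖ = 1) (ρ : ℝ) (c : ℂ) (j : ℕ) :
    (directionalD ξ)^[j] (fun y => c * wave x₀ ξ ρ y) =
      fun y => (c * (ρ : ℂ) ^ j) * wave x₀ ξ ρ y := by
  induction j with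
  | zero => simp
  | succ j ih =>
    rw [Function.iterate_succ_apply', ih]
    funext y
    have hd := (hasFDerivAt_wave x₀ ξ ρ y).const_mul (c * (ρ : ℂ) ^ j)
    rw [directionalD, hd.fderiv]
    simp only [smul_apply, ContinuousLinearMap.smulRight_apply, innerSL_apply_apply,
      real_inner_self_eq_norm_sq, hξ, one_pow, one_smul, smul_eq_mul]
    linear_combination (-(c * (ρ : ℂ) ^ (j + 1) * wave x₀ ξ ρ y)) * Complex.I_mul_I

/-- Near `x₀` the packet is a plane wave, on which `D_ξ` acts as multiplication by `ρ ‖ξ‖² = ρ`. -/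
theorem iterate_directionalD_metivierFamily {χ : EuclideanSpace ℝ (Fin n) → ℂ}
    (hχ : ∀ᶠ y in 𝓝 0, χ y = 1) (x₀ : EuclideanSpace ℝ (Fin n))
    {ξ : EuclideanSpace ℝ (Fin n)} (hξ : ‖ξ‖ = 1) (ε η ρ : ℝ) (j : ℕ) :
    (directionalD ξ)^[j] (metivierFamily x₀ ξ ε η χ ρ) x₀ =
      ((ρ ^ j * Real.exp (-(ρ ^ η)) : ℝ) : ℂ) := by
  obtain ⟨V, hV, hVo, h0⟩ := eventually_nhds_iff.1 hχ
  have hcont : Continuous fun y : EuclideanSpace ℝ (Fin n) => ρ ^ ε • (y - x₀) := by fun_prop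
  have hEq : EqOn (metivierFamily x₀ ξ ε η χ ρ)
      (fun y => (Real.exp (-(ρ ^ η)) : ℂ) * wave x₀ ξ ρ y)
      ((fun y => ρ ^ ε • (y - x₀)) ⁻¹' V) := by
    intro y hy
    simp only [metivierFamily, amplitude, hV _ hy, one_mul]
  have hx : x₀ ∈ (fun y => ρ ^ ε • (y - x₀)) ⁻¹' V := by simpa using h0
  rw [iterate_directionalD_congr (hVo.preimage hcont) hEq ξ j hx,
    iterate_directionalD_const_mul_wave x₀ hξ]
  simp [wave, mul_comm]

theorem integrableOn_pow_mul_exp_neg_rpow {η : ℝ} (hη : 0 < η) (j : ℕ) :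
    IntegrableOn (fun ρ : ℝ => ρ ^ j * Real.exp (-(ρ ^ η))) (Ioi 0) := by
  have h := integrableOn_rpow_mul_exp_neg_mul_rpow_Ioi hη one_pos
    (q := (j : ℝ)) (by have := Nat.cast_nonneg (α := ℝ) j; linarith)
  simpa only [Real.rpow_natCast, neg_mul, one_mul] using h

/-- The difference is minus the integral over `(0, 1]`, which is at most `∫_0^1 ρ ^ j dρ = 1 / (j +
1)`. -/
theorem tendsto_integral_Ioi_one_sub_Gamma {η : ℝ} (hη : 0 < η) :
    Tendsto (fun j : ℕ => (∫ ρ in Ioi (1 : ℝ), ρ ^ j * Real.exp (-(ρ ^ η))) -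
      1 / η * Real.Gamma ((j + 1) / η)) atTop (𝓝 0) := by
  refine squeeze_zero_norm (fun j => ?_) tendsto_one_div_add_atTop_nhds_zero_nat
  have hint := integrableOn_pow_mul_exp_neg_rpow hη j
  have hG := integral_rpow_mul_exp_neg_rpow hη
    (by have := Nat.cast_nonneg (α := ℝ) j; linarith : (-1 : ℝ) < j)
  simp only [Real.rpow_natCast] at hG
  have hsplit : ∫ ρ in Ioi (0 : ℝ), ρ ^ j * Real.exp (-(ρ ^ η)) =
      (∫ ρ in Ioc (0 : ℝ) 1, ρ ^ j * Real.exp (-(ρ ^ η))) +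
        ∫ ρ in Ioi (1 : ℝ), ρ ^ j * Real.exp (-(ρ ^ η)) := by
    rw [← Ioc_union_Ioi_eq_Ioi zero_le_one]
    exact setIntegral_union (Ioc_disjoint_Ioi le_rfl) measurableSet_Ioi
      (hint.mono_set Ioc_subset_Ioi_self) (hint.mono_set (Ioi_subset_Ioi zero_le_one))
  rw [← hG, hsplit, sub_add_cancel_right, norm_neg, Real.norm_of_nonneg
    (setIntegral_nonneg measurableSet_Ioc fun ρ hρ => by have := hρ.1; positivity)]
  calc ∫ ρ in Ioc (0 : ℝ) 1, ρ ^ j * Real.exp (-(ρ ^ η))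
      ≤ ∫ ρ in Ioc (0 : ℝ) 1, ρ ^ j := by
        refine setIntegral_mono_on (hint.mono_set Ioc_subset_Ioi_self)
          ((continuous_pow j).integrableOn_Ioc) measurableSet_Ioc fun ρ hρ => ?_
        have := hρ.1
        refine mul_le_of_le_one_right (by positivity) (Real.exp_le_one_iff.2 ?_)
        have : 0 ≤ ρ ^ η := by positivity
        linarith
    _ = 1 / ((j : ℝ) + 1) := by
        rw [← intervalIntegral.integral_of_le zero_le_one, integral_pow]
        simp

/-- The interval `(R, 2 R]` with `R ^ η = j` already carries the growth `j ^ (j / η)` up to a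
geometric factor, so no asymptotics of the Gamma function are needed. -/
theorem pow_le_integral_Ioi_one {η : ℝ} (hη : 0 < η) {j : ℕ} (hj : 1 ≤ j) :
    ((j : ℝ) ^ (1 / η) * Real.exp (-(2 ^ η))) ^ j ≤
      ∫ ρ in Ioi (1 : ℝ), ρ ^ j * Real.exp (-(ρ ^ η)) := by
  set R : ℝ := (j : ℝ) ^ (1 / η) with hR
  have hj1 : (1 : ℝ) ≤ j := by exact_mod_cast hj
  have hR1 : 1 ≤ R := Real.one_le_rpow hj1 (by positivity)
  have hRη : R ^ η = j := by
    rw [hR, ← Real.rpow_mul (by positivity), one_div_mul_cancel hη.ne', Real.rpow_one]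
  have hint := integrableOn_pow_mul_exp_neg_rpow hη j
  have hsub : Ioc R (2 * R) ⊆ Ioi 1 := fun ρ hρ => hR1.trans_lt hρ.1
  have h1 : (R * Real.exp (-(2 ^ η))) ^ j * volume.real (Ioc R (2 * R)) ≤
      ∫ ρ in Ioc R (2 * R), ρ ^ j * Real.exp (-(ρ ^ η)) := by
    refine setIntegral_ge_of_const_le_real measurableSet_Ioc (by simp) (fun ρ hρ => ?_)
      (hint.mono_set (hsub.trans (Ioi_subset_Ioi zero_le_one)))
    rw [mul_pow, ← Real.exp_nat_mul]
    have hρ0 : 0 < ρ := zero_lt_one.trans (hsub hρ)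
    have h2 : ρ ^ η ≤ j * 2 ^ η := by
      calc ρ ^ η ≤ (2 * R) ^ η := Real.rpow_le_rpow hρ0.le hρ.2 hη.le
        _ = _ := by rw [Real.mul_rpow zero_le_two (by positivity), hRη, mul_comm]
    have h3 : R ^ j ≤ ρ ^ j := pow_le_pow_left₀ (by positivity) hρ.1.le j
    have h4 : Real.exp (j * -(2 ^ η)) ≤ Real.exp (-(ρ ^ η)) := Real.exp_le_exp.2 (by linarith)
    exact mul_le_mul h3 h4 (Real.exp_pos _).le (by positivity)
  have hvol : volume.real (Ioc R (2 * R)) = R := by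
    rw [Real.volume_real_Ioc_of_le (by linarith)]; ring
  rw [hvol] at h1
  calc (R * Real.exp (-(2 ^ η))) ^ j ≤ (R * Real.exp (-(2 ^ η))) ^ j * R :=
        le_mul_of_one_le_right (by positivity) hR1
    _ ≤ _ := h1
    _ ≤ _ := setIntegral_mono_set (hint.mono_set (Ioi_subset_Ioi zero_le_one))
        ((ae_restrict_iff' measurableSet_Ioi).2 (Eventually.of_forall fun ρ hρ => by
          have : 0 < ρ := zero_lt_one.trans hρ
          simp only [Pi.zero_apply]
          positivity)) (LE.le.eventuallyLE hsub)

/-- Membership is tested on the compact set `{x}` alone, so `u` fails to be in the class near `x₀`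
because of its derivatives at that single point. -/
theorem norm_iterate_directionalD_le_of_mem_roumieu {r : ℝ} (hr : 0 < r)
    {f : EuclideanSpace ℝ (Fin n) → ℂ} {U : Set (EuclideanSpace ℝ (Fin n))} (hU : IsOpen U)
    (hf : f ∈ roumieu (gevreyWeight r) U) {x : EuclideanSpace ℝ (Fin n)} (hx : x ∈ U)
    {ξ : EuclideanSpace ℝ (Fin n)} (hξ : ‖ξ‖ = 1) :
    ∃ C D : ℝ, 0 ≤ C ∧ 0 ≤ D ∧ ∀ j : ℕ,
      ‖(directionalD ξ)^[j] f x‖ ≤ C * (D * (j : ℝ) ^ r) ^ j := by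
  obtain ⟨l, hl, C, hC⟩ := hf.2 {x} isCompact_singleton (singleton_subset_iff.2 hx)
  refine ⟨max C 0, n * (r / l) ^ r, le_max_right _ _, by positivity, fun j => ?_⟩
  have h1 : ‖iteratedFDeriv ℝ j f x‖ ≤ n ^ j * (max C 0 * (r * j / l) ^ (r * j)) := by
    refine norm_iteratedFDeriv_le_of_multiD hf.1 hU hx (by positivity) fun α hα => ?_
    have h2 := hC α x rfl
    rw [Real.exp_neg, ← div_eq_mul_inv, div_le_iff₀ (Real.exp_pos _), hα] at h2
    exact h2.trans (mul_le_mul (le_max_left _ _) (exp_youngConj_gevreyWeight_le hr hl j)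
      (Real.exp_pos _).le (le_max_right _ _))
  rw [iterate_directionalD hf.1 hU ξ j hx, norm_mul, norm_pow, norm_neg, Complex.norm_I, one_pow,
    one_mul]
  refine ((iteratedFDeriv ℝ j f x).le_opNorm _).trans ?_
  simp only [hξ, Finset.prod_const_one, mul_one]
  refine h1.trans (le_of_eq ?_)
  rw [mul_div_right_comm, Real.rpow_mul (by positivity), Real.rpow_natCast,
    Real.mul_rpow (by positivity) (by positivity), mul_pow, mul_pow, mul_pow]
  ring

/-- The quotient of the bases grows like `j ^ (r' - r)`. Once it exceeds `2` with `D + 1` in place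
of `D`, and `j ≥ C`, the inequality would force `2 ^ j ≤ j`. -/
theorem not_forall_pow_le {r r' C D E : ℝ} (hr : r < r') (hD : 0 ≤ D) (hE : 0 < E) :
    ¬ ∀ j : ℕ, 1 ≤ j → ((j : ℝ) ^ r' * E) ^ j ≤ C * (D * (j : ℝ) ^ r) ^ j := by
  intro h
  have ht := (tendsto_rpow_atTop (sub_pos.2 hr)).comp (tendsto_natCast_atTop_atTop (R := ℝ))
  obtain ⟨j, hj, hj1, hjC⟩ := ((ht.eventually_ge_atTop (2 * (D + 1) / E)).and
    ((eventually_ge_atTop 1).and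
      (tendsto_natCast_atTop_atTop (R := ℝ) |>.eventually_ge_atTop C))).exists
  have hj0 : (0 : ℝ) < j := by exact_mod_cast hj1
  have hjr : 0 < (j : ℝ) ^ r := Real.rpow_pos_of_pos hj0 r
  simp only [Function.comp_apply, Real.rpow_sub hj0] at hj
  rw [div_le_div_iff₀ hE hjr] at hj
  have hpos : 0 < ((D + 1) * (j : ℝ) ^ r) ^ j := by positivity
  have h2 : (2 : ℝ) ^ j * ((D + 1) * (j : ℝ) ^ r) ^ j ≤ j * ((D + 1) * (j : ℝ) ^ r) ^ j := by
    calc (2 : ℝ) ^ j * ((D + 1) * (j : ℝ) ^ r) ^ j = (2 * (D + 1) * (j : ℝ) ^ r) ^ j := by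
          rw [← mul_pow]; ring
      _ ≤ ((j : ℝ) ^ r' * E) ^ j := pow_le_pow_left₀ (by positivity) hj j
      _ ≤ C * (D * (j : ℝ) ^ r) ^ j := h j hj1
      _ ≤ j * ((D + 1) * (j : ℝ) ^ r) ^ j := by
          gcongr
          linarith
  have h3 : (2 : ℝ) ^ j ≤ j := le_of_mul_le_mul_right h2 hpos
  have h4 : (j : ℝ) < 2 ^ j := by exact_mod_cast Nat.lt_two_pow_self
  linarith

/-! ### Admissible parameters -/

theorem metivierEta_mul {m : ℕ} (hm : 1 ≤ m) {s : ℝ} (hs : 0 < s) (ε : ℝ) :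
    metivierEta m s ε * s * m = m - ε := by
  have : (m : ℝ) ≠ 0 := by positivity
  rw [metivierEta]
  field_simp

namespace IsMetivierData

variable {Ω : Set (EuclideanSpace ℝ (Fin n))} {x₀ : EuclideanSpace ℝ (Fin n)} {m : ℕ}
  {s σ ε δ : ℝ} {χ : EuclideanSpace ℝ (Fin n) → ℂ}

theorem eps_mul_lt (h : IsMetivierData Ω x₀ m s σ ε δ χ) (hm : 1 ≤ m) :
    ε * (2 * m * s - σ) < m * (s - σ) := by
  have hm1 : (1 : ℝ) ≤ m := by exact_mod_cast hm
  have := h.one_lt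
  have := h.lt_s
  exact (lt_div_iff₀ (by nlinarith)).1 h.eps_lt

theorem eps_lt_half (h : IsMetivierData Ω x₀ m s σ ε δ χ) (hm : 1 ≤ m) : ε < 1 / 2 := by
  have hm1 : (1 : ℝ) ≤ m := by exact_mod_cast hm
  have h1 := h.one_lt
  have h2 := h.lt_s
  have h3 : 0 < 2 * m * s - σ := by nlinarith
  have h4 := h.eps_mul_lt hm
  have h5 : m * (s - σ) ≤ 1 / 2 * (2 * m * s - σ) := by nlinarith
  exact lt_of_mul_lt_mul_right (h4.trans_le h5) h3.le

theorem eta_pos (h : IsMetivierData Ω x₀ m s σ ε δ χ) (hm : 1 ≤ m) : 0 < metivierEta m s ε := by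
  have hm1 : (1 : ℝ) ≤ m := by exact_mod_cast hm
  have h1 := h.one_lt
  have h2 := h.lt_s
  have h3 := h.eps_lt_half hm
  have hs : 0 < s := by linarith
  exact div_pos (by linarith) (by positivity)

/-- This is the upper bound on `ε` in disguise: clearing denominators gives `ε (2 m s - σ) ≤ m (s -
σ)`. -/
theorem eta_mul_le (h : IsMetivierData Ω x₀ m s σ ε δ χ) (hm : 1 ≤ m) :
    metivierEta m s ε * σ ≤ 1 - 2 * ε := by
  have hm1 : (1 : ℝ) ≤ m := by exact_mod_cast hm
  have h1 := h.one_lt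
  have h2 := h.lt_s
  have h4 := h.eps_mul_lt hm
  have hs : 0 < s := by linarith
  rw [metivierEta, div_mul_eq_mul_div, div_le_iff₀ (by positivity)]
  nlinarith

/-- Since `η s m = m - ε < m`, the gain `ε` is precisely what separates the two Gevrey orders. -/
theorem lt_one_div_eta (h : IsMetivierData Ω x₀ m s σ ε δ χ) (hm : 1 ≤ m) :
    s < 1 / metivierEta m s ε := by
  have hm1 : (0 : ℝ) < m := by exact_mod_cast hm
  have hs : 0 < s := by linarith [h.one_lt, h.lt_s]
  have hη := h.eta_pos hm
  have he := metivierEta_mul hm hs ε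
  rw [lt_div_iff₀ hη, mul_comm]
  refine lt_of_mul_lt_mul_right ?_ hm1.le
  linarith [h.eps_pos]

theorem globalGevrey (h : IsMetivierData Ω x₀ m s σ ε δ χ) : GlobalGevrey σ χ :=
  globalGevrey_of_mem_beurling (by linarith [h.one_lt]) h.mem_beurling
    (Metric.isCompact_of_isClosed_isBounded (isClosed_tsupport χ)
      (Metric.isBounded_ball.subset h.tsupport_subset))

variable {ξ₀ : EuclideanSpace ℝ (Fin n)}

theorem goodFamily (h : IsMetivierData Ω x₀ m s σ ε δ χ) (hm : 1 ≤ m) (hξ₀ : ‖ξ₀‖ = 1) :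
    GoodFamily (metivierFamily x₀ ξ₀ ε (metivierEta m s ε) χ) univ :=
  goodFamily_metivierFamily h.one_lt.le h.eps_pos.le (by linarith [h.eps_lt_half hm])
    (h.eta_pos hm) (h.eta_mul_le hm) (h.lt_s.le.trans (h.lt_one_div_eta hm).le) h.globalGevrey
    x₀ hξ₀

theorem mem_roumieu (h : IsMetivierData Ω x₀ m s σ ε δ χ) (hm : 1 ≤ m) (hξ₀ : ‖ξ₀‖ = 1) :
    metivierFun x₀ ξ₀ ε (metivierEta m s ε) χ ∈
      roumieu (gevreyWeight (1 / metivierEta m s ε)) univ :=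
  metivierFun_mem_roumieu h.one_lt.le h.eps_pos.le (by linarith [h.eps_lt_half hm])
    (h.eta_pos hm) (h.eta_mul_le hm) (h.lt_s.le.trans (h.lt_one_div_eta hm).le) h.globalGevrey
    x₀ hξ₀

theorem iterBoundOn (h : IsMetivierData Ω x₀ m s σ ε δ χ) (hm : 1 ≤ m) (hξ₀ : ‖ξ₀‖ = 1)
    (hΩ : IsOpen Ω) {a : (Fin n → ℕ) → EuclideanSpace ℝ (Fin n) → ℂ}
    (ha : ∀ α : Fin n → ℕ, ∑ i, α i ≤ m → AnalyticOnNhd ℝ (a α) Ω)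
    (hP : principalSymbol m a x₀ ξ₀ = 0) :
    IterBoundOn s m a (metivierFun x₀ ξ₀ ε (metivierEta m s ε) χ) Ω :=
  iterBoundOn_metivierFun hm h.one_lt.le h.eps_pos.le (by linarith [h.eps_lt_half hm])
    (h.eta_pos hm) (h.eta_mul_le hm) (h.lt_s.le.trans (h.lt_one_div_eta hm).le) h.lt_s.le
    (metivierEta_mul hm (by linarith [h.one_lt, h.lt_s]) ε) h.globalGevrey hΩ h.delta_pos
    h.ball_subset h.tsupport_subset hξ₀ ha hP

theorem iterate_directionalD_eq (h : IsMetivierData Ω x₀ m s σ ε δ χ) (hm : 1 ≤ m)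
    (hξ₀ : ‖ξ₀‖ = 1) (j : ℕ) :
    (directionalD ξ₀)^[j] (metivierFun x₀ ξ₀ ε (metivierEta m s ε) χ) x₀ =
      ((∫ ρ in Ioi (1 : ℝ), ρ ^ j * Real.exp (-(ρ ^ metivierEta m s ε)) : ℝ) : ℂ) := by
  rw [metivierFun_eq, ((h.goodFamily hm hξ₀).iterate_directionalD_integral isOpen_univ ξ₀ j).2
    (mem_univ x₀)]
  simp only [iterate_directionalD_metivierFamily h.eq_one x₀ hξ₀]
  exact integral_ofReal

theorem tendsto_iterate_directionalD (h : IsMetivierData Ω x₀ m s σ ε δ χ) (hm : 1 ≤ m)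
    (hξ₀ : ‖ξ₀‖ = 1) :
    Tendsto (fun j : ℕ =>
      (directionalD ξ₀)^[j] (metivierFun x₀ ξ₀ ε (metivierEta m s ε) χ) x₀ -
        ((1 / metivierEta m s ε * Real.Gamma ((j + 1) / metivierEta m s ε) : ℝ) : ℂ))
      atTop (𝓝 0) := by
  have ht := (Complex.continuous_ofReal.tendsto 0).comp
    (tendsto_integral_Ioi_one_sub_Gamma (h.eta_pos hm))
  rw [Complex.ofReal_zero] at ht
  refine ht.congr fun j => ?_
  rw [Function.comp_apply, h.iterate_directionalD_eq hm hξ₀, Complex.ofReal_sub]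

theorem notMem_roumieu (h : IsMetivierData Ω x₀ m s σ ε δ χ) (hm : 1 ≤ m) (hξ₀ : ‖ξ₀‖ = 1)
    {s' : ℝ} (hs' : 0 < s') (hlt : s' < 1 / metivierEta m s ε)
    {U : Set (EuclideanSpace ℝ (Fin n))} (hU : IsOpen U) (hx₀ : x₀ ∈ U) :
    metivierFun x₀ ξ₀ ε (metivierEta m s ε) χ ∉ roumieu (gevreyWeight s') U := by
  intro hu
  obtain ⟨C, D, hC, hD, hb⟩ := norm_iterate_directionalD_le_of_mem_roumieu hs' hU hu hx₀ hξ₀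
  refine not_forall_pow_le (C := C) hlt hD (Real.exp_pos (-(2 ^ metivierEta m s ε)))
    fun j hj => (pow_le_integral_Ioi_one (h.eta_pos hm) hj).trans (le_trans ?_ (hb j))
  rw [h.iterate_directionalD_eq hm hξ₀, Complex.norm_real]
  exact le_abs_self _

theorem mem_beurlingIter (h : IsMetivierData Ω x₀ m s σ ε δ χ) (hm : 1 ≤ m) (hξ₀ : ‖ξ₀‖ = 1)
    (hΩ : IsOpen Ω) {a : (Fin n → ℕ) → EuclideanSpace ℝ (Fin n) → ℂ}
    (ha : ∀ α : Fin n → ℕ, ∑ i, α i ≤ m → AnalyticOnNhd ℝ (a α) Ω)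
    (hP : principalSymbol m a x₀ ξ₀ = 0) {ω : ℝ → ℝ} (hω : IsWeight ω)
    (hωs : ω =o[atTop] gevreyWeight s) :
    metivierFun x₀ ξ₀ ε (metivierEta m s ε) χ ∈ beurlingIter m a ω Ω :=
  Ultradiff.mem_beurlingIter hω.youngBdd hω.monotoneOn (by linarith [h.one_lt, h.lt_s]) hωs
    (ContDiffOn.mono (h.mem_roumieu hm hξ₀).1 (subset_univ Ω)) (h.iterBoundOn hm hξ₀ hΩ ha hP)

end IsMetivierData

end Ultradiff

/-! ### Assembly of the four assertions. -/

theorem mainTheorem3 {n m : ℕ} (hm : 1 ≤ m)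
    {Ω : Set (EuclideanSpace ℝ (Fin n))} (hΩ : IsOpen Ω) (hΩc : IsConnected Ω)
    (a : (Fin n → ℕ) → EuclideanSpace ℝ (Fin n) → ℂ)
    (ha : ∀ α : Fin n → ℕ, ∑ i, α i ≤ m → AnalyticOnNhd ℝ (a α) Ω)
    (x₀ ξ₀ : EuclideanSpace ℝ (Fin n)) (hx₀ : x₀ ∈ Ω) (hξ₀ : ‖ξ₀‖ = 1)
    (hP : Ultradiff.principalSymbol m a x₀ ξ₀ = 0)
    (s : ℝ) (hs : 1 < s) :
    -- for all admissible parameters there is a cut-off function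
    (∀ σ ε δ : ℝ, 1 < σ → σ < s → 0 < ε → ε < m * (s - σ) / (2 * m * s - σ) →
      0 < δ → Metric.closedBall x₀ (2 * δ) ⊆ Ω →
      ∃ χ, Ultradiff.IsMetivierData Ω x₀ m s σ ε δ χ) ∧
    -- properties of the function of Métivier
    (∀ (σ ε δ : ℝ) (χ : EuclideanSpace ℝ (Fin n) → ℂ),
      Ultradiff.IsMetivierData Ω x₀ m s σ ε δ χ →
      ∀ (η : ℝ) (u : EuclideanSpace ℝ (Fin n) → ℂ),
      η = Ultradiff.metivierEta m s ε → u = Ultradiff.metivierFun x₀ ξ₀ ε η χ →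
      0 < η ∧ s < 1 / η ∧
      Tendsto (fun j : ℕ => (Ultradiff.directionalD ξ₀)^[j] u x₀ -
        ((1 / η * Real.Gamma ((j + 1) / η) : ℝ) : ℂ)) atTop (𝓝 0) ∧
      u ∈ Ultradiff.roumieu (Ultradiff.gevreyWeight (1 / η)) univ ∧
      (∀ s' : ℝ, 0 < s' → s' < 1 / η → ∀ U, IsOpen U → x₀ ∈ U →
        u ∉ Ultradiff.roumieu (Ultradiff.gevreyWeight s') U) ∧
      u ∈ Ultradiff.roumieuIter m a (Ultradiff.gevreyWeight s) Ω ∧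
      ∀ (s' : ℝ) (ω : ℝ → ℝ), s < s' → s' < 1 / η → Ultradiff.IsBetween s s' ω →
        u ∈ Ultradiff.roumieuIter m a ω Ω \ Ultradiff.roumieu ω Ω ∧
        u ∈ Ultradiff.beurlingIter m a ω Ω \
          Ultradiff.beurling (Ultradiff.gevreyWeight s') Ω) ∧
    -- the weight `t^{1/s} / log t` (changed on a bounded interval) is such a weight
    (∃ ω : ℝ → ℝ, (∀ᶠ t in atTop, ω t = t ^ (1 / s) / Real.log t) ∧
      (∀ s' : ℝ, s < s' → Ultradiff.IsBetween s s' ω) ∧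
      ∀ r : ℝ, 1 < r → ¬ (ω =Θ[atTop] Ultradiff.gevreyWeight r)) ∧
    -- so `E_{ω} = E^P_{ω}` and `E^P_(ω) ⊆ E_(τ)` for all `τ = o(ω)` fail
    (∃ s' : ℝ, s < s' ∧ ∀ ω : ℝ → ℝ, Ultradiff.IsBetween s s' ω →
      (∀ α : Fin n → ℕ, ∑ i, α i ≤ m →
        a α ∈ Ultradiff.roumieu ω Ω ∩ Ultradiff.beurling ω Ω) ∧
      Ultradiff.roumieu ω Ω ≠ Ultradiff.roumieuIter m a ω Ω ∧
      ∃ τ : ℝ → ℝ, Ultradiff.IsWeight τ ∧ Ultradiff.IsSubadd τ ∧ τ =o[atTop] ω ∧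
        τ = Ultradiff.gevreyWeight s' ∧
        ¬ Ultradiff.beurlingIter m a ω Ω ⊆ Ultradiff.beurling τ Ω) := by
  refine ⟨fun σ ε δ hσ hσs hε hεlt hδ hball => ?_, ?_, ?_, ?_⟩
  · obtain ⟨χ, h1, h2, h3⟩ := Ultradiff.exists_cutoff n hσ hδ
    exact ⟨χ, hσ, hσs, hε, hεlt, hδ, hball, h1, h2, h3⟩
  · rintro σ ε δ χ h η u rfl rfl
    refine ⟨h.eta_pos hm, h.lt_one_div_eta hm, h.tendsto_iterate_directionalD hm hξ₀,
      h.mem_roumieu hm hξ₀, fun s' hs' hlt U hU hxU => h.notMem_roumieu hm hξ₀ hs' hlt hU hxU,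
      Ultradiff.mem_roumieuIter_gevreyWeight (by linarith)
        (ContDiffOn.mono (h.mem_roumieu hm hξ₀).1 (subset_univ Ω))
        (h.iterBoundOn hm hξ₀ hΩ ha hP), fun s' ω hss' hlt hω => ?_⟩
    have hu := h.mem_beurlingIter hm hξ₀ hΩ ha hP hω.isWeight hω.upper
    -- Failure at the Gevrey order `s'` settles both claims: the Roumieu class of `ω` and the
    -- Beurling class of order `s'` lie in the Roumieu class of order `s'`.
    have hnot := h.notMem_roumieu hm hξ₀ (by linarith) hlt hΩ hx₀
    exact ⟨⟨Ultradiff.beurlingIter_subset_roumieuIter m a ω Ω hu, fun h' => hnot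
        (Ultradiff.roumieu_subset_of_isLittleO hω.isWeight (by linarith) hω.lower Ω h')⟩,
      hu, fun h' => hnot (Ultradiff.beurling_subset_roumieu _ Ω h')⟩
  · exact ⟨Ultradiff.logWeight s, Ultradiff.logWeight_eventuallyEq hs,
      fun s' hs' => Ultradiff.isBetween_logWeight hs hs',
      fun r hr => Ultradiff.not_isTheta_logWeight hs hr⟩
  · obtain ⟨σ, hσ, hσs⟩ := exists_between hs
    have hm1 : (1 : ℝ) ≤ m := by exact_mod_cast hm
    have hpos : 0 < (m : ℝ) * (s - σ) / (2 * m * s - σ) :=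
      div_pos (mul_pos (by linarith) (by linarith)) (by nlinarith)
    obtain ⟨ε, hε, hεlt⟩ := exists_between hpos
    obtain ⟨d, hd, hball⟩ := Metric.nhds_basis_closedBall.mem_iff.1 (hΩ.mem_nhds hx₀)
    obtain ⟨χ, h1, h2, h3⟩ := Ultradiff.exists_cutoff n hσ (half_pos hd)
    have h : Ultradiff.IsMetivierData Ω x₀ m s σ ε (d / 2) χ :=
      ⟨hσ, hσs, hε, hεlt, half_pos hd, by rwa [mul_div_cancel₀ d two_ne_zero], h1, h2, h3⟩
    -- Any value between `s` and `1 / η` works, and it is fixed before `ω` is given.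
    obtain ⟨s', hss', hlt⟩ := exists_between (h.lt_one_div_eta hm)
    refine ⟨s', hss', fun ω hω => ⟨fun α hα => ?_, fun heq => ?_, Ultradiff.gevreyWeight s',
      Ultradiff.isWeight_gevreyWeight (by linarith), Ultradiff.isSubadd_gevreyWeight (by linarith),
      hω.lower, rfl, fun hsub => ?_⟩⟩
    · have hb := Ultradiff.mem_beurling_of_analyticOnNhd hω.isWeight hs hω.upper (ha α hα)
      exact ⟨Ultradiff.beurling_subset_roumieu ω Ω hb, hb⟩
    · have hu := h.mem_beurlingIter hm hξ₀ hΩ ha hP hω.isWeight hω.upper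
      refine h.notMem_roumieu hm hξ₀ (by linarith) hlt hΩ hx₀
        (Ultradiff.roumieu_subset_of_isLittleO hω.isWeight (by linarith) hω.lower Ω ?_)
      rw [heq]
      exact Ultradiff.beurlingIter_subset_roumieuIter m a ω Ω hu
    · have hu := h.mem_beurlingIter hm hξ₀ hΩ ha hP hω.isWeight hω.upper
      exact h.notMem_roumieu hm hξ₀ (by linarith) hlt hΩ hx₀
        (Ultradiff.beurling_subset_roumieu _ Ω (hsub hu))
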